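/- **Definitions.** A *pin sequence* is an infinite word $w=w_1w_2\cdots$ over the alphabet $\{\mathsf l_{\mathsf u},\mathsf l_{\mathsf d},\mathsf r_{\mathsf u},\mathsf r_{\mathsf d},\mathsf u_{\mathsf l},\mathsf u_{\mathsf r},\mathsf d_{\mathsf l},\mathsf d_{\mathsf r}\}$ in which the subscript of each letter $w_{i+1}$ is the main symbol of $w_i$. It encodes an infinite permutation $\pi_w$ in the plane, gridded by the two coordinate axes, with points $p_1,p_2,\dots$: the point $p_1$ lies in the quadrant spanned by the two directions of $w_1$ (for example, quadrant 1 if $w_1\in\{\mathsf r_{\mathsf u},\mathsf u_{\mathsf r}\}$), and for $i\ge 2$ the point $p_i$ lies outside the rectangular hull of $\{(0,0),p_1,\dots,p_{i-1}\}$, in the direction (left, right, up or down) given by the main symbol of $w_i$, and separates $p_{i-1}$, horizontally or vertically, from $\{(0,0),p_1,\dots,p_{i-2}\}$. The *pin class* $\mathcal C_w$ is the set of all finite gridded permutations contained in $\pi_w$, where containment respects the quadrants. Write $\mathcal C_{w,n}$ for its members of length $n$, and $\mathrm{gr}(\mathcal C_w)=\lim_{n\to\infty}|\mathcal C_{w,n}|^{1/n}$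 for its growth rate. Let $\mu\approx 3.28277$ be the largest real zero of $z^5-4z^4+3z^3-2z^2-z+2$, and let $\kappa\approx 2.20557$ be the largest real zero of $z^3-2z^2-1$. For $\ell\ge 1$ let $\nu_\ell$ be the largest real zero of - $z^4-3z^3-2$, if $\ell=1$ (so $\nu_1\approx 3.06918$); - $z^4-3z^3-2z-2$, if $\ell=2$ (so $\nu_2\approx 3.24796$); - $z^{2\ell}-4z^{2\ell-1}+3z^{2\ell-2}-2z^{2\ell-3}-z^{2\ell-4}+2z^{2\ell-5}+1$, if $\ell\ge 3$. **Theorem.** Let $w$ be a pin sequence with $\mathrm{gr}(\mathcal C_w)<\mu$ (it is enough that $\liminf_{n\to\infty}|\mathcal C_{w,n}|^{1/n}<\mu$). Then $w$ is eventually periodic. Moreover, the growth rate $\mathrm{gr}(\mathcal C_w)$ exists, and either $\mathrm{gr}(\mathcal C_w)=\kappa$, or $\mathrm{gr}(\mathcal C_w)=\nu_\ell=\mathrm{gr}(\mathcal C_{w_{1,\ell}})$ for some $\ell\ge 1$, where $w_{1,\ell}=\big(\mathsf l\,\mathsf u\,(\mathsf r\,\mathsf u)^\ell\big)^\infty$ is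 the periodic pin sequence, each letter of which carries as subscript the main symbol of its predecessor (and the first letter is $\mathsf l_{\mathsf u}$). -/

import Mathlib

open Filter Topology
open scoped ENNReal

/-- The four directions: left, right, up, down. -/
inductive PinDir
  | l | r | u | d
  deriving DecidableEq

/-- The unit vector of a direction. -/
def PinDir.vec : PinDir → ℤ × ℤ
  | .l => (-1, 0)
  | .r => (1, 0)
  | .u => (0, 1)
  | .d => (0, -1)

/-- The eight letters of the memory encoding. The letter `ru` is a right pin that follows an up
pin, and similarly for the other letters. -/
inductive PinLetter
  | lu | ld | ru | rd | ul | ur | dl | dr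
  deriving DecidableEq

/-- The direction of the pin encoded by a letter. -/
def PinLetter.dir : PinLetter → PinDir
  | .lu => .l
  | .ld => .l
  | .ru => .r
  | .rd => .r
  | .ul => .u
  | .ur => .u
  | .dl => .d
  | .dr => .d

/-- The direction of the preceding pin, as recorded in a letter (its subscript). -/
def PinLetter.prev : PinLetter → PinDir
  | .lu => .u
  | .ld => .d
  | .ru => .u
  | .rd => .d
  | .ul => .l
  | .ur => .r
  | .dl => .l
  | .dr => .r

/-- An infinite word over the memory alphabet is a pin sequence if the subscript of each letter
is the direction of the letter before it. Every letter may come first. -/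
def IsPinSequence (w : ℕ → PinLetter) : Prop :=
  ∀ i, (w (i + 1)).prev = (w i).dir

/-- The points of the infinite pin permutation of `w`, with `w 0` encoding the first point.

Pin `i` has coordinate `2 * i + 4` (in absolute value) in its own direction and `2 * i + 1` in the
direction of the preceding pin. All coordinates of earlier pins have absolute value at most
`2 * i + 2`, so that pin `i` lies outside the rectangular hull of the origin and the earlier pins.
For `i ≥ 1`, pin `i - 1` has coordinate `2 * i + 2` in its own direction, while all the pins before
it have coordinates of absolute value at most `2 * i`; so pin `i` separates pin `i - 1` from the
origin and the pins before it. The first point lies in the quadrant spanned by the direction and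
the subscript of its letter. No two points share a coordinate. -/
def pinPoint (w : ℕ → PinLetter) (i : ℕ) : ℤ × ℤ :=
  (2 * (i : ℤ) + 4) • (w i).dir.vec + (2 * (i : ℤ) + 1) • (w i).prev.vec

/-- A permutation of length `n` in the `2 × 2` gridded plane. The plot of `perm` consists of the
points `(i, perm i)`; the vertical line has exactly the first `left` columns on its left, and the
horizontal line has exactly the lowest `below` rows below it. Two such gridded permutations have
the same points in each cell if and only if they are equal. -/
@[ext]
structure GriddedPerm (n : ℕ) where
  perm : Equiv.Perm (Fin n)
  left : Fin (n + 1)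
  below : Fin (n + 1)

/-- `σ ≤ π_w`: the gridded permutation `σ` embeds into the gridded infinite pin permutation of `w`,
where the two grid lines of the latter are the coordinate axes. The column `i` of `σ` is sent to
the pin with index `f i`. -/
def GriddedPerm.ContainedInPins {n : ℕ} (σ : GriddedPerm n) (w : ℕ → PinLetter) : Prop :=
  ∃ f : Fin n → ℕ,
    (∀ i j : Fin n, i < j ↔ (pinPoint w (f i)).1 < (pinPoint w (f j)).1) ∧
    (∀ i j : Fin n, σ.perm i < σ.perm j ↔ (pinPoint w (f i)).2 < (pinPoint w (f j)).2) ∧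
    (∀ i : Fin n, (i : ℕ) < (σ.left : ℕ) ↔ (pinPoint w (f i)).1 < 0) ∧
    (∀ i : Fin n, (σ.perm i : ℕ) < (σ.below : ℕ) ↔ (pinPoint w (f i)).2 < 0)

/-- The members of length `n` of the pin class `C_w`: all gridded permutations of length `n`
contained in the pin permutation of `w`. -/
def pinClass (w : ℕ → PinLetter) (n : ℕ) : Set (GriddedPerm n) :=
  {σ | σ.ContainedInPins w}

/-- The number of members of length `n` of the pin class (a set of permutations of a finite set
with finitely many griddings, hence finite). -/
noncomputable def pinClassCount (w : ℕ → PinLetter) (n : ℕ) : ℕ :=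
  (pinClass w n).ncard

/-- The lower growth rate `liminf (s n) ^ (1 / n)`, an extended non-negative real. -/
noncomputable def lowerGrowthRate (s : ℕ → ℕ) : ℝ≥0∞ :=
  liminf (fun n : ℕ => (s n : ℝ≥0∞) ^ (1 / (n : ℝ))) atTop

/-- The growth rate of the sequence `s` exists and equals `g`. -/
def HasGrowthRate (s : ℕ → ℕ) (g : ℝ) : Prop :=
  Tendsto (fun n : ℕ => (s n : ℝ) ^ (1 / (n : ℝ))) atTop (𝓝 g)

/-- `x` is the largest real zero of the function `f`. -/
def IsLargestRealZero (f : ℝ → ℝ) (x : ℝ) : Prop :=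
  IsGreatest {z : ℝ | f z = 0} x

/-- The word `w` is of the form `u v v v ⋯` with `u` and `v` finite words, `v` non-empty. -/
def IsEventuallyPeriodic (w : ℕ → PinLetter) : Prop :=
  ∃ N p : ℕ, 0 < p ∧ ∀ i, N ≤ i → w (i + p) = w i

/-- The periodic pin sequence `(l u (r u)^ℓ)^∞`. -/
def oneEllWord (ℓ : ℕ) (i : ℕ) : PinLetter :=
  if i / 2 % (ℓ + 1) = 0 then
    if i % 2 = 0 then .lu else .ul
  else
    if i % 2 = 0 then .ru else .ur

/-- The polynomial whose largest real zero is `ν_ℓ`, for `ℓ ≥ 1`. -/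
def nuPoly (ℓ : ℕ) (z : ℝ) : ℝ :=
  if ℓ = 1 then z ^ 4 - 3 * z ^ 3 - 2
  else if ℓ = 2 then z ^ 4 - 3 * z ^ 3 - 2 * z - 2
  else z ^ (2 * ℓ) - 4 * z ^ (2 * ℓ - 1) + 3 * z ^ (2 * ℓ - 2) - 2 * z ^ (2 * ℓ - 3)
    - z ^ (2 * ℓ - 4) + 2 * z ^ (2 * ℓ - 5) + 1

/-!
Members of the pin class of length `n` correspond to isomorphism classes of `n`-sets of pins, where
an isomorphism keeps the quadrants and the orders of the distances from the axes among points on the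
same side (`card_le_pinClassCount`, `pinClassCount_le_card`). As a pin separates only its immediate
predecessor from the origin, a set of pins is the box sum, from the inside to the outside, of its
maximal runs of consecutive pins (`pinConf_union_iso`). Conversely, a box sum of strongly connected
blocks determines the blocks, and their order up to exchanges of neighbours in opposite quadrants
(`Conf.list_injective`). So runs of pins that recur in the sequence give lower bounds by counting
lists of blocks (`exists_le_pinClassCount`), and upper bounds hold where all runs recur
(`exists_pinClassCount_le`).

If all four directions recur, then a few short blocks yield a growth rate of at least
`3.3 > μ`: single points if all quadrants recur (`le_lowerGrowthRate_of_four_quadrants`), and the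
entries into the two neighbours of the avoided quadrant otherwise
(`le_lowerGrowthRate_of_three_quadrants`). Hence some direction is eventually avoided, and by
symmetry this is the direction down.

Such a sequence is a binary sequence `h` from some point on, which records whether the horizontal
pins go to the right. Its blocks are indexed by the words that recur in `h`, up to a few coincidences
of small blocks, and their generating function `runGF` only depends on the complexity function of
`h`, that is the number of recurrent words of each length, and on the number of doubled letters
among the words of length two. For the complexity `m + 1` the generating function equals `1` at
`1 / μ`, so that the growth rate is at least `μ` if the complexity exceeds `m` for all `m`. Otherwise
the complexity stagnates first at some `ℓ`, and `h` is eventually periodic by the argument of Morse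
and Hedlund (`exists_periodic`). If the complexity is more than `m + 1` at some `m ≤ ℓ`, then the
growth rate is still at least `μ` (`UpperTail.mu_le_of_jump`). Else it equals `min m ℓ + 1`, just as
for the word `(l u (r u)^ℓ)^∞` (`complexity_oneEll`), and the generating function equals `1` at the
reciprocal of `κ` for `ℓ = 0` and of `ν_ℓ` for `ℓ ≥ 1`.
-/

/-! ### Coordinates of pins -/

/-- Pin `i` is a left or right pin. -/
def isHor (w : ℕ → PinLetter) (i : ℕ) : Bool :=
  match (w i).dir with
  | .l => true
  | .r => true
  | .u => false
  | .d => false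

/-- Pin `i` lies to the right of the vertical axis. -/
def isRight (w : ℕ → PinLetter) (i : ℕ) : Bool := decide (0 < (pinPoint w i).1)

/-- Pin `i` lies above the horizontal axis. -/
def isUp (w : ℕ → PinLetter) (i : ℕ) : Bool := decide (0 < (pinPoint w i).2)

/-- The distance of pin `i` from the vertical axis. -/
def absX (w : ℕ → PinLetter) (i : ℕ) : ℕ := 2 * i + 1 + if isHor w i then 3 else 0

/-- The distance of pin `i` from the horizontal axis. -/
def absY (w : ℕ → PinLetter) (i : ℕ) : ℕ := 2 * i + 1 + if isHor w i then 0 else 3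

lemma pinPoint_fst (w : ℕ → PinLetter) (i : ℕ) :
    (pinPoint w i).1 = if isRight w i then (absX w i : ℤ) else -(absX w i : ℤ) := by
  unfold isRight absX isHor pinPoint
  cases w i <;> simp [PinLetter.dir, PinLetter.prev, PinDir.vec] <;> (try split_ifs) <;> omega

lemma pinPoint_snd (w : ℕ → PinLetter) (i : ℕ) :
    (pinPoint w i).2 = if isUp w i then (absY w i : ℤ) else -(absY w i : ℤ) := by
  unfold isUp absY isHor pinPoint
  cases w i <;> simp [PinLetter.dir, PinLetter.prev, PinDir.vec] <;> (try split_ifs) <;> omega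

lemma absX_pos (w : ℕ → PinLetter) (i : ℕ) : 0 < absX w i := by unfold absX; omega

lemma absY_pos (w : ℕ → PinLetter) (i : ℕ) : 0 < absY w i := by unfold absY; omega

lemma isHor_succ {w : ℕ → PinLetter} (hw : IsPinSequence w) (i : ℕ) :
    isHor w (i + 1) = !isHor w i := by
  have := hw i
  unfold isHor
  revert this
  cases w i <;> cases w (i + 1) <;> simp [PinLetter.dir, PinLetter.prev]

lemma isHor_add {w : ℕ → PinLetter} (hw : IsPinSequence w) (i j : ℕ) :
    isHor w (i + j) = (isHor w i ^^ decide (j % 2 = 1)) := by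
  induction j with
  | zero => simp
  | succ j ih =>
    rw [← add_assoc, isHor_succ hw, ih]
    rcases Nat.mod_two_eq_zero_or_one j with h | h
    · simp [h, Nat.add_mod]
    · simp [h, Nat.add_mod]

lemma isUp_succ {w : ℕ → PinLetter} (hw : IsPinSequence w) {i : ℕ} (h : isHor w i = false) :
    isUp w (i + 1) = isUp w i := by
  have := hw i
  unfold isUp pinPoint
  unfold isHor at h
  revert this h
  cases w i <;> cases w (i + 1) <;> simp [PinLetter.dir, PinLetter.prev, PinDir.vec] <;> omega

lemma isRight_succ {w : ℕ → PinLetter} (hw : IsPinSequence w) {i : ℕ} (h : isHor w i = true) :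
    isRight w (i + 1) = isRight w i := by
  have := hw i
  unfold isRight pinPoint
  unfold isHor at h
  revert this h
  cases w i <;> cases w (i + 1) <;> simp [PinLetter.dir, PinLetter.prev, PinDir.vec] <;> omega

lemma absX_injective (w : ℕ → PinLetter) : Function.Injective (absX w) := by
  intro i j h
  unfold absX at h
  split_ifs at h <;> omega

lemma absY_injective (w : ℕ → PinLetter) : Function.Injective (absY w) := by
  intro i j h
  unfold absY at h
  split_ifs at h <;> omega

/-! ### Configurations of points around the origin -/

/-- The order-theoretic content of a finite set of points off the axes: for each point the side of
either axis on which it lies, and for each two points on the same side of an axis which of them is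
closer to that axis. The relations `inX` and `inY` carry no information for points on different
sides. -/
structure Conf where
  /-- The points. -/
  ι : Type
  /-- The point lies to the right of the vertical axis. -/
  right : ι → Bool
  /-- The point lies above the horizontal axis. -/
  up : ι → Bool
  /-- The first point is closer to the vertical axis than the second. -/
  inX : ι → ι → Prop
  /-- The first point is closer to the horizontal axis than the second. -/
  inY : ι → ι → Prop

namespace Conf

/-- A bijection between the points that keeps sides, and that keeps distances in order among the
points on one side. -/
structure IsoMap (C D : Conf) where
  /-- The bijection. -/
  e : C.ι ≃ D.ι
  right : ∀ a, D.right (e a) = C.right a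
  up : ∀ a, D.up (e a) = C.up a
  inX : ∀ a b, C.right a = C.right b → (D.inX (e a) (e b) ↔ C.inX a b)
  inY : ∀ a b, C.up a = C.up b → (D.inY (e a) (e b) ↔ C.inY a b)

/-- Two configurations are isomorphic. -/
def Iso (C D : Conf) : Prop := Nonempty (IsoMap C D)

lemma Iso.refl (C : Conf) : Iso C C := ⟨⟨Equiv.refl _, by simp, by simp, by simp, by simp⟩⟩

/-- The inverse of an isomorphism. -/
def IsoMap.symm {C D : Conf} (f : IsoMap C D) : IsoMap D C where
  e := f.e.symm
  right a := by rw [← f.right]; simp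
  up a := by rw [← f.up]; simp
  inX a b h := by rw [← f.inX _ _ (by rw [← f.right, ← f.right]; simpa using h)]; simp
  inY a b h := by rw [← f.inY _ _ (by rw [← f.up, ← f.up]; simpa using h)]; simp

lemma Iso.symm {C D : Conf} (h : Iso C D) : Iso D C := h.elim fun f => ⟨f.symm⟩

lemma Iso.trans {C D E : Conf} (h : Iso C D) (h' : Iso D E) : Iso C E := by
  obtain ⟨f⟩ := h
  obtain ⟨g⟩ := h'
  refine ⟨⟨f.e.trans g.e, ?_, ?_, ?_, ?_⟩⟩
  · intro a; simp [g.right, f.right]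
  · intro a; simp [g.up, f.up]
  · intro a b h
    simp only [Equiv.trans_apply]
    rw [g.inX _ _ (by rw [f.right, f.right, h]), f.inX _ _ h]
  · intro a b h
    simp only [Equiv.trans_apply]
    rw [g.inY _ _ (by rw [f.up, f.up, h]), f.inY _ _ h]

/-- The box sum: the points of `D` are placed outside the rectangular hull of the origin and the
points of `C`, without separating them. -/
def sum (C D : Conf) : Conf where
  ι := C.ι ⊕ D.ι
  right := Sum.elim C.right D.right
  up := Sum.elim C.up D.up
  inX a b := match a, b with
    | .inl a, .inl b => C.inX a b
    | .inl _, .inr _ => True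
    | .inr _, .inl _ => False
    | .inr a, .inr b => D.inX a b
  inY a b := match a, b with
    | .inl a, .inl b => C.inY a b
    | .inl _, .inr _ => True
    | .inr _, .inl _ => False
    | .inr a, .inr b => D.inY a b

/-- The configuration without points. -/
def empty : Conf := ⟨Empty, fun _ => true, fun _ => true, fun _ _ => True, fun _ _ => True⟩

lemma Iso.sum {C C' D D' : Conf} (h : Iso C C') (h' : Iso D D') : Iso (C.sum D) (C'.sum D') := by
  obtain ⟨f⟩ := h
  obtain ⟨g⟩ := h'
  refine ⟨⟨Equiv.sumCongr f.e g.e, ?_, ?_, ?_, ?_⟩⟩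
  · rintro (a | a)
    · exact f.right a
    · exact g.right a
  · rintro (a | a)
    · exact f.up a
    · exact g.up a
  · rintro (a | a) (b | b) h
    · exact f.inX a b h
    · exact Iff.rfl
    · exact Iff.rfl
    · exact g.inX a b h
  · rintro (a | a) (b | b) h
    · exact f.inY a b h
    · exact Iff.rfl
    · exact Iff.rfl
    · exact g.inY a b h

lemma sum_assoc_iso (C D E : Conf) : Iso ((C.sum D).sum E) (C.sum (D.sum E)) := by
  refine ⟨⟨Equiv.sumAssoc _ _ _, ?_, ?_, ?_, ?_⟩⟩
  · rintro ((a | a) | a) <;> rfl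
  · rintro ((a | a) | a) <;> rfl
  · rintro ((a | a) | a) ((b | b) | b) h <;> exact Iff.rfl
  · rintro ((a | a) | a) ((b | b) | b) h <;> exact Iff.rfl

lemma empty_sum_iso (C : Conf) : Iso (empty.sum C) C := by
  refine ⟨⟨Equiv.emptySum Empty _, ?_, ?_, ?_, ?_⟩⟩
  · rintro (a | a)
    · exact a.elim
    · rfl
  · rintro (a | a)
    · exact a.elim
    · rfl
  · rintro (a | a) (b | b) h
    all_goals first | exact a.elim | exact b.elim | exact Iff.rfl
  · rintro (a | a) (b | b) h
    all_goals first | exact a.elim | exact b.elim | exact Iff.rfl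

lemma sum_empty_iso (C : Conf) : Iso (C.sum empty) C := by
  refine ⟨⟨Equiv.sumEmpty _ Empty, ?_, ?_, ?_, ?_⟩⟩
  · rintro (a | a)
    · rfl
    · exact a.elim
  · rintro (a | a)
    · rfl
    · exact a.elim
  · rintro (a | a) (b | b) h
    all_goals first | exact a.elim | exact b.elim | exact Iff.rfl
  · rintro (a | a) (b | b) h
    all_goals first | exact a.elim | exact b.elim | exact Iff.rfl

end Conf

/-- The configuration formed by the pins with indices in `I`. -/
def pinConf (w : ℕ → PinLetter) (I : Finset ℕ) : Conf where
  ι := I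
  right i := isRight w i
  up i := isUp w i
  inX i j := absX w i < absX w j
  inY i j := absY w i < absY w j

lemma pinConf_iso_iff {w w' : ℕ → PinLetter} {I J : Finset ℕ} :
    (pinConf w I).Iso (pinConf w' J) ↔ ∃ e : I ≃ J,
      (∀ a : I, isRight w' (e a) = isRight w a) ∧ (∀ a : I, isUp w' (e a) = isUp w a) ∧
      (∀ a b : I, isRight w a = isRight w b →
        (absX w' (e a) < absX w' (e b) ↔ absX w a < absX w b)) ∧
      (∀ a b : I, isUp w a = isUp w b →
        (absY w' (e a) < absY w' (e b) ↔ absY w a < absY w b)) :=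
  ⟨fun ⟨f⟩ => ⟨f.e, f.right, f.up, f.inX, f.inY⟩,
    fun ⟨e, h1, h2, h3, h4⟩ => ⟨⟨e, h1, h2, h3, h4⟩⟩⟩

lemma card_eq_of_iso {w w' : ℕ → PinLetter} {I J : Finset ℕ}
    (h : (pinConf w I).Iso (pinConf w' J)) : I.card = J.card := by
  obtain ⟨f⟩ := h
  have := Fintype.card_congr (α := I) (β := J) f.e
  simpa using this

/-! ### Gridded permutations as configurations -/

instance GriddedPerm.finite (n : ℕ) : Finite (GriddedPerm n) := by
  have : Function.Injective
      (fun σ : GriddedPerm n => (σ.perm, σ.left, σ.below)) := by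
    intro σ τ h
    simp only [Prod.mk.injEq] at h
    exact GriddedPerm.ext h.1 h.2.1 h.2.2
  exact Finite.of_injective _ this

/-- `f` embeds `σ` into the pin permutation of `w`. -/
def GriddedPerm.EmbedsBy {n : ℕ} (σ : GriddedPerm n) (w : ℕ → PinLetter) (f : Fin n → ℕ) : Prop :=
  (∀ i j : Fin n, i < j ↔ (pinPoint w (f i)).1 < (pinPoint w (f j)).1) ∧
    (∀ i j : Fin n, σ.perm i < σ.perm j ↔ (pinPoint w (f i)).2 < (pinPoint w (f j)).2) ∧
    (∀ i : Fin n, (i : ℕ) < (σ.left : ℕ) ↔ (pinPoint w (f i)).1 < 0) ∧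
    (∀ i : Fin n, (σ.perm i : ℕ) < (σ.below : ℕ) ↔ (pinPoint w (f i)).2 < 0)

lemma GriddedPerm.EmbedsBy.injective {n : ℕ} {σ : GriddedPerm n} {w : ℕ → PinLetter}
    {f : Fin n → ℕ} (h : σ.EmbedsBy w f) : Function.Injective f := by
  intro i j hij
  by_contra hne
  rcases lt_or_gt_of_ne hne with h' | h'
  · have := (h.1 i j).1 h'
    rw [hij] at this
    exact lt_irrefl _ this
  · have := (h.1 j i).1 h'
    rw [hij] at this
    exact lt_irrefl _ this

lemma exists_fin_cut {n : ℕ} (P : Fin n → Prop) (hP : ∀ i j, i ≤ j → P j → P i) :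
    ∃ k : Fin (n + 1), ∀ i : Fin n, (i : ℕ) < (k : ℕ) ↔ P i := by
  classical
  by_cases h : ∃ i : ℕ, ∃ hi : i < n, ¬P ⟨i, hi⟩
  · have hs := Nat.find_spec h
    obtain ⟨hk, hnP⟩ := hs
    refine ⟨⟨Nat.find h, by omega⟩, fun i => ⟨fun hi => ?_, fun hi => ?_⟩⟩
    · by_contra hc
      exact Nat.find_min h hi ⟨i.2, hc⟩
    · by_contra hc
      exact hnP (hP _ _ (by simpa [Fin.le_def] using hc) hi)
  · push Not at h
    exact ⟨⟨n, by omega⟩, fun i => ⟨fun _ => h i i.2, fun _ => i.2⟩⟩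

lemma pinPoint_fst_injective (w : ℕ → PinLetter) :
    Function.Injective fun i => (pinPoint w i).1 := by
  intro i j h
  simp only [pinPoint_fst] at h
  have := absX_pos w i
  have := absX_pos w j
  apply absX_injective w
  split_ifs at h <;> omega

lemma pinPoint_snd_injective (w : ℕ → PinLetter) :
    Function.Injective fun i => (pinPoint w i).2 := by
  intro i j h
  simp only [pinPoint_snd] at h
  have := absY_pos w i
  have := absY_pos w j
  apply absY_injective w
  split_ifs at h <;> omega

/-- Every finite set of pins is the image of an embedding. -/
lemma exists_embedsBy (w : ℕ → PinLetter) {n : ℕ} {I : Finset ℕ}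
    (hI : I.card = n) :
    ∃ (σ : GriddedPerm n) (f : Fin n → ℕ), σ.EmbedsBy w f ∧ Finset.univ.image f = I := by
  classical
  set x : ℕ → ℤ := fun i => (pinPoint w i).1 with hx
  set y : ℕ → ℤ := fun i => (pinPoint w i).2 with hy
  have xinj : Function.Injective x := pinPoint_fst_injective w
  have yinj : Function.Injective y := pinPoint_snd_injective w
  have hX : (I.image x).card = n := by rw [Finset.card_image_of_injective _ xinj, hI]
  have hY : (I.image y).card = n := by rw [Finset.card_image_of_injective _ yinj, hI]
  have ex : ∀ k : Fin n, ∃ i ∈ I, x i = (I.image x).orderIsoOfFin hX k := fun k => by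
    exact Finset.mem_image.1 ((I.image x).orderIsoOfFin hX k).2
  choose f hfI hfx using ex
  have hord : ∀ i j : Fin n, i < j ↔ x (f i) < x (f j) := by
    intro i j
    rw [hfx, hfx, Subtype.coe_lt_coe]
    exact ((I.image x).orderIsoOfFin hX).lt_iff_lt.symm
  have finj : Function.Injective f := by
    intro i j hij
    have : ((I.image x).orderIsoOfFin hX i) = ((I.image x).orderIsoOfFin hX j) := by
      apply Subtype.ext; rw [← hfx, ← hfx, hij]
    exact ((I.image x).orderIsoOfFin hX).injective this
  have himg : Finset.univ.image f = I := by
    apply Finset.eq_of_subset_of_card_le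
    · intro i hi
      obtain ⟨k, -, rfl⟩ := Finset.mem_image.1 hi
      exact hfI k
    · rw [Finset.card_image_of_injective _ finj, hI]; simp
  set r : Fin n → Fin n := fun k => ((I.image y).orderIsoOfFin hY).symm
    ⟨y (f k), Finset.mem_image_of_mem _ (hfI k)⟩ with hr
  have hrlt : ∀ i j, r i < r j ↔ y (f i) < y (f j) := by
    intro i j
    rw [hr]
    simp only [OrderIso.lt_iff_lt, Subtype.mk_lt_mk]
  have rinj : Function.Injective r := by
    intro i j hij
    have := ((I.image y).orderIsoOfFin hY).symm.injective hij
    simp only [Subtype.mk.injEq] at this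
    exact finj (yinj this)
  set p : Equiv.Perm (Fin n) := Equiv.ofBijective r (Finite.injective_iff_bijective.1 rinj) with hp
  have hpr : ∀ i, p i = r i := fun i => rfl
  obtain ⟨a, ha⟩ := exists_fin_cut (fun i : Fin n => x (f i) < 0) (fun i j hij h => by
    rcases hij.lt_or_eq with h' | rfl
    · exact ((hord i j).1 h').trans h
    · exact h)
  obtain ⟨b, hb⟩ := exists_fin_cut (fun i : Fin n => y (f (p.symm i)) < 0) (fun i j hij h => by
    rcases hij.lt_or_eq with h' | rfl
    · refine lt_trans ((hrlt _ _).1 ?_) h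
      rw [← hpr, ← hpr]
      simpa using h'
    · exact h)
  refine ⟨⟨p, a, b⟩, f, ⟨hord, ?_, ha, ?_⟩, himg⟩
  · exact hrlt
  · intro i
    have := hb (p i)
    simpa using this

lemma fst_lt_iff (w : ℕ → PinLetter) (i j : ℕ) : (pinPoint w i).1 < (pinPoint w j).1 ↔
    (isRight w i = false ∧ isRight w j = true) ∨
      (isRight w i = isRight w j ∧ (if isRight w i then absX w i < absX w j
        else absX w j < absX w i)) := by
  rw [pinPoint_fst, pinPoint_fst]
  have := absX_pos w i
  have := absX_pos w j
  cases isRight w i <;> cases isRight w j <;> simp <;> omega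

lemma snd_lt_iff (w : ℕ → PinLetter) (i j : ℕ) : (pinPoint w i).2 < (pinPoint w j).2 ↔
    (isUp w i = false ∧ isUp w j = true) ∨
      (isUp w i = isUp w j ∧ (if isUp w i then absY w i < absY w j
        else absY w j < absY w i)) := by
  rw [pinPoint_snd, pinPoint_snd]
  have := absY_pos w i
  have := absY_pos w j
  cases isUp w i <;> cases isUp w j <;> simp <;> omega

lemma fst_neg_iff (w : ℕ → PinLetter) (i : ℕ) : (pinPoint w i).1 < 0 ↔ isRight w i = false := by
  rw [pinPoint_fst]
  have := absX_pos w i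
  cases isRight w i <;> simp <;> omega

lemma snd_neg_iff (w : ℕ → PinLetter) (i : ℕ) : (pinPoint w i).2 < 0 ↔ isUp w i = false := by
  rw [pinPoint_snd]
  have := absY_pos w i
  cases isUp w i <;> simp <;> omega

lemma perm_eq_of_lt_iff {n : ℕ} {p q : Equiv.Perm (Fin n)} (h : ∀ i j, p i < p j ↔ q i < q j) :
    p = q := by
  have hm : StrictMono (q ∘ p.symm) := by
    intro i j hij
    have := (h (p.symm i) (p.symm j)).1 (by simpa using hij)
    simpa using this
  let o : Fin n ≃o Fin n := StrictMono.orderIsoOfSurjective _ hm (q.surjective.comp p.symm.surjective)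
  have ho : o = OrderIso.refl _ := Subsingleton.elim _ _
  ext i
  have h1 : o (p i) = p i := by rw [ho]; rfl
  have h2 : o (p i) = q i := by simp [o]
  rw [← h2, h1]

/-- A gridded permutation is determined by the isomorphism type of its image in the pins. -/
lemma GriddedPerm.eq_of_embedsBy {n : ℕ} {σ τ : GriddedPerm n} {w : ℕ → PinLetter}
    {f g : Fin n → ℕ} (hf : σ.EmbedsBy w f) (hg : τ.EmbedsBy w g)
    (h : (pinConf w (Finset.univ.image f)).Iso (pinConf w (Finset.univ.image g))) : σ = τ := by
  classical
  obtain ⟨e⟩ := h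
  let e' : ↥(Finset.univ.image f) ≃ ↥(Finset.univ.image g) := e.e
  have finj := hf.injective
  have ginj := hg.injective
  have hmem : ∀ k : Fin n, f k ∈ Finset.univ.image f := fun k => Finset.mem_image_of_mem _ (by simp)
  have ex : ∀ k : Fin n, ∃ m : Fin n, g m = e' ⟨f k, hmem k⟩ := by
    intro k
    obtain ⟨m, -, hm⟩ := Finset.mem_image.1 (e' ⟨f k, hmem k⟩).2
    exact ⟨m, hm⟩
  choose s hs using ex
  have hR : ∀ k, isRight w (g (s k)) = isRight w (f k) := fun k => by
    rw [hs]; exact e.right ⟨f k, hmem k⟩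
  have hU : ∀ k, isUp w (g (s k)) = isUp w (f k) := fun k => by
    rw [hs]; exact e.up ⟨f k, hmem k⟩
  have hX : ∀ k l, isRight w (f k) = isRight w (f l) →
      (absX w (g (s k)) < absX w (g (s l)) ↔ absX w (f k) < absX w (f l)) := fun k l hkl => by
    rw [hs, hs]; exact e.inX ⟨f k, hmem k⟩ ⟨f l, hmem l⟩ hkl
  have hY : ∀ k l, isUp w (f k) = isUp w (f l) →
      (absY w (g (s k)) < absY w (g (s l)) ↔ absY w (f k) < absY w (f l)) := fun k l hkl => by
    rw [hs, hs]; exact e.inY ⟨f k, hmem k⟩ ⟨f l, hmem l⟩ hkl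
  have hx : ∀ k l, (pinPoint w (g (s k))).1 < (pinPoint w (g (s l))).1 ↔
      (pinPoint w (f k)).1 < (pinPoint w (f l)).1 := by
    intro k l
    rw [fst_lt_iff, fst_lt_iff, hR, hR]
    by_cases hkl : isRight w (f k) = isRight w (f l)
    · rw [hX k l hkl, hX l k hkl.symm]
    · simp [hkl]
  have hy : ∀ k l, (pinPoint w (g (s k))).2 < (pinPoint w (g (s l))).2 ↔
      (pinPoint w (f k)).2 < (pinPoint w (f l)).2 := by
    intro k l
    rw [snd_lt_iff, snd_lt_iff, hU, hU]
    by_cases hkl : isUp w (f k) = isUp w (f l)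
    · rw [hY k l hkl, hY l k hkl.symm]
    · simp [hkl]
  have sinj : Function.Injective s := by
    intro k l hkl
    have h1 : e' ⟨f k, hmem k⟩ = e' ⟨f l, hmem l⟩ := by
      apply Subtype.ext; rw [← hs, ← hs, hkl]
    have h2 := e'.injective h1
    simp only [Subtype.mk.injEq] at h2
    exact finj h2
  have hs1 : ∀ k, s k = k := by
    have : Equiv.ofBijective s (Finite.injective_iff_bijective.1 sinj) = Equiv.refl _ := by
      apply perm_eq_of_lt_iff
      intro i j
      simp only [Equiv.ofBijective_apply, Equiv.refl_apply]
      rw [hg.1, hx, ← hf.1]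
    intro k
    exact congrArg (fun p : Equiv.Perm (Fin n) => p k) this
  simp only [hs1] at hx hy hR hU
  have hperm : σ.perm = τ.perm := by
    apply perm_eq_of_lt_iff
    intro i j
    rw [hf.2.1, hg.2.1, hy]
  have hcut : ∀ a b : Fin (n + 1), (∀ i : Fin n, (i : ℕ) < (a : ℕ) ↔ (i : ℕ) < (b : ℕ)) → a = b := by
    intro a b hab
    apply Fin.ext
    by_contra hne
    rcases lt_or_gt_of_ne hne with h' | h'
    · have := (hab ⟨a, by omega⟩).2 h'
      simp at this
    · have := (hab ⟨b, by omega⟩).1 h'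
      simp at this
  apply GriddedPerm.ext hperm
  · apply hcut
    intro i
    rw [hf.2.2.1, hg.2.2.1, fst_neg_iff, fst_neg_iff, hR]
  · apply hcut
    intro i
    have h1 := hf.2.2.2 (σ.perm.symm i)
    have h2 := hg.2.2.2 (σ.perm.symm i)
    rw [← hperm] at h2
    simp only [Equiv.apply_symm_apply] at h1 h2
    rw [h1, h2, snd_neg_iff, snd_neg_iff, hU]

/-- Two embeddings of one gridded permutation have isomorphic images. -/
lemma iso_of_embedsBy {n : ℕ} {σ : GriddedPerm n} {w w' : ℕ → PinLetter}
    {f g : Fin n → ℕ} (hf : σ.EmbedsBy w f) (hg : σ.EmbedsBy w' g) :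
    (pinConf w (Finset.univ.image f)).Iso (pinConf w' (Finset.univ.image g)) := by
  classical
  let ef : Fin n ≃ ↥(Finset.univ.image f) :=
    Equiv.ofBijective (fun k => ⟨f k, Finset.mem_image_of_mem _ (by simp)⟩)
      ⟨fun a b h => hf.injective (by simpa using h), fun ⟨b, hb⟩ => by
        obtain ⟨k, -, rfl⟩ := Finset.mem_image.1 hb; exact ⟨k, rfl⟩⟩
  let eg : Fin n ≃ ↥(Finset.univ.image g) :=
    Equiv.ofBijective (fun k => ⟨g k, Finset.mem_image_of_mem _ (by simp)⟩)
      ⟨fun a b h => hg.injective (by simpa using h), fun ⟨b, hb⟩ => by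
        obtain ⟨k, -, rfl⟩ := Finset.mem_image.1 hb; exact ⟨k, rfl⟩⟩
  have hR : ∀ k, isRight w' (g k) = isRight w (f k) := by
    intro k
    have := (hf.2.2.1 k).symm.trans (hg.2.2.1 k)
    rw [fst_neg_iff, fst_neg_iff] at this
    cases h1 : isRight w (f k) <;> cases h2 : isRight w' (g k) <;> simp_all
  have hU : ∀ k, isUp w' (g k) = isUp w (f k) := by
    intro k
    have := (hf.2.2.2 k).symm.trans (hg.2.2.2 k)
    rw [snd_neg_iff, snd_neg_iff] at this
    cases h1 : isUp w (f k) <;> cases h2 : isUp w' (g k) <;> simp_all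
  have hX : ∀ k l, isRight w (f k) = isRight w (f l) →
      (absX w' (g k) < absX w' (g l) ↔ absX w (f k) < absX w (f l)) := by
    intro k l hkl
    have h1 := (hf.1 k l).symm.trans (hg.1 k l)
    have h2 := (hf.1 l k).symm.trans (hg.1 l k)
    rw [fst_lt_iff, fst_lt_iff, hR, hR] at h1 h2
    cases h3 : isRight w (f l) <;> (rw [h3] at hkl; rw [hkl, h3] at h1 h2; simp at h1 h2)
    · omega
    · omega
  have hY : ∀ k l, isUp w (f k) = isUp w (f l) →
      (absY w' (g k) < absY w' (g l) ↔ absY w (f k) < absY w (f l)) := by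
    intro k l hkl
    have h1 := (hf.2.1 k l).symm.trans (hg.2.1 k l)
    have h2 := (hf.2.1 l k).symm.trans (hg.2.1 l k)
    rw [snd_lt_iff, snd_lt_iff, hU, hU] at h1 h2
    cases h3 : isUp w (f l) <;> (rw [h3] at hkl; rw [hkl, h3] at h1 h2; simp at h1 h2)
    · omega
    · omega
  refine pinConf_iso_iff.2 ⟨ef.symm.trans eg, ?_, ?_, ?_, ?_⟩
  · intro a
    obtain ⟨k, rfl⟩ := ef.surjective a
    simp only [Equiv.trans_apply, Equiv.symm_apply_apply]
    exact hR k
  · intro a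
    obtain ⟨k, rfl⟩ := ef.surjective a
    simp only [Equiv.trans_apply, Equiv.symm_apply_apply]
    exact hU k
  · intro a b h
    obtain ⟨k, rfl⟩ := ef.surjective a
    obtain ⟨l, rfl⟩ := ef.surjective b
    simp only [Equiv.trans_apply, Equiv.symm_apply_apply]
    exact hX k l h
  · intro a b h
    obtain ⟨k, rfl⟩ := ef.surjective a
    obtain ⟨l, rfl⟩ := ef.surjective b
    simp only [Equiv.trans_apply, Equiv.symm_apply_apply]
    exact hY k l h

lemma mem_pinClass_iff {w : ℕ → PinLetter} {n : ℕ} {σ : GriddedPerm n} :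
    σ ∈ pinClass w n ↔ ∃ f, σ.EmbedsBy w f := Iff.rfl

/-- A family of pairwise non-isomorphic `n`-sets of pins has at most `pinClassCount w n` members. -/
lemma card_le_pinClassCount (w : ℕ → PinLetter) {n : ℕ} {α : Type*}
    (F : Finset α) (I : α → Finset ℕ) (hI : ∀ a ∈ F, (I a).card = n)
    (hinj : ∀ a ∈ F, ∀ b ∈ F, (pinConf w (I a)).Iso (pinConf w (I b)) → a = b) :
    F.card ≤ pinClassCount w n := by
  classical
  have ex : ∀ a : F, ∃ (σ : GriddedPerm n) (f : Fin n → ℕ),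
      σ.EmbedsBy w f ∧ Finset.univ.image f = I a := fun a => exists_embedsBy w (hI a a.2)
  choose σ f hf hfI using ex
  have hσ : Function.Injective σ := by
    intro a b hab
    have h1 := iso_of_embedsBy (hf a) (hab ▸ hf b)
    rw [hfI, hfI] at h1
    exact Subtype.ext (hinj a a.2 b b.2 h1)
  have hsub : Set.range σ ⊆ pinClass w n := by
    rintro _ ⟨a, rfl⟩
    exact mem_pinClass_iff.2 ⟨f a, hf a⟩
  calc F.card = Nat.card F := by simp
    _ = (Set.range σ).ncard := by
      rw [← Set.image_univ, Set.ncard_image_of_injective _ hσ, Set.ncard_univ]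
    _ ≤ (pinClass w n).ncard := Set.ncard_le_ncard hsub (Set.toFinite _)

/-- If `n`-sets of pins with equal codes are isomorphic, then `pinClassCount w n` is at most the
number of codes. -/
lemma pinClassCount_le_card {w : ℕ → PinLetter} {n : ℕ} {β : Type*}
    (S : Finset β) (R : Finset ℕ → β → Prop)
    (hR : ∀ I : Finset ℕ, I.card = n → ∃ b ∈ S, R I b)
    (hiso : ∀ I J b, R I b → R J b → (pinConf w I).Iso (pinConf w J)) :
    pinClassCount w n ≤ S.card := by
  classical
  have ex : ∀ σ : pinClass w n, ∃ f, σ.1.EmbedsBy w f := fun σ => mem_pinClass_iff.1 σ.2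
  choose f hf using ex
  have hcard : ∀ σ, (Finset.univ.image (f σ)).card = n := fun σ => by
    rw [Finset.card_image_of_injective _ (hf σ).injective]; simp
  choose code hcS hcR using fun σ => hR _ (hcard σ)
  have hinj : Function.Injective fun σ : pinClass w n => (⟨code σ, hcS σ⟩ : S) := by
    intro σ τ h
    simp only [Subtype.mk.injEq] at h
    exact Subtype.ext (GriddedPerm.eq_of_embedsBy (hf σ) (hf τ) (hiso _ _ _ (hcR σ) (h ▸ hcR τ)))
  have := Nat.card_le_card_of_injective _ hinj
  simpa [pinClassCount, Nat.card_coe_set_eq] using this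

/-- The counting sequence only depends on the isomorphism relation between finite sets of pins. -/
lemma pinClassCount_congr {w w' : ℕ → PinLetter}
    (h : ∀ I J, (pinConf w I).Iso (pinConf w J) ↔ (pinConf w' I).Iso (pinConf w' J)) (n : ℕ) :
    pinClassCount w n = pinClassCount w' n := by
  classical
  have key : ∀ w w' : ℕ → PinLetter,
      (∀ I J, (pinConf w I).Iso (pinConf w J) ↔ (pinConf w' I).Iso (pinConf w' J)) →
      pinClassCount w n ≤ pinClassCount w' n := by
    intro w w' h
    have ex : ∀ σ : pinClass w n, ∃ f, σ.1.EmbedsBy w f := fun σ => mem_pinClass_iff.1 σ.2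
    choose f hf using ex
    have : Fintype (pinClass w n) := Fintype.ofFinite _
    have := card_le_pinClassCount w' (n := n) (Finset.univ : Finset (pinClass w n))
      (fun σ => Finset.univ.image (f σ))
      (fun σ _ => by rw [Finset.card_image_of_injective _ (hf σ).injective]; simp)
      (fun σ _ τ _ hστ => Subtype.ext (GriddedPerm.eq_of_embedsBy (hf σ) (hf τ) ((h _ _).2 hστ)))
    rwa [Finset.card_univ, ← Nat.card_eq_fintype_card, Nat.card_coe_set_eq] at this
  exact le_antisymm (key w w' h) (key w' w fun I J => (h I J).symm)

/-! ### Unique decomposition into blocks -/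

namespace Conf

/-- An arrow from `p` to `q`: the point `q` lies in the rectangular hull of the origin and `p`, or
separates it. A box summand that contains `p` and is not preceded by `q` contains `q`. -/
def Arrow (C : Conf) (p q : C.ι) : Prop :=
  (C.right q = C.right p ∧ C.inX q p) ∨ (C.up q = C.up p ∧ C.inY q p)

/-- There is a path of arrows. -/
def Reach (C : Conf) : C.ι → C.ι → Prop := Relation.ReflTransGen C.Arrow

/-- The configuration is non-empty, and any two points are joined by paths of arrows. -/
def StrongConn (C : Conf) : Prop := Nonempty C.ι ∧ ∀ p q, C.Reach p q

/-- All points lie in the quadrant with the given sides. -/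
def InQuadrant (C : Conf) (a b : Bool) : Prop := ∀ p, C.right p = a ∧ C.up p = b

lemma IsoMap.arrow {C D : Conf} (f : IsoMap C D) {p q : C.ι} (h : C.Arrow p q) :
    D.Arrow (f.e p) (f.e q) := by
  rcases h with ⟨h1, h2⟩ | ⟨h1, h2⟩
  · exact Or.inl ⟨by rw [f.right, f.right, h1], (f.inX _ _ h1).2 h2⟩
  · exact Or.inr ⟨by rw [f.up, f.up, h1], (f.inY _ _ h1).2 h2⟩

lemma IsoMap.reach {C D : Conf} (f : IsoMap C D) {p q : C.ι} (h : C.Reach p q) :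
    D.Reach (f.e p) (f.e q) :=
  Relation.ReflTransGen.lift f.e (fun _ _ => f.arrow) _ _ h

lemma reach_inl {C : Conf} (D : Conf) {p q : C.ι} (h : C.Reach p q) :
    (C.sum D).Reach (Sum.inl p : C.ι ⊕ D.ι) (Sum.inl q : C.ι ⊕ D.ι) :=
  Relation.ReflTransGen.lift (p := (C.sum D).Arrow) (Sum.inl : C.ι → C.ι ⊕ D.ι)
    (fun _ _ h => h) _ _ h

lemma not_arrow_inl_inr {C D : Conf} (p : C.ι) (q : D.ι) :
    ¬(C.sum D).Arrow (Sum.inl p : C.ι ⊕ D.ι) (Sum.inr q : C.ι ⊕ D.ι) := by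
  rintro (⟨-, h⟩ | ⟨-, h⟩) <;> exact h

/-- The inner summand of a box sum is closed under arrows. -/
lemma eq_inl_of_reach {C D : Conf} {p : C.ι} {z : C.ι ⊕ D.ι}
    (h : (C.sum D).Reach (Sum.inl p : C.ι ⊕ D.ι) z) : ∃ q, z = Sum.inl q := by
  unfold Reach at h
  induction h with
  | refl => exact ⟨p, rfl⟩
  | @tail b c _ hbc ih =>
    obtain ⟨q, rfl⟩ := ih
    rcases c with c | c
    · exact ⟨c, rfl⟩
    · exact absurd hbc (not_arrow_inl_inr q c)

/-- If an isomorphism of box sums matches the inner summands, then the summands are isomorphic. -/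
lemma iso_of_sum_iso {C D C' D' : Conf} (f : IsoMap (C.sum D) (C'.sum D'))
    (h1 : ∀ p : C.ι, ∃ q : C'.ι, f.e (Sum.inl p : C.ι ⊕ D.ι) = (Sum.inl q : C'.ι ⊕ D'.ι))
    (h2 : ∀ q : C'.ι, ∃ p : C.ι, f.e.symm (Sum.inl q : C'.ι ⊕ D'.ι) = (Sum.inl p : C.ι ⊕ D.ι)) :
    C.Iso C' ∧ D.Iso D' := by
  have h3 : ∀ p : D.ι, ∃ q : D'.ι, f.e (Sum.inr p : C.ι ⊕ D.ι) = (Sum.inr q : C'.ι ⊕ D'.ι) := by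
    intro p
    rcases hq : (f.e (Sum.inr p : C.ι ⊕ D.ι) : C'.ι ⊕ D'.ι) with q | q
    · obtain ⟨p', hp'⟩ := h2 q
      rw [← hq] at hp'
      have := (f.e.symm_apply_apply (Sum.inr p : C.ι ⊕ D.ι)).symm.trans hp'
      exact absurd this (by simp)
    · exact ⟨q, rfl⟩
  choose g hg using h1
  choose k hk using h3
  have gbij : Function.Bijective g := by
    constructor
    · intro a b hab
      have : f.e (Sum.inl a : C.ι ⊕ D.ι) = f.e (Sum.inl b : C.ι ⊕ D.ι) := by
        rw [hg, hg, hab]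
      exact Sum.inl_injective (f.e.injective this)
    · intro q
      obtain ⟨p, hp⟩ := h2 q
      refine ⟨p, ?_⟩
      have : f.e (Sum.inl p : C.ι ⊕ D.ι) = (Sum.inl q : C'.ι ⊕ D'.ι) := by
        rw [← hp]; exact f.e.apply_symm_apply _
      rw [hg] at this
      exact Sum.inl_injective this
  have kbij : Function.Bijective k := by
    constructor
    · intro a b hab
      have : f.e (Sum.inr a : C.ι ⊕ D.ι) = f.e (Sum.inr b : C.ι ⊕ D.ι) := by
        rw [hk, hk, hab]
      exact Sum.inr_injective (f.e.injective this)
    · intro q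
      rcases hp : (f.e.symm (Sum.inr q : C'.ι ⊕ D'.ι) : C.ι ⊕ D.ι) with p | p
      · have : f.e (Sum.inl p : C.ι ⊕ D.ι) = (Sum.inr q : C'.ι ⊕ D'.ι) := by
          rw [← hp]; exact f.e.apply_symm_apply _
        rw [hg] at this
        exact absurd this (by simp)
      · refine ⟨p, ?_⟩
        have : f.e (Sum.inr p : C.ι ⊕ D.ι) = (Sum.inr q : C'.ι ⊕ D'.ι) := by
          rw [← hp]; exact f.e.apply_symm_apply _
        rw [hk] at this
        exact Sum.inr_injective this
  constructor
  · refine ⟨⟨Equiv.ofBijective g gbij, ?_, ?_, ?_, ?_⟩⟩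
    · intro a
      have := f.right (Sum.inl a : C.ι ⊕ D.ι)
      rw [hg] at this
      exact this
    · intro a
      have := f.up (Sum.inl a : C.ι ⊕ D.ι)
      rw [hg] at this
      exact this
    · intro a b hab
      have := f.inX (Sum.inl a : C.ι ⊕ D.ι) (Sum.inl b : C.ι ⊕ D.ι) hab
      rw [hg, hg] at this
      exact this
    · intro a b hab
      have := f.inY (Sum.inl a : C.ι ⊕ D.ι) (Sum.inl b : C.ι ⊕ D.ι) hab
      rw [hg, hg] at this
      exact this
  · refine ⟨⟨Equiv.ofBijective k kbij, ?_, ?_, ?_, ?_⟩⟩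
    · intro a
      have := f.right (Sum.inr a : C.ι ⊕ D.ι)
      rw [hk] at this
      exact this
    · intro a
      have := f.up (Sum.inr a : C.ι ⊕ D.ι)
      rw [hk] at this
      exact this
    · intro a b hab
      have := f.inX (Sum.inr a : C.ι ⊕ D.ι) (Sum.inr b : C.ι ⊕ D.ι) hab
      rw [hk, hk] at this
      exact this
    · intro a b hab
      have := f.inY (Sum.inr a : C.ι ⊕ D.ι) (Sum.inr b : C.ι ⊕ D.ι) hab
      rw [hk, hk] at this
      exact this

/-- The box sum of the configurations of the members of a list, from the inside to the outside. -/
def list {A : Type} (f : A → Conf) : List A → Conf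
  | [] => empty
  | a :: l => (f a).sum (list f l)

lemma list_append_iso {A : Type} (f : A → Conf) (l m : List A) :
    (list f (l ++ m)).Iso ((list f l).sum (list f m)) := by
  induction l with
  | nil => exact (empty_sum_iso _).symm
  | cons a l ih => exact ((Iso.refl (f a)).sum ih).trans (sum_assoc_iso _ _ _).symm

section Unique

variable {A : Type} {f : A → Conf} {S : Set A} {ok : A → A → Prop}

/-- Suppose that a block within a quadrant on the left is never directly followed by a block within
the opposite quadrant. Then, in a list whose first block lies within a quadrant on the left, no
non-empty set of points of the opposite quadrant is closed under arrows: as long as the blocks lie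
in the first quadrant, the next block does not meet the closed set, hence there are no arrows into
this block, so that it lies in the first quadrant as well. -/
lemma not_closed_opposite (hS : ∀ a ∈ S, (f a).StrongConn)
    (hok : ∀ a ∈ S, ∀ b ∈ S, ok a b → ∀ q, (f a).InQuadrant false q → ¬(f b).InQuadrant true (!q))
    (q : Bool) (m : List A) : ∀ b, (b :: m).IsChain ok → (∀ a ∈ b :: m, a ∈ S) →
      (f b).InQuadrant false q → ∀ Z : Set (list f (b :: m)).ι, Z.Nonempty →
      (∀ z ∈ Z, ∀ y, (list f (b :: m)).Arrow z y → y ∈ Z) →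
      ¬∀ z ∈ Z, (list f (b :: m)).right z = true ∧ (list f (b :: m)).up z = !q := by
  induction m with
  | nil =>
    intro b _ _ hb Z hne _ hZ
    obtain ⟨z, hz⟩ := hne
    have := hZ z hz
    rcases z with z | z
    · have h1 := (hb z).1
      have h2 : (f b).right z = true := this.1
      rw [h1] at h2
      simp at h2
    · exact z.elim
  | cons c m ih =>
    intro b hch hmem hb Z hne hcl hZ
    rw [List.isChain_cons_cons] at hch
    have hcS : c ∈ S := hmem c (by simp)
    have hbS : b ∈ S := hmem b (by simp)
    have hinl : ∀ p : (f b).ι, (Sum.inl p : (f b).ι ⊕ (list f (c :: m)).ι) ∉ Z := by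
      intro p hp
      have h2 : (f b).right p = true := (hZ _ hp).1
      rw [(hb p).1] at h2
      simp at h2
    have hne' : ∃ z : (list f (c :: m)).ι, (Sum.inr z : (f b).ι ⊕ (list f (c :: m)).ι) ∈ Z := by
      obtain ⟨z | z, hz⟩ := hne
      · exact absurd hz (hinl z)
      · exact ⟨z, hz⟩
    let Z' : Set (list f (c :: m)).ι := {z | (Sum.inr z : (f b).ι ⊕ (list f (c :: m)).ι) ∈ Z}
    have hcl' : ∀ z ∈ Z', ∀ y, (list f (c :: m)).Arrow z y → y ∈ Z' :=
      fun z hz y hzy => hcl _ hz (Sum.inr y : (f b).ι ⊕ (list f (c :: m)).ι) hzy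
    have hZ' : ∀ z ∈ Z', (list f (c :: m)).right z = true ∧ (list f (c :: m)).up z = !q :=
      fun z hz => hZ _ hz
    have hclr : ∀ z ∈ Z', ∀ y, (list f (c :: m)).Reach z y → y ∈ Z' := by
      intro z hz y hzy
      unfold Reach at hzy
      induction hzy with
      | refl => exact hz
      | tail _ h ih => exact hcl' _ ih _ h
    have hinl' : ∀ p : (f c).ι, (Sum.inl p : (f c).ι ⊕ (list f m).ι) ∉ Z' := by
      intro p hp
      refine hok b hbS c hcS hch.1 q hb fun p' => ?_
      exact hZ' _ (hclr _ hp _ (reach_inl (list f m) ((hS c hcS).2 p p')))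
    refine ih c hch.2 (fun a ha => hmem a (List.mem_cons_of_mem _ ha)) ?_ Z' hne' hcl' hZ'
    obtain ⟨z | z, hz⟩ := hne'
    · exact absurd hz (hinl' z)
    intro p
    have hna : ¬(list f (c :: m)).Arrow (Sum.inr z : (f c).ι ⊕ (list f m).ι)
        (Sum.inl p : (f c).ι ⊕ (list f m).ι) := fun h => hinl' p (hcl' _ hz _ h)
    have hz1 := (hZ' _ hz).1
    have hz2 := (hZ' _ hz).2
    constructor
    · by_contra h
      refine hna (Or.inl ⟨?_, trivial⟩)
      rw [hz1]
      change (f c).right p ≠ false at h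
      change (f c).right p = true
      simpa using h
    · by_contra h
      refine hna (Or.inr ⟨?_, trivial⟩)
      rw [hz2]
      change (f c).up p ≠ q at h
      change (f c).up p = !q
      exact Bool.eq_not_of_ne h

/-- Unique decomposition: a box sum of pairwise non-isomorphic strongly connected blocks determines
the list of its blocks, as only blocks in opposite quadrants commute, and the order of these is
prescribed. -/
theorem list_injective (hS : ∀ a ∈ S, (f a).StrongConn)
    (hinj : ∀ a ∈ S, ∀ b ∈ S, (f a).Iso (f b) → a = b)
    (hok : ∀ a ∈ S, ∀ b ∈ S, ok a b → ∀ q, (f a).InQuadrant false q → ¬(f b).InQuadrant true (!q))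
    (l : List A) : ∀ m : List A, l.IsChain ok → m.IsChain ok → (∀ a ∈ l, a ∈ S) →
      (∀ a ∈ m, a ∈ S) → (list f l).Iso (list f m) → l = m := by
  induction l with
  | nil =>
    intro m _ _ _ hmS ⟨e⟩
    rcases m with _ | ⟨b, m⟩
    · rfl
    · obtain ⟨p⟩ := (hS b (hmS b (by simp))).1
      exact (e.e.symm (Sum.inl p : (f b).ι ⊕ (list f m).ι) : Empty).elim
  | cons a l ih =>
    intro m hl hm hlS hmS ⟨e⟩
    have haS := hlS a (by simp)
    rcases m with _ | ⟨b, m⟩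
    · obtain ⟨p⟩ := (hS a haS).1
      exact (e.e (Sum.inl p : (f a).ι ⊕ (list f l).ι) : Empty).elim
    have hbS := hmS b (by simp)
    obtain ⟨p0⟩ := (hS a haS).1
    obtain ⟨q0⟩ := (hS b hbS).1
    -- Paths inside the inner blocks, transported by the isomorphism.
    have ra : ∀ p p' : (f a).ι, (list f (b :: m)).Reach
        (e.e (Sum.inl p : (f a).ι ⊕ (list f l).ι)) (e.e (Sum.inl p' : (f a).ι ⊕ (list f l).ι)) :=
      fun p p' => e.reach (reach_inl (list f l) ((hS a haS).2 p p'))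
    have rb : ∀ q q' : (f b).ι, (list f (a :: l)).Reach
        (e.e.symm (Sum.inl q : (f b).ι ⊕ (list f m).ι))
        (e.e.symm (Sum.inl q' : (f b).ι ⊕ (list f m).ι)) :=
      fun q q' => e.symm.reach (reach_inl (list f m) ((hS b hbS).2 q q'))
    rcases hz : (e.e (Sum.inl p0 : (f a).ι ⊕ (list f l).ι) : (f b).ι ⊕ (list f m).ι) with q1 | z0
    · have h1 : ∀ p : (f a).ι, ∃ q : (f b).ι, e.e (Sum.inl p : (f a).ι ⊕ (list f l).ι) =
          (Sum.inl q : (f b).ι ⊕ (list f m).ι) := by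
        intro p
        have := ra p0 p
        rw [hz] at this
        exact eq_inl_of_reach this
      have h2 : ∀ q : (f b).ι, ∃ p : (f a).ι, e.e.symm (Sum.inl q : (f b).ι ⊕ (list f m).ι) =
          (Sum.inl p : (f a).ι ⊕ (list f l).ι) := by
        intro q
        have h3 := rb q1 q
        rw [← hz] at h3
        have h4 : e.e.symm (e.e (Sum.inl p0 : (f a).ι ⊕ (list f l).ι)) = Sum.inl p0 :=
          e.e.symm_apply_apply _
        rw [h4] at h3
        exact eq_inl_of_reach h3
      obtain ⟨i1, i2⟩ := iso_of_sum_iso e h1 h2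
      have hab := hinj a haS b hbS i1
      subst hab
      rw [ih m hl.tail hm.tail (fun c hc => hlS c (by simp [hc])) (fun c hc => hmS c (by simp [hc]))
        i2]
    · exfalso
      have h1 : ∀ p : (f a).ι, ∃ z : (list f m).ι, e.e (Sum.inl p : (f a).ι ⊕ (list f l).ι) =
          (Sum.inr z : (f b).ι ⊕ (list f m).ι) := by
        intro p
        rcases hq : (e.e (Sum.inl p : (f a).ι ⊕ (list f l).ι) : (f b).ι ⊕ (list f m).ι) with q | z
        · have := ra p p0
          rw [hq, hz] at this
          obtain ⟨q', hq'⟩ := eq_inl_of_reach this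
          exact absurd hq' (by simp)
        · exact ⟨z, rfl⟩
      -- No arrow leads from the image of the first block of `a :: l` to the first block of `b :: m`.
      have hna : ∀ (p : (f a).ι) (q : (f b).ι), ¬(list f (b :: m)).Arrow
          (e.e (Sum.inl p : (f a).ι ⊕ (list f l).ι)) (Sum.inl q : (f b).ι ⊕ (list f m).ι) := by
        intro p q h
        have h2 := e.symm.arrow h
        have h3 : e.symm.e (e.e (Sum.inl p : (f a).ι ⊕ (list f l).ι)) = Sum.inl p :=
          e.e.symm_apply_apply _
        rw [h3] at h2
        obtain ⟨p', hp'⟩ := eq_inl_of_reach (Relation.ReflTransGen.single h2)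
        obtain ⟨z, hz'⟩ := h1 p'
        rw [← hp'] at hz'
        have h4 : e.e (e.symm.e (Sum.inl q : (f b).ι ⊕ (list f m).ι)) = Sum.inl q :=
          e.e.apply_symm_apply _
        rw [h4] at hz'
        exact absurd hz' (by simp)
      have hopp : ∀ (p : (f a).ι) (q : (f b).ι),
          (f b).right q ≠ (f a).right p ∧ (f b).up q ≠ (f a).up p := by
        intro p q
        have hR : (list f (b :: m)).right (e.e (Sum.inl p : (f a).ι ⊕ (list f l).ι)) =
          (f a).right p := e.right _
        have hU : (list f (b :: m)).up (e.e (Sum.inl p : (f a).ι ⊕ (list f l).ι)) =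
          (f a).up p := e.up _
        obtain ⟨z, hz'⟩ := h1 p
        have := hna p q
        rw [hz'] at this hR hU
        constructor
        · intro h
          refine this (Or.inl ⟨?_, trivial⟩)
          rw [hR]; exact h
        · intro h
          refine this (Or.inr ⟨?_, trivial⟩)
          rw [hU]; exact h
      have hA : (f a).InQuadrant (!(f b).right q0) (!(f b).up q0) := fun p => by
        obtain ⟨h1, h2⟩ := hopp p q0
        exact ⟨Bool.eq_not_of_ne h1.symm, Bool.eq_not_of_ne h2.symm⟩
      have hB : (f b).InQuadrant (!(f a).right p0) (!(f a).up p0) := fun q => by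
        obtain ⟨h1, h2⟩ := hopp p0 q
        exact ⟨Bool.eq_not_of_ne h1, Bool.eq_not_of_ne h2⟩
      rcases hr : (f a).right p0 with _ | _
      · -- the first block of `a :: l` is on the left
        have hb1 := (hB q0).1
        rw [hr] at hb1
        have ha1 := (hA p0).1
        rw [hb1] at hA
        refine not_closed_opposite hS hok (!(f b).up q0) l a hl hlS hA
          (Set.range fun q : (f b).ι => e.e.symm (Sum.inl q : (f b).ι ⊕ (list f m).ι))
          ⟨_, ⟨q0, rfl⟩⟩ ?_ ?_
        · rintro _ ⟨q, rfl⟩ y hy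
          have h2 := e.arrow hy
          have h3 : e.e (e.e.symm (Sum.inl q : (f b).ι ⊕ (list f m).ι)) = Sum.inl q :=
            e.e.apply_symm_apply _
          rw [h3] at h2
          obtain ⟨q', hq'⟩ := eq_inl_of_reach (Relation.ReflTransGen.single h2)
          refine ⟨q', ?_⟩
          change e.e.symm _ = y
          rw [← hq']
          exact e.e.symm_apply_apply _
        · rintro _ ⟨q, rfl⟩
          have hR : (list f (a :: l)).right (e.e.symm (Sum.inl q : (f b).ι ⊕ (list f m).ι)) =
            (f b).right q := e.symm.right _
          have hU : (list f (a :: l)).up (e.e.symm (Sum.inl q : (f b).ι ⊕ (list f m).ι)) =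
            (f b).up q := e.symm.up _
          have h5 := hB q
          have h6 := hB q0
          refine ⟨hR.trans ?_, hU.trans ?_⟩
          · rw [h5.1, hr]; rfl
          · rw [h5.2, h6.2]; simp
      · -- the first block of `b :: m` is on the left
        have hb1 := (hB q0).1
        rw [hr] at hB
        refine not_closed_opposite hS hok (!(f a).up p0) m b hm hmS hB
          (Set.range fun p : (f a).ι => e.e (Sum.inl p : (f a).ι ⊕ (list f l).ι))
          ⟨_, ⟨p0, rfl⟩⟩ ?_ ?_
        · rintro _ ⟨p, rfl⟩ y hy
          have h2 := e.symm.arrow hy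
          have h3 : e.symm.e (e.e (Sum.inl p : (f a).ι ⊕ (list f l).ι)) = Sum.inl p :=
            e.e.symm_apply_apply _
          rw [h3] at h2
          obtain ⟨p', hp'⟩ := eq_inl_of_reach (Relation.ReflTransGen.single h2)
          refine ⟨p', ?_⟩
          change e.e _ = y
          rw [← hp']
          exact e.e.apply_symm_apply _
        · rintro _ ⟨p, rfl⟩
          have hR : (list f (b :: m)).right (e.e (Sum.inl p : (f a).ι ⊕ (list f l).ι)) =
            (f a).right p := e.right _
          have hU : (list f (b :: m)).up (e.e (Sum.inl p : (f a).ι ⊕ (list f l).ι)) =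
            (f a).up p := e.up _
          have h5 := hA p
          have h6 := hA p0
          refine ⟨hR.trans ?_, hU.trans ?_⟩
          · rw [h5.1, ← h6.1, hr]
          · rw [h5.2, ← h6.2]; simp

end Unique

end Conf

/-! ### Bounds for the counting sequence from box sums -/

lemma pinConf_congr_iso {w : ℕ → PinLetter} {I J : Finset ℕ} (h : I = J) :
    (pinConf w I).Iso (pinConf w J) := h ▸ Conf.Iso.refl _

/-- Disjoint sets of pins form a box sum if the pins of the second set are further out. -/
lemma pinConf_union_iso_of_lt (w : ℕ → PinLetter) {I J : Finset ℕ}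
    (hX : ∀ i ∈ I, ∀ j ∈ J, isRight w i = isRight w j → absX w i < absX w j)
    (hY : ∀ i ∈ I, ∀ j ∈ J, isUp w i = isUp w j → absY w i < absY w j) :
    (pinConf w (I ∪ J)).Iso ((pinConf w I).sum (pinConf w J)) := by
  have hd : Disjoint I J := by
    rw [Finset.disjoint_left]
    intro i hi hj
    exact lt_irrefl _ (hX i hi i hj rfl)
  refine Conf.Iso.symm ⟨⟨Equiv.Finset.union I J hd, ?_, ?_, ?_, ?_⟩⟩
  · rintro (a | a) <;> rfl
  · rintro (a | a) <;> rfl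
  · rintro (⟨a, ha⟩ | ⟨a, ha⟩) (⟨b, hb⟩ | ⟨b, hb⟩) h
    · exact Iff.rfl
    · exact iff_of_true (hX a ha b hb h) trivial
    · exact iff_of_false (hX b hb a ha h.symm).not_gt id
    · exact Iff.rfl
  · rintro (⟨a, ha⟩ | ⟨a, ha⟩) (⟨b, hb⟩ | ⟨b, hb⟩) h
    · exact Iff.rfl
    · exact iff_of_true (hY a ha b hb h) trivial
    · exact iff_of_false (hY b hb a ha h.symm).not_gt id
    · exact Iff.rfl

/-- Sets of pins with a gap of at least one pin between them form a box sum, as a pin only separates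
its immediate predecessor from the origin. -/
lemma pinConf_union_iso (w : ℕ → PinLetter) {I J : Finset ℕ} (h : ∀ i ∈ I, ∀ j ∈ J, i + 1 < j) :
    (pinConf w (I ∪ J)).Iso ((pinConf w I).sum (pinConf w J)) :=
  pinConf_union_iso_of_lt w
    (fun i hi j hj _ => by have := h i hi j hj; unfold absX; split_ifs <;> omega)
    (fun i hi j hj _ => by have := h i hi j hj; unfold absY; split_ifs <;> omega)

lemma pinConf_empty_iso (w : ℕ → PinLetter) : (pinConf w ∅).Iso Conf.empty := by
  refine ⟨⟨Equiv.equivOfIsEmpty (↥(∅ : Finset ℕ)) Empty, ?_, ?_, ?_, ?_⟩⟩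
  all_goals exact fun a => absurd (show ↥(∅ : Finset ℕ) from a).2 (by simp)

/-- Box sums of blocks that recur in `w` are formed by pins of `w`. -/
lemma exists_pinConf_iso_list (w : ℕ → PinLetter) {A : Type} {f : A → Conf} {len : A → ℕ}
    {S : Set A} (hrec : ∀ a ∈ S, ∀ N, ∃ i, N ≤ i ∧
      (pinConf w (Finset.Ico i (i + len a))).Iso (f a))
    (l : List A) : (∀ a ∈ l, a ∈ S) → ∀ N, ∃ I : Finset ℕ, (∀ i ∈ I, N ≤ i) ∧
      I.card = (l.map len).sum ∧ (pinConf w I).Iso (Conf.list f l) := by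
  induction l with
  | nil => exact fun _ N => ⟨∅, by simp, by simp, pinConf_empty_iso w⟩
  | cons a l ih =>
    intro hS N
    obtain ⟨i, hi, hiso⟩ := hrec a (hS a (by simp)) N
    obtain ⟨I, hI, hcard, hIso⟩ := ih (fun b hb => hS b (by simp [hb])) (i + len a + 1)
    have hgap : ∀ x ∈ Finset.Ico i (i + len a), ∀ y ∈ I, x + 1 < y := by
      intro x hx y hy
      have := hI y hy
      have := (Finset.mem_Ico.1 hx).2
      omega
    refine ⟨Finset.Ico i (i + len a) ∪ I, ?_, ?_, ?_⟩
    · intro x hx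
      rcases Finset.mem_union.1 hx with hx | hx
      · exact hi.trans (Finset.mem_Ico.1 hx).1
      · have := hI x hx
        omega
    · rw [Finset.card_union_of_disjoint, hcard]
      · simp
      · rw [Finset.disjoint_left]
        intro x hx hy
        have := hgap x hx x hy
        omega
    · exact (pinConf_union_iso w hgap).trans (hiso.sum hIso)

lemma card_biUnion_cons {A : Type} [DecidableEq A] (T : Finset A) (F : A → Finset (List A)) :
    (T.biUnion fun a => (F a).image (List.cons a)).card = ∑ a ∈ T, (F a).card := by
  rw [Finset.card_biUnion]
  · exact Finset.sum_congr rfl fun a _ =>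
      Finset.card_image_of_injective _ (List.cons_injective)
  · intro a _ b _ hab
    rw [Function.onFun, Finset.disjoint_left]
    intro l hl hl'
    obtain ⟨l1, -, rfl⟩ := Finset.mem_image.1 hl
    obtain ⟨l2, -, h2⟩ := Finset.mem_image.1 hl'
    exact hab (List.cons.inj h2).1.symm

/-- The number of lists of letters of total length `n`, in which successive letters are related by
`ok`, grows at least like `t ^ n` if the transfer matrix with entries `1 / t ^ len b` for `ok a b`
maps some positive vector `h` to a vector that is at least `h`. Letters of length one that may follow
make sure that all total lengths occur. -/
lemma exists_many_lists {A : Type} (S : Finset A) (len : A → ℕ) (ok : A → A → Prop)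
    [DecidableRel ok] (h : A → ℝ) {t : ℝ} (ht : 1 < t) (hlen : ∀ a ∈ S, 1 ≤ len a)
    (hpos : ∀ a ∈ S, 0 < h a) (hone : ∀ a ∈ S, ∃ b ∈ S, ok a b ∧ len b = 1)
    (hsum : ∀ a ∈ S, h a ≤ ∑ b ∈ S with ok a b, h b / t ^ len b) :
    ∃ C : ℝ, 0 < C ∧ ∀ n, ∀ a ∈ S, ∃ F : Finset (List A),
      (∀ l ∈ F, (a :: l).IsChain ok ∧ (∀ b ∈ l, b ∈ S) ∧ (l.map len).sum = n) ∧
      C * h a * t ^ n ≤ F.card := by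
  classical
  have ht0 : 0 < t := by linarith
  have hex : ∀ n, ∀ a ∈ S, ∃ l : List A,
      (a :: l).IsChain ok ∧ (∀ b ∈ l, b ∈ S) ∧ (l.map len).sum = n := by
    intro n
    induction n with
    | zero => exact fun a _ => ⟨[], by simp, by simp, by simp⟩
    | succ n ih =>
      intro a ha
      obtain ⟨b, hb, hab, hb1⟩ := hone a ha
      obtain ⟨l, h1, h2, h3⟩ := ih b hb
      refine ⟨b :: l, List.isChain_cons_cons.2 ⟨hab, h1⟩, ?_, ?_⟩
      · intro c hc
        rcases List.mem_cons.1 hc with rfl | hc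
        · exact hb
        · exact h2 c hc
      · simp [hb1, h3]; omega
  set K := S.sup len with hK
  set H := 1 + ∑ a ∈ S, h a with hH
  have hHa : ∀ a ∈ S, h a ≤ H := by
    intro a ha
    have := Finset.single_le_sum (f := h) (fun b hb => (hpos b hb).le) ha
    linarith
  have hH0 : 0 < H := by
    have := Finset.sum_nonneg (f := h) (fun b hb => (hpos b hb).le : ∀ b ∈ S, 0 ≤ h b)
    linarith
  -- the constant is chosen such that one list suffices for `n ≤ K`, the start of the recursion
  refine ⟨1 / (H * t ^ K), by positivity, ?_⟩
  intro n
  induction n using Nat.strong_induction_on with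
  | _ n ih =>
    intro a ha
    rcases le_or_gt n K with hn | hn
    · obtain ⟨l, hl⟩ := hex n a ha
      refine ⟨{l}, by simpa using hl, ?_⟩
      have h1 : t ^ n ≤ t ^ K := pow_le_pow_right₀ ht.le hn
      have h2 := hHa a ha
      have h3 : h a * t ^ n ≤ H * t ^ K :=
        mul_le_mul h2 h1 (by positivity) hH0.le
      have h4 : 0 < H * t ^ K := by positivity
      rw [Finset.card_singleton, Nat.cast_one, mul_assoc, one_div, inv_mul_le_iff₀ h4]
      linarith
    · have hlt : ∀ b ∈ S, n - len b < n := fun b hb => by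
        have := hlen b hb
        omega
      choose! F hF hFc using fun b (hb : b ∈ S) => ih (n - len b) (hlt b hb) b hb
      refine ⟨(S.filter (ok a)).biUnion fun b => (F b).image (List.cons b), ?_, ?_⟩
      · intro l hl
        obtain ⟨b, hb, hl⟩ := Finset.mem_biUnion.1 hl
        obtain ⟨m, hm, rfl⟩ := Finset.mem_image.1 hl
        obtain ⟨hbS, hab⟩ := Finset.mem_filter.1 hb
        obtain ⟨h1, h2, h3⟩ := hF b hbS m hm
        refine ⟨List.isChain_cons_cons.2 ⟨hab, h1⟩, ?_, ?_⟩
        · intro c hc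
          rcases List.mem_cons.1 hc with rfl | hc
          · exact hbS
          · exact h2 c hc
        · have : len b ≤ K := Finset.le_sup hbS
          simp only [List.map_cons, List.sum_cons, h3]
          omega
      · rw [card_biUnion_cons, Nat.cast_sum]
        calc 1 / (H * t ^ K) * h a * t ^ n
            = 1 / (H * t ^ K) * t ^ n * h a := by ring
          _ ≤ 1 / (H * t ^ K) * t ^ n * ∑ b ∈ S with ok a b, h b / t ^ len b := by
              gcongr
              exact hsum a ha
          _ = ∑ b ∈ S with ok a b, 1 / (H * t ^ K) * h b * t ^ (n - len b) := by
              rw [Finset.mul_sum]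
              refine Finset.sum_congr rfl fun b hb => ?_
              have : len b ≤ K := Finset.le_sup (Finset.mem_filter.1 hb).1
              rw [pow_sub₀ t ht0.ne' (by omega)]
              ring
          _ ≤ ∑ b ∈ S with ok a b, ((F b).card : ℝ) :=
              Finset.sum_le_sum fun b hb => hFc b (Finset.mem_filter.1 hb).1

/-- The lower bound: lists of blocks that recur in `w` are counted by the members of the class, if
the blocks are strongly connected and pairwise non-isomorphic. The relation `ok` selects one order for
successive blocks in opposite quadrants. -/
theorem exists_le_pinClassCount (w : ℕ → PinLetter) {A : Type} (S : Finset A) (f : A → Conf)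
    (len : A → ℕ) (ok : A → A → Prop) [DecidableRel ok] (h : A → ℝ) {t : ℝ} (ht : 1 < t)
    (hne : S.Nonempty) (hlen : ∀ a ∈ S, 1 ≤ len a)
    (hrec : ∀ a ∈ S, ∀ N, ∃ i, N ≤ i ∧ (pinConf w (Finset.Ico i (i + len a))).Iso (f a))
    (hS : ∀ a ∈ S, (f a).StrongConn)
    (hinj : ∀ a ∈ S, ∀ b ∈ S, (f a).Iso (f b) → a = b)
    (hok : ∀ a ∈ S, ∀ b ∈ S, ok a b → ∀ q, (f a).InQuadrant false q → ¬(f b).InQuadrant true (!q))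
    (hpos : ∀ a ∈ S, 0 < h a) (hone : ∀ a ∈ S, ∃ b ∈ S, ok a b ∧ len b = 1)
    (hsum : ∀ a ∈ S, h a ≤ ∑ b ∈ S with ok a b, h b / t ^ len b) :
    ∃ C : ℝ, 0 < C ∧ ∀ n, C * t ^ n ≤ pinClassCount w n := by
  classical
  obtain ⟨C, hC, hF⟩ := exists_many_lists S len ok h ht hlen hpos hone hsum
  obtain ⟨a, ha⟩ := hne
  refine ⟨C * h a, mul_pos hC (hpos a ha), fun n => ?_⟩
  obtain ⟨F, hF1, hF2⟩ := hF n a ha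
  refine hF2.trans ?_
  have ex := fun l : F => exists_pinConf_iso_list w (S := (S : Set A)) hrec l.1 (hF1 l l.2).2.1 0
  choose I _ hIc hI using ex
  have := card_le_pinClassCount w (n := n) (Finset.univ : Finset F) I
    (fun l _ => by rw [hIc, (hF1 l l.2).2.2]) (fun l _ m _ hlm => by
      apply Subtype.ext
      exact Conf.list_injective (S := (S : Set A)) hS hinj hok l m (hF1 l l.2).1.tail
        (hF1 m m.2).1.tail (hF1 l l.2).2.1 (hF1 m m.2).2.1 (((hI l).symm.trans hlm).trans (hI m)))
  rw [Finset.card_univ, Fintype.card_coe] at this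
  exact_mod_cast this

/-- Lists of letters of total length `n` number at most `t ^ n` if `∑ 1 / t ^ len a ≤ 1`. -/
lemma exists_few_lists {A : Type} (Λ : Set A) (len : A → ℕ) {t : ℝ} (ht : 1 ≤ t)
    (hlen : ∀ a ∈ Λ, 1 ≤ len a)
    (hfin : ∀ n, ∃ S : Finset A, (∀ a ∈ Λ, len a ≤ n → a ∈ S) ∧ ∑ a ∈ S, 1 / t ^ len a ≤ 1)
    (n : ℕ) : ∃ F : Finset (List A),
      (∀ l : List A, (∀ a ∈ l, a ∈ Λ) → (l.map len).sum = n → l ∈ F) ∧ (F.card : ℝ) ≤ t ^ n := by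
  classical
  have ht0 : 0 < t := by linarith
  induction n using Nat.strong_induction_on with
  | _ n ih =>
    rcases Nat.eq_zero_or_pos n with rfl | hn
    · refine ⟨{[]}, ?_, by simp⟩
      intro l hl h0
      rcases l with _ | ⟨a, l⟩
      · simp
      · have := hlen a (hl a (by simp))
        simp at h0
        omega
    · obtain ⟨S, hS, hsum⟩ := hfin n
      have : ∀ a : A, 1 ≤ len a → n - len a < n := fun a h => by omega
      choose! F hF hFc using fun (a : A) (h : 1 ≤ len a) => ih (n - len a) (this a h)
      refine ⟨(S.filter fun a => 1 ≤ len a ∧ len a ≤ n).biUnion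
        fun a => (F a).image (List.cons a), ?_, ?_⟩
      · intro l hl h0
        rcases l with _ | ⟨a, l⟩
        · simp at h0
          omega
        have ha := hl a (by simp)
        have h1 := hlen a ha
        simp only [List.map_cons, List.sum_cons] at h0
        refine Finset.mem_biUnion.2 ⟨a, Finset.mem_filter.2 ⟨hS a ha (by omega), h1, by omega⟩,
          Finset.mem_image_of_mem _ (hF a h1 l (fun b hb => hl b (by simp [hb])) (by omega))⟩
      · rw [card_biUnion_cons, Nat.cast_sum]
        calc ∑ a ∈ S with 1 ≤ len a ∧ len a ≤ n, ((F a).card : ℝ)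
            ≤ ∑ a ∈ S with 1 ≤ len a ∧ len a ≤ n, t ^ n * (1 / t ^ len a) := by
              refine Finset.sum_le_sum fun a ha => ?_
              obtain ⟨-, h1, h2⟩ := Finset.mem_filter.1 ha
              refine (hFc a h1).trans_eq ?_
              rw [pow_sub₀ t ht0.ne' h2]
              ring
          _ ≤ ∑ a ∈ S, t ^ n * (1 / t ^ len a) :=
              Finset.sum_le_sum_of_subset_of_nonneg (Finset.filter_subset _ _)
                fun _ _ _ => by positivity
          _ = t ^ n * ∑ a ∈ S, 1 / t ^ len a := by rw [Finset.mul_sum]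
          _ ≤ t ^ n * 1 := by gcongr
          _ = t ^ n := mul_one _

/-- If all contiguous runs of pins far out are box sums of letters, then so are all finite sets of
pins far out. -/
lemma exists_list_iso_pinConf (w : ℕ → PinLetter) {A : Type} {f : A → Conf} {len : A → ℕ}
    {Λ : Set A} {L : ℕ} (hrun : ∀ i, L ≤ i → ∀ k, 1 ≤ k → ∃ l : List A, (∀ a ∈ l, a ∈ Λ) ∧
      (l.map len).sum = k ∧ (pinConf w (Finset.Ico i (i + k))).Iso (Conf.list f l))
    (c : ℕ) : ∀ B : Finset ℕ, B.card = c → (∀ i ∈ B, L ≤ i) →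
      ∃ l : List A, (∀ a ∈ l, a ∈ Λ) ∧ (l.map len).sum = B.card ∧
        (pinConf w B).Iso (Conf.list f l) := by
  induction c using Nat.strong_induction_on with
  | _ c ih =>
    intro B hc hL
    rcases B.eq_empty_or_nonempty with rfl | hne
    · exact ⟨[], by simp, by simp, pinConf_empty_iso w⟩
    -- split off the maximal run that starts with the innermost pin
    set i := B.min' hne with hi
    have hiB : i ∈ B := B.min'_mem hne
    have hex : ∃ k, i + k ∉ B := by
      refine ⟨B.max' hne + 1, fun h => ?_⟩
      have := B.le_max' _ h
      omega
    classical
    set k := Nat.find hex with hk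
    have hk1 : i + k ∉ B := Nat.find_spec hex
    have hk2 : ∀ j < k, i + j ∈ B := fun j hj => by
      have := Nat.find_min hex hj
      simpa using this
    have hk0 : 1 ≤ k := by
      rcases Nat.eq_zero_or_pos k with h0 | h0
      · rw [h0] at hk1; exact absurd hiB hk1
      · exact h0
    set B' := B.filter fun j => i + k < j with hB'
    have hBeq : B = Finset.Ico i (i + k) ∪ B' := by
      ext j
      simp only [Finset.mem_union, Finset.mem_Ico, hB', Finset.mem_filter]
      constructor
      · intro hj
        have h1 := B.min'_le j hj
        by_cases h2 : j = i + k
        · exact absurd (h2 ▸ hj) hk1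
        · by_cases h3 : j < i + k
          · exact Or.inl ⟨h1, h3⟩
          · exact Or.inr ⟨hj, by omega⟩
      · rintro (⟨h1, h2⟩ | h)
        · have := hk2 (j - i) (by omega)
          rwa [Nat.add_sub_cancel' h1] at this
        · exact h.1
    have hgap : ∀ x ∈ Finset.Ico i (i + k), ∀ y ∈ B', x + 1 < y := by
      intro x hx y hy
      have h1 := (Finset.mem_Ico.1 hx).2
      have h2 := (Finset.mem_filter.1 hy).2
      omega
    have hdis : Disjoint (Finset.Ico i (i + k)) B' := by
      rw [Finset.disjoint_left]
      intro x hx hy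
      have := hgap x hx x hy
      omega
    have hcard : B.card = k + B'.card := by
      conv_lhs => rw [hBeq]
      rw [Finset.card_union_of_disjoint hdis]
      simp
    obtain ⟨l1, h11, h12, h13⟩ := hrun i (hL i hiB) k hk0
    obtain ⟨l2, h21, h22, h23⟩ := ih B'.card (by omega) B' rfl
      fun j hj => hL j (Finset.mem_filter.1 hj).1
    refine ⟨l1 ++ l2, ?_, ?_, ?_⟩
    · intro a ha
      rcases List.mem_append.1 ha with h | h
      · exact h11 a h
      · exact h21 a h
    · rw [List.map_append, List.sum_append, h12, h22, hcard]
    · exact ((pinConf_congr_iso hBeq).trans (pinConf_union_iso w hgap)).trans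
        ((h13.sum h23).trans (Conf.list_append_iso f l1 l2).symm)

/-- The upper bound: all runs of pins from index `L` on are box sums of letters with
`∑ 1 / t ^ len a ≤ 1`. A set of pins is described by its pins before `L`, by the run that starts
at `L`, which the pins before `L` may touch, and by the letters of the rest. -/
theorem exists_pinClassCount_le (w : ℕ → PinLetter) {A : Type} (f : A → Conf) (len : A → ℕ)
    (Λ : Set A) (L : ℕ) {t : ℝ} (ht : 1 ≤ t) (hlen : ∀ a ∈ Λ, 1 ≤ len a)
    (hfin : ∀ n, ∃ S : Finset A, (∀ a ∈ Λ, len a ≤ n → a ∈ S) ∧ ∑ a ∈ S, 1 / t ^ len a ≤ 1)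
    (hrun : ∀ i, L ≤ i → ∀ k, 1 ≤ k → ∃ l : List A, (∀ a ∈ l, a ∈ Λ) ∧
      (l.map len).sum = k ∧ (pinConf w (Finset.Ico i (i + k))).Iso (Conf.list f l)) :
    ∀ n : ℕ, (pinClassCount w n : ℝ) ≤ 2 ^ L * ((n + 1 : ℕ) : ℝ) ^ 2 * t ^ n := by
  classical
  choose F hF hFc using exists_few_lists Λ len ht hlen hfin
  intro n
  set G := (Finset.range (n + 1)).biUnion F with hG
  have hGc : (G.card : ℝ) ≤ ((n + 1 : ℕ) : ℝ) * t ^ n := by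
    calc (G.card : ℝ) ≤ ((∑ m ∈ Finset.range (n + 1), (F m).card : ℕ) : ℝ) := by
          exact_mod_cast Finset.card_biUnion_le
      _ = ∑ m ∈ Finset.range (n + 1), ((F m).card : ℝ) := by push_cast; rfl
      _ ≤ ∑ m ∈ Finset.range (n + 1), t ^ n := by
          refine Finset.sum_le_sum fun m hm => (hFc m).trans ?_
          exact pow_le_pow_right₀ ht (by have := Finset.mem_range.1 hm; omega)
      _ = ((n + 1 : ℕ) : ℝ) * t ^ n := by simp
  have key := pinClassCount_le_card (w := w) (n := n)
    ((Finset.range L).powerset ×ˢ (Finset.range (n + 1) ×ˢ G))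
    (fun I b => ∃ B : Finset ℕ, (∀ j ∈ B, L + b.2.1 < j) ∧ b.1 ⊆ Finset.range L ∧
      I = (b.1 ∪ Finset.Ico L (L + b.2.1)) ∪ B ∧ (pinConf w B).Iso (Conf.list f b.2.2)) ?_ ?_
  · rw [Finset.card_product, Finset.card_product, Finset.card_powerset, Finset.card_range,
      Finset.card_range] at key
    calc (pinClassCount w n : ℝ) ≤ ((2 ^ L * ((n + 1) * G.card) : ℕ) : ℝ) := by exact_mod_cast key
      _ = 2 ^ L * (((n + 1 : ℕ) : ℝ) * G.card) := by push_cast; ring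
      _ ≤ 2 ^ L * (((n + 1 : ℕ) : ℝ) * (((n + 1 : ℕ) : ℝ) * t ^ n)) := by gcongr
      _ = _ := by ring
  · intro I hI
    have hex : ∃ k, L + k ∉ I := by
      by_contra hc
      push Not at hc
      have : (Finset.Ico L (L + (n + 1))) ⊆ I := by
        intro j hj
        obtain ⟨h1, h2⟩ := Finset.mem_Ico.1 hj
        have := hc (j - L)
        rwa [Nat.add_sub_cancel' h1] at this
      have := Finset.card_le_card this
      rw [hI] at this
      simp at this
    set k := Nat.find hex with hk
    have hk1 : L + k ∉ I := Nat.find_spec hex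
    have hk2 : ∀ j < k, L + j ∈ I := fun j hj => by
      have := Nat.find_min hex hj
      simpa using this
    have hsub : Finset.Ico L (L + k) ⊆ I := by
      intro j hj
      obtain ⟨h1, h2⟩ := Finset.mem_Ico.1 hj
      have := hk2 (j - L) (by omega)
      rwa [Nat.add_sub_cancel' h1] at this
    have hkn : k ≤ n := by
      have := Finset.card_le_card hsub
      rw [hI] at this
      simpa using this
    obtain ⟨l, hl1, hl2, hl3⟩ := exists_list_iso_pinConf w hrun _
      (I.filter fun j => L + k < j) rfl fun j hj => by
        have := (Finset.mem_filter.1 hj).2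
        omega
    have hlc : (l.map len).sum ≤ n := by
      rw [hl2, ← hI]
      exact Finset.card_le_card (Finset.filter_subset _ _)
    refine ⟨(I.filter fun j => j < L, k, l), ?_, I.filter fun j => L + k < j, ?_, ?_, ?_, hl3⟩
    · simp only [Finset.mem_product, Finset.mem_powerset, Finset.mem_range]
      refine ⟨fun j hj => Finset.mem_range.2 (Finset.mem_filter.1 hj).2, by omega, ?_⟩
      exact Finset.mem_biUnion.2 ⟨_, Finset.mem_range.2 (by omega), hF _ l hl1 rfl⟩
    · exact fun j hj => (Finset.mem_filter.1 hj).2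
    · exact fun j hj => Finset.mem_range.2 (Finset.mem_filter.1 hj).2
    · ext j
      simp only [Finset.mem_union, Finset.mem_filter, Finset.mem_Ico]
      constructor
      · intro hj
        by_cases h1 : j < L
        · exact Or.inl (Or.inl ⟨hj, h1⟩)
        · by_cases h2 : j < L + k
          · exact Or.inl (Or.inr ⟨by omega, h2⟩)
          · by_cases h3 : j = L + k
            · exact absurd (h3 ▸ hj) hk1
            · exact Or.inr ⟨hj, by omega⟩
      · rintro ((h | h) | h)
        · exact h.1
        · exact hsub (Finset.mem_Ico.2 h)
        · exact h.1
  · rintro I J ⟨S, k, l⟩ ⟨B, h1, h2, rfl, h4⟩ ⟨B', h1', h2', rfl, h4'⟩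
    simp only at h1 h2 h4 h1' h2' h4'
    have hgap : ∀ B : Finset ℕ, (∀ j ∈ B, L + k < j) →
        ∀ x ∈ S ∪ Finset.Ico L (L + k), ∀ y ∈ B, x + 1 < y := by
      intro B hB x hx y hy
      have := hB y hy
      rcases Finset.mem_union.1 hx with h | h
      · have := Finset.mem_range.1 (h2 h)
        omega
      · have := (Finset.mem_Ico.1 h).2
        omega
    exact (pinConf_union_iso w (hgap B h1)).trans
      (((Conf.Iso.refl _).sum (h4.trans h4'.symm)).trans (pinConf_union_iso w (hgap B' h1')).symm)

/-! ### Growth rates from exponential bounds -/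

lemma eventually_pow_le_of_lt {s : ℕ → ℕ} {t t' C : ℝ} (ht : 0 < t) (htt : t < t') (hC : 0 < C)
    (h : ∀ n, C * t' ^ n ≤ s n) : ∀ᶠ n in atTop, t ^ n ≤ s n := by
  have h1 : Tendsto (fun n : ℕ => (t' / t) ^ n) atTop atTop :=
    tendsto_pow_atTop_atTop_of_one_lt ((one_lt_div ht).2 htt)
  filter_upwards [h1.eventually_ge_atTop (1 / C)] with n hn
  refine le_trans ?_ (h n)
  rw [div_pow, div_le_div_iff₀ hC (by positivity)] at hn
  linarith

lemma le_rpow_one_div {t x : ℝ} (ht : 0 ≤ t) {n : ℕ} (hn : n ≠ 0) (h : t ^ n ≤ x) :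
    t ≤ x ^ (1 / (n : ℝ)) := by
  have := Real.rpow_le_rpow (by positivity) h (z := 1 / (n : ℝ)) (by positivity)
  rw [one_div] at this ⊢
  rwa [Real.pow_rpow_inv_natCast ht hn] at this

lemma rpow_one_div_le {t x : ℝ} (ht : 0 ≤ t) (hx : 0 ≤ x) {n : ℕ} (hn : n ≠ 0) (h : x ≤ t ^ n) :
    x ^ (1 / (n : ℝ)) ≤ t := by
  have := Real.rpow_le_rpow hx h (z := 1 / (n : ℝ)) (by positivity)
  rw [one_div] at this ⊢
  rwa [Real.pow_rpow_inv_natCast ht hn] at this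

/-- Exponential lower bounds for all bases below `g` bound the lower growth rate. -/
lemma ofReal_le_lowerGrowthRate {s : ℕ → ℕ} {g : ℝ} (hg : 1 < g)
    (h : ∀ t, 1 < t → t < g → ∃ C : ℝ, 0 < C ∧ ∀ n, C * t ^ n ≤ s n) :
    ENNReal.ofReal g ≤ lowerGrowthRate s := by
  have key : ∀ t, 1 < t → t < g → ENNReal.ofReal t ≤ lowerGrowthRate s := by
    intro t ht htg
    obtain ⟨C, hC, hCs⟩ := h ((t + g) / 2) (by linarith) (by linarith)
    have h1 := eventually_pow_le_of_lt (by linarith) (by linarith : t < (t + g) / 2) hC hCs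
    unfold lowerGrowthRate
    refine le_liminf_of_le (by isBoundedDefault) ?_
    filter_upwards [h1, eventually_ge_atTop 1] with n hn hn1
    have h2 := le_rpow_one_div (by linarith) (by omega) hn
    calc ENNReal.ofReal t ≤ ENNReal.ofReal ((s n : ℝ) ^ (1 / (n : ℝ))) := ENNReal.ofReal_le_ofReal h2
      _ = (s n : ℝ≥0∞) ^ (1 / (n : ℝ)) := by
        rw [← ENNReal.ofReal_rpow_of_nonneg (by positivity) (by positivity),
          ENNReal.ofReal_natCast]
  refine le_of_forall_lt fun b hb => ?_
  obtain ⟨c, hc1, hc2⟩ := exists_between (max_lt hb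
    (show ENNReal.ofReal 1 < ENNReal.ofReal g from (ENNReal.ofReal_lt_ofReal_iff (by linarith)).2 hg))
  have hctop : c ≠ ⊤ := (hc2.trans ENNReal.ofReal_lt_top).ne
  have h1 : 1 < c.toReal := by
    have := (le_max_right _ _).trans_lt hc1
    rw [ENNReal.ofReal_one] at this
    have := (ENNReal.toReal_lt_toReal (by simp) hctop).2 this
    simpa using this
  have h2 : c.toReal < g := by
    rw [← ENNReal.ofReal_toReal hctop] at hc2
    exact (ENNReal.ofReal_lt_ofReal_iff (by linarith)).1 hc2
  have h3 := key _ h1 h2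
  rw [ENNReal.ofReal_toReal hctop] at h3
  exact ((le_max_left _ _).trans_lt hc1).trans_le h3

/-- Matching exponential bounds up to polynomial factors determine the growth rate. -/
lemma hasGrowthRate_of_bounds {s : ℕ → ℕ} {g D : ℝ} (hg : 1 < g)
    (h : ∀ t, 1 < t → t < g → ∃ C : ℝ, 0 < C ∧ ∀ n, C * t ^ n ≤ s n)
    (h' : ∀ n : ℕ, (s n : ℝ) ≤ D * ((n + 1 : ℕ) : ℝ) ^ 2 * g ^ n) : HasGrowthRate s g := by
  unfold HasGrowthRate
  rw [tendsto_order]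
  constructor
  · intro a ha
    obtain ⟨t, ht1, ht2⟩ := exists_between (max_lt ha hg)
    have ht0 : 1 < t := (le_max_right _ _).trans_lt ht1
    obtain ⟨C, hC, hCs⟩ := h ((t + g) / 2) (by linarith) (by linarith)
    have h1 := eventually_pow_le_of_lt (by linarith) (by linarith : t < (t + g) / 2) hC hCs
    filter_upwards [h1, eventually_ge_atTop 1] with n hn hn1
    exact ((le_max_left _ _).trans_lt ht1).trans_le (le_rpow_one_div (by linarith) (by omega) hn)
  · intro b hb
    set t := (g + b) / 2 with ht
    have hgt : g < t := by rw [ht]; linarith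
    have htb : t < b := by rw [ht]; linarith
    have h1 : Tendsto (fun n : ℕ => ((n + 1 : ℕ) : ℝ) ^ 2 * (g / t) ^ (n + 1)) atTop (𝓝 0) :=
      (tendsto_pow_const_mul_const_pow_of_abs_lt_one 2 (r := g / t) (by
        rw [abs_of_pos (div_pos (by linarith) (by linarith))]
        exact (div_lt_one (by linarith)).2 hgt)).comp (tendsto_add_atTop_nat 1)
    have h2 : Tendsto (fun n : ℕ => D * (t / g) * (((n + 1 : ℕ) : ℝ) ^ 2 * (g / t) ^ (n + 1)))
        atTop (𝓝 (D * (t / g) * 0)) := h1.const_mul _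
    rw [mul_zero] at h2
    filter_upwards [h2.eventually_lt_const one_pos, eventually_ge_atTop 1] with n hn hn1
    refine lt_of_le_of_lt (rpow_one_div_le (by linarith) (by positivity) (by omega) ?_) htb
    refine (h' n).trans ?_
    have ht0 : 0 < t := by linarith
    have hg0 : 0 < g := by linarith
    have h3 : D * (t / g) * (((n + 1 : ℕ) : ℝ) ^ 2 * (g / t) ^ (n + 1)) * t ^ n =
        D * ((n + 1 : ℕ) : ℝ) ^ 2 * g ^ n := by
      rw [div_pow]
      field_simp
      ring
    rw [← h3]
    have h4 : 0 < t ^ n := by positivity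
    nlinarith

/-! ### Symmetries of pin sequences -/

/-- Reflection in the vertical axis. -/
def PinLetter.flipX : PinLetter → PinLetter
  | .lu => .ru | .ld => .rd | .ru => .lu | .rd => .ld
  | .ul => .ur | .ur => .ul | .dl => .dr | .dr => .dl

/-- Reflection in the horizontal axis. -/
def PinLetter.flipY : PinLetter → PinLetter
  | .lu => .ld | .ld => .lu | .ru => .rd | .rd => .ru
  | .ul => .dl | .ur => .dr | .dl => .ul | .dr => .ur

/-- Reflection in the main diagonal. -/
def PinLetter.swap : PinLetter → PinLetter
  | .lu => .dr | .ld => .dl | .ru => .ur | .rd => .ul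
  | .ul => .rd | .ur => .ru | .dl => .ld | .dr => .lu

lemma PinLetter.flipX_injective : Function.Injective PinLetter.flipX := by
  intro a b; cases a <;> cases b <;> simp [PinLetter.flipX]

lemma PinLetter.flipY_injective : Function.Injective PinLetter.flipY := by
  intro a b; cases a <;> cases b <;> simp [PinLetter.flipY]

lemma PinLetter.swap_injective : Function.Injective PinLetter.swap := by
  intro a b; cases a <;> cases b <;> simp [PinLetter.swap]

section Symmetry

variable (w : ℕ → PinLetter)

lemma IsPinSequence.flipX {w : ℕ → PinLetter} (hw : IsPinSequence w) :
    IsPinSequence fun i => (w i).flipX := by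
  have h : ∀ a b : PinLetter, b.prev = a.dir → b.flipX.prev = a.flipX.dir := by
    intro a b
    cases a <;> cases b <;> decide
  exact fun i => h _ _ (hw i)

lemma IsPinSequence.flipY {w : ℕ → PinLetter} (hw : IsPinSequence w) :
    IsPinSequence fun i => (w i).flipY := by
  have h : ∀ a b : PinLetter, b.prev = a.dir → b.flipY.prev = a.flipY.dir := by
    intro a b
    cases a <;> cases b <;> decide
  exact fun i => h _ _ (hw i)

lemma IsPinSequence.swap {w : ℕ → PinLetter} (hw : IsPinSequence w) :
    IsPinSequence fun i => (w i).swap := by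
  have h : ∀ a b : PinLetter, b.prev = a.dir → b.swap.prev = a.swap.dir := by
    intro a b
    cases a <;> cases b <;> decide
  exact fun i => h _ _ (hw i)

lemma isHor_flipX (i : ℕ) : isHor (fun i => (w i).flipX) i = isHor w i := by
  simp only [isHor]
  cases w i <;> rfl

lemma isHor_flipY (i : ℕ) : isHor (fun i => (w i).flipY) i = isHor w i := by
  simp only [isHor]
  cases w i <;> rfl

lemma isHor_swap (i : ℕ) : isHor (fun i => (w i).swap) i = !isHor w i := by
  simp only [isHor]
  cases w i <;> rfl

/-- The side of the vertical axis on which a pin with a given letter lies. -/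
lemma isRight_eq (i : ℕ) : isRight w i =
    match w i with | .ru | .rd | .ur | .dr => true | _ => false := by
  unfold isRight pinPoint
  cases w i <;> simp [PinLetter.dir, PinLetter.prev, PinDir.vec] <;> omega

/-- The side of the horizontal axis on which a pin with a given letter lies. -/
lemma isUp_eq (i : ℕ) : isUp w i =
    match w i with | .lu | .ru | .ul | .ur => true | _ => false := by
  unfold isUp pinPoint
  cases w i <;> simp [PinLetter.dir, PinLetter.prev, PinDir.vec] <;> omega

lemma isRight_flipX (i : ℕ) : isRight (fun i => (w i).flipX) i = !isRight w i := by
  rw [isRight_eq, isRight_eq]; cases w i <;> rfl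

lemma isUp_flipX (i : ℕ) : isUp (fun i => (w i).flipX) i = isUp w i := by
  rw [isUp_eq, isUp_eq]; cases w i <;> rfl

lemma isRight_flipY (i : ℕ) : isRight (fun i => (w i).flipY) i = isRight w i := by
  rw [isRight_eq, isRight_eq]; cases w i <;> rfl

lemma isUp_flipY (i : ℕ) : isUp (fun i => (w i).flipY) i = !isUp w i := by
  rw [isUp_eq, isUp_eq]; cases w i <;> rfl

lemma isRight_swap (i : ℕ) : isRight (fun i => (w i).swap) i = isUp w i := by
  rw [isRight_eq, isUp_eq]; cases w i <;> rfl

lemma isUp_swap (i : ℕ) : isUp (fun i => (w i).swap) i = isRight w i := by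
  rw [isRight_eq, isUp_eq]; cases w i <;> rfl

lemma absX_flipX (i : ℕ) : absX (fun i => (w i).flipX) i = absX w i := by
  unfold absX; rw [isHor_flipX]

lemma absY_flipX (i : ℕ) : absY (fun i => (w i).flipX) i = absY w i := by
  unfold absY; rw [isHor_flipX]

lemma absX_flipY (i : ℕ) : absX (fun i => (w i).flipY) i = absX w i := by
  unfold absX; rw [isHor_flipY]

lemma absY_flipY (i : ℕ) : absY (fun i => (w i).flipY) i = absY w i := by
  unfold absY; rw [isHor_flipY]

lemma absX_swap (i : ℕ) : absX (fun i => (w i).swap) i = absY w i := by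
  unfold absX absY; rw [isHor_swap]; cases isHor w i <;> rfl

lemma absY_swap (i : ℕ) : absY (fun i => (w i).swap) i = absX w i := by
  unfold absX absY; rw [isHor_swap]; cases isHor w i <;> rfl

lemma pinClassCount_flipX : pinClassCount (fun i => (w i).flipX) = pinClassCount w := by
  funext n
  refine pinClassCount_congr (fun I J => ?_) n
  simp only [pinConf_iso_iff, isRight_flipX, isUp_flipX, absX_flipX, absY_flipX, Bool.not_inj_iff]

lemma pinClassCount_flipY : pinClassCount (fun i => (w i).flipY) = pinClassCount w := by
  funext n
  refine pinClassCount_congr (fun I J => ?_) n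
  simp only [pinConf_iso_iff, isRight_flipY, isUp_flipY, absX_flipY, absY_flipY, Bool.not_inj_iff]

lemma pinClassCount_swap : pinClassCount (fun i => (w i).swap) = pinClassCount w := by
  funext n
  refine pinClassCount_congr (fun I J => ?_) n
  simp only [pinConf_iso_iff, isRight_swap, isUp_swap, absX_swap, absY_swap]
  exact exists_congr fun e => by tauto

end Symmetry

lemma IsEventuallyPeriodic.of_comp {w : ℕ → PinLetter} {s : PinLetter → PinLetter}
    (hs : Function.Injective s) (h : IsEventuallyPeriodic fun i => s (w i)) :
    IsEventuallyPeriodic w := by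
  obtain ⟨N, p, hp, h⟩ := h
  exact ⟨N, p, hp, fun i hi => hs (h i hi)⟩

/-! ### Contiguous runs of pins -/

/-- An isomorphism between sets of pins from mutually inverse maps on indices. -/
lemma pinConf_iso_of_maps {w w' : ℕ → PinLetter} {I J : Finset ℕ} (f g : ℕ → ℕ)
    (hf : ∀ a ∈ I, f a ∈ J) (hg : ∀ b ∈ J, g b ∈ I) (hgf : ∀ a ∈ I, g (f a) = a)
    (hfg : ∀ b ∈ J, f (g b) = b) (hR : ∀ a ∈ I, isRight w' (f a) = isRight w a)
    (hU : ∀ a ∈ I, isUp w' (f a) = isUp w a)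
    (hX : ∀ a ∈ I, ∀ b ∈ I, isRight w a = isRight w b →
      (absX w' (f a) < absX w' (f b) ↔ absX w a < absX w b))
    (hY : ∀ a ∈ I, ∀ b ∈ I, isUp w a = isUp w b →
      (absY w' (f a) < absY w' (f b) ↔ absY w a < absY w b)) :
    (pinConf w I).Iso (pinConf w' J) :=
  pinConf_iso_iff.2 ⟨⟨fun a => ⟨f a, hf a a.2⟩, fun b => ⟨g b, hg b b.2⟩,
    fun a => Subtype.ext (hgf a a.2), fun b => Subtype.ext (hfg b b.2)⟩,
    fun a => hR a a.2, fun a => hU a a.2, fun a b h => hX a a.2 b b.2 h,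
    fun a b h => hY a a.2 b b.2 h⟩

/-- Runs of the same length are isomorphic if they start in the same axis and visit the same
quadrants. -/
lemma pinConf_Ico_iso {w w' : ℕ → PinLetter} (hw : IsPinSequence w) (hw' : IsPinSequence w')
    {i j k : ℕ} (hh : isHor w i = isHor w' j)
    (hR : ∀ s < k, isRight w (i + s) = isRight w' (j + s))
    (hU : ∀ s < k, isUp w (i + s) = isUp w' (j + s)) :
    (pinConf w (Finset.Ico i (i + k))).Iso (pinConf w' (Finset.Ico j (j + k))) := by
  have hhor : ∀ s, isHor w (i + s) = isHor w' (j + s) := fun s => by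
    rw [isHor_add hw, isHor_add hw', hh]
  have mem : ∀ {i a : ℕ}, a ∈ Finset.Ico i (i + k) → ∃ s < k, a = i + s := by
    intro i a ha
    obtain ⟨h1, h2⟩ := Finset.mem_Ico.1 ha
    exact ⟨a - i, by omega, by omega⟩
  have heq : ∀ s, i + s - i + j = j + s := fun s => by omega
  refine pinConf_iso_of_maps (fun a => a - i + j) (fun b => b - j + i) ?_ ?_ ?_ ?_ ?_ ?_ ?_ ?_
  · intro a ha; rw [Finset.mem_Ico] at *; omega
  · intro a ha; rw [Finset.mem_Ico] at *; omega
  · intro a ha; rw [Finset.mem_Ico] at ha; omega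
  · intro a ha; rw [Finset.mem_Ico] at ha; omega
  · intro a ha
    obtain ⟨s, hs, rfl⟩ := mem ha
    simp only [heq, hR s hs]
  · intro a ha
    obtain ⟨s, hs, rfl⟩ := mem ha
    simp only [heq, hU s hs]
  · intro a ha b hb _
    obtain ⟨s, hs, rfl⟩ := mem ha
    obtain ⟨s', hs', rfl⟩ := mem hb
    simp only [heq, absX, hhor]
    split_ifs <;> omega
  · intro a ha b hb _
    obtain ⟨s, hs, rfl⟩ := mem ha
    obtain ⟨s', hs', rfl⟩ := mem hb
    simp only [heq, absY, hhor]
    split_ifs <;> omega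

/-- Every pin separates its predecessor from the origin. -/
lemma arrow_succ {w : ℕ → PinLetter} (hw : IsPinSequence w) {I : Finset ℕ} {i : ℕ} (hi : i ∈ I)
    (hi' : i + 1 ∈ I) :
    (pinConf w I).Arrow (⟨i, hi⟩ : I) (⟨i + 1, hi'⟩ : I) := by
  have hh := isHor_succ hw i
  cases h : isHor w i
  · refine Or.inr ⟨isUp_succ hw h, ?_⟩
    change absY w (i + 1) < absY w i
    unfold absY
    rw [hh, h]
    simp
    omega
  · refine Or.inl ⟨isRight_succ hw h, ?_⟩
    change absX w (i + 1) < absX w i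
    unfold absX
    rw [hh, h]
    simp
    omega

/-- A run is strongly connected if there is an arrow from its last pin to its first one. -/
lemma strongConn_Ico {w : ℕ → PinLetter} (hw : IsPinSequence w) {i k : ℕ}
    (h : (isRight w i = isRight w (i + k) ∧ absX w i < absX w (i + k)) ∨
      (isUp w i = isUp w (i + k) ∧ absY w i < absY w (i + k))) :
    (pinConf w (Finset.Ico i (i + (k + 1)))).StrongConn := by
  have hmem : ∀ s, s ≤ k → i + s ∈ Finset.Ico i (i + (k + 1)) := fun s hs =>
    Finset.mem_Ico.2 ⟨by omega, by omega⟩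
  have up : ∀ d s (hs : s + d ≤ k), (pinConf w (Finset.Ico i (i + (k + 1)))).Reach
      (⟨i + s, hmem s (by omega)⟩ : ↥(Finset.Ico i (i + (k + 1))))
      (⟨i + (s + d), hmem (s + d) hs⟩ : ↥(Finset.Ico i (i + (k + 1)))) := by
    intro d
    induction d with
    | zero => exact fun s hs => Relation.ReflTransGen.refl
    | succ d ih =>
      intro s hs
      exact (ih s (by omega)).tail (arrow_succ hw (hmem (s + d) (by omega)) (hmem (s + d + 1) hs))
  refine ⟨⟨(⟨i, hmem 0 (by omega)⟩ : ↥(Finset.Ico i (i + (k + 1))))⟩, ?_⟩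
  rintro ⟨a, ha⟩ ⟨b, hb⟩
  obtain ⟨ha1, ha2⟩ := Finset.mem_Ico.1 ha
  obtain ⟨hb1, hb2⟩ := Finset.mem_Ico.1 hb
  obtain ⟨s, rfl⟩ := Nat.exists_eq_add_of_le ha1
  obtain ⟨s', rfl⟩ := Nat.exists_eq_add_of_le hb1
  have h1 := up (k - s) s (by omega)
  have h2 : (pinConf w (Finset.Ico i (i + (k + 1)))).Arrow
      (⟨i + (s + (k - s)), hmem _ (by omega)⟩ : ↥(Finset.Ico i (i + (k + 1))))
      (⟨i + 0, hmem 0 (by omega)⟩ : ↥(Finset.Ico i (i + (k + 1)))) := by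
    have hsk : s + (k - s) = k := by omega
    rcases h with h | h
    · left
      change isRight w (i + 0) = isRight w (i + (s + (k - s))) ∧
        absX w (i + 0) < absX w (i + (s + (k - s)))
      rw [hsk]; exact h
    · right
      change isUp w (i + 0) = isUp w (i + (s + (k - s))) ∧
        absY w (i + 0) < absY w (i + (s + (k - s)))
      rw [hsk]; exact h
  have h3 := up s' 0 (by omega)
  simp only [Nat.zero_add] at h3
  exact (h1.tail h2).trans h3

lemma strongConn_singleton (w : ℕ → PinLetter) (i : ℕ) :
    (pinConf w (Finset.Ico i (i + 1))).StrongConn := by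
  refine ⟨⟨(⟨i, by simp⟩ : ↥(Finset.Ico i (i + 1)))⟩, ?_⟩
  rintro ⟨a, ha⟩ ⟨b, hb⟩
  obtain ⟨ha1, ha2⟩ := Finset.mem_Ico.1 ha
  obtain ⟨hb1, hb2⟩ := Finset.mem_Ico.1 hb
  obtain rfl : a = i := by omega
  obtain rfl : b = a := by omega
  exact Relation.ReflTransGen.refl

/-! ### Recurrent words of a binary sequence -/

/-- The factor of length `m` of the sequence `h` at position `k`. -/
def factor (h : ℕ → Bool) (k m : ℕ) : List Bool := (List.range m).map fun j => h (k + j)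

@[simp] lemma length_factor (h : ℕ → Bool) (k m : ℕ) : (factor h k m).length = m := by
  simp [factor]

lemma factor_eq_iff {h h' : ℕ → Bool} {k k' m : ℕ} :
    factor h k m = factor h' k' m ↔ ∀ j < m, h (k + j) = h' (k' + j) := by
  simp [factor]

/-- The words that occur infinitely often in `h`. -/
def recurrentWords (h : ℕ → Bool) : Set (List Bool) :=
  {u | ∃ᶠ k in atTop, factor h k u.length = u}

/-- The recurrent words of length `m`. -/
noncomputable def words (h : ℕ → Bool) (m : ℕ) : Finset (List Bool) :=
  ((List.finite_length_eq Bool m).inter_of_left (recurrentWords h)).toFinset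

lemma mem_words {h : ℕ → Bool} {m : ℕ} {u : List Bool} :
    u ∈ words h m ↔ u.length = m ∧ u ∈ recurrentWords h := by
  simp [words]

lemma mem_words_iff_frequently {h : ℕ → Bool} {m : ℕ} {u : List Bool} :
    u ∈ words h m ↔ ∃ᶠ k in atTop, factor h k m = u := by
  rw [mem_words]
  constructor
  · rintro ⟨rfl, hu⟩
    exact hu
  · intro hu
    obtain ⟨k, hk⟩ := hu.exists
    have : u.length = m := by rw [← hk]; simp
    refine ⟨this, ?_⟩
    subst this
    exact hu

/-- A position at which a recurrent word occurs. -/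
noncomputable def occ (h : ℕ → Bool) (u : List Bool) : ℕ :=
  Classical.epsilon fun k => factor h k u.length = u

lemma factor_occ {h : ℕ → Bool} {u : List Bool} (hu : u ∈ recurrentWords h) :
    factor h (occ h u) u.length = u :=
  Classical.epsilon_spec hu.exists

/-- If both `a` and `b` recur, then so does the change from `a` to `b`. -/
lemma change_mem_recurrentWords {h : ℕ → Bool} {a b : Bool} (hab : a ≠ b)
    (ha : ∃ᶠ k in atTop, h k = a) (hb : ∃ᶠ k in atTop, h k = b) : [a, b] ∈ recurrentWords h := by
  change ∃ᶠ k in atTop, factor h k 2 = [a, b]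
  rw [frequently_atTop] at ha hb ⊢
  intro N
  obtain ⟨k1, hk1, h1⟩ := ha N
  obtain ⟨k2, hk2, h2⟩ := hb k1
  classical
  have hex : ∃ d, h (k1 + d) = b := ⟨k2 - k1, by rw [Nat.add_sub_cancel' hk2]; exact h2⟩
  have hd := Nat.find_spec hex
  set d := Nat.find hex with hdd
  have hd0 : d ≠ 0 := by
    intro h0
    rw [h0] at hd
    exact hab (h1.symm.trans hd)
  have hd1 := Nat.find_min hex (m := d - 1) (by omega)
  refine ⟨k1 + (d - 1), by omega, ?_⟩
  have h3 : k1 + (d - 1) + 1 = k1 + d := by omega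
  have h4 : h (k1 + (d - 1)) = a := by cases a <;> cases b <;> simp_all
  simp [factor, List.range_succ, h3, h4, hd]

/-! ### Pin sequences that eventually stay above the horizontal axis -/

/-- From pin `i₀` on, all pins lie above the horizontal axis, and the horizontal pins are those with
indices `i₀ + 2 * k`; such a pin goes to the right if `h k` holds. It shares its quadrant with the
up pin that follows. -/
structure UpperTail (w : ℕ → PinLetter) (i₀ : ℕ) (h : ℕ → Bool) : Prop where
  pinSeq : IsPinSequence w
  hor : isHor w i₀ = true
  up : ∀ i, i₀ ≤ i → isUp w i = true
  right : ∀ k, isRight w (i₀ + 2 * k) = h k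

section Upper

variable {w : ℕ → PinLetter} {i₀ : ℕ} {h : ℕ → Bool}

lemma UpperTail.hor_even (hw : UpperTail w i₀ h) (k : ℕ) : isHor w (i₀ + 2 * k) = true := by
  rw [isHor_add hw.pinSeq, hw.hor]
  simp

lemma UpperTail.hor_odd (hw : UpperTail w i₀ h) (k : ℕ) : isHor w (i₀ + 2 * k + 1) = false := by
  rw [isHor_succ hw.pinSeq, hw.hor_even]
  rfl

lemma UpperTail.right_div (hw : UpperTail w i₀ h) (s : ℕ) : isRight w (i₀ + s) = h (s / 2) := by
  rcases Nat.even_or_odd' s with ⟨k, rfl | rfl⟩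
  · rw [hw.right]; congr 1; omega
  · rw [← add_assoc, isRight_succ hw.pinSeq (hw.hor_even k), hw.right]; congr 1; omega

/-- A letter stands for a run of pins in the quadrants given by a word `u`: all the `2 * |u|` pins
that start with a horizontal one, where the first pin is dropped if `b` holds, and the last pin if
`e` holds. -/
abbrev RunLetter := List Bool × Bool × Bool

/-- The number of pins of a letter. -/
def RunLetter.len (a : RunLetter) : ℕ := 2 * a.1.length - a.2.1.toNat - a.2.2.toNat

/-- The letters that are kept. Shorter runs which start with a vertical pin are omitted, as they are
box sums, or isomorphic to runs which start with a horizontal pin. -/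
def RunLetter.Adm (a : RunLetter) : Prop :=
  (a.1.length = 1 ∧ a.2.1 = false) ∨
    (a.1.length = 2 ∧ (a.2.1 = false ∨ (a.2.2 = false ∧ a.1[0]? = a.1[1]?))) ∨ 3 ≤ a.1.length

instance : DecidablePred RunLetter.Adm := fun a => by unfold RunLetter.Adm; infer_instance

/-- The index of the first pin of a run that represents the letter. -/
noncomputable def runPos (i₀ : ℕ) (h : ℕ → Bool) (a : RunLetter) : ℕ :=
  i₀ + (2 * occ h a.1 + a.2.1.toNat)

/-- The configuration of a letter. -/
noncomputable def runConf (w : ℕ → PinLetter) (i₀ : ℕ) (h : ℕ → Bool) (a : RunLetter) : Conf :=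
  pinConf w (Finset.Ico (runPos i₀ h a) (runPos i₀ h a + a.len))

lemma RunLetter.Adm.one_le_len {a : RunLetter} (ha : a.Adm) : 1 ≤ a.len := by
  obtain ⟨u, b, e⟩ := a
  unfold RunLetter.Adm at ha
  unfold RunLetter.len
  cases b <;> cases e <;> simp at * <;> omega

/-- All runs with the word and the shape of a letter are isomorphic to that letter. -/
lemma UpperTail.iso_runConf (hw : UpperTail w i₀ h) {a : RunLetter} (ha : a.1 ∈ recurrentWords h)
    {k : ℕ} (hk : factor h k a.1.length = a.1) {i n : ℕ} (hi : i = i₀ + (2 * k + a.2.1.toNat))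
    (hn : n = a.len) :
    (pinConf w (Finset.Ico i (i + n))).Iso (runConf w i₀ h a) := by
  subst hn hi
  have h1 := hk.trans (factor_occ ha).symm
  rw [factor_eq_iff] at h1
  obtain ⟨u, b, e⟩ := a
  refine pinConf_Ico_iso hw.pinSeq hw.pinSeq ?_ ?_ ?_
  · rw [runPos, isHor_add hw.pinSeq, isHor_add hw.pinSeq i₀]
    congr 2
    simp only [Nat.mul_add_mod]
  · intro s hs
    rw [runPos, add_assoc i₀, add_assoc i₀, hw.right_div, hw.right_div]
    have h2 := h1 ((b.toNat + s) / 2) (by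
      unfold RunLetter.len at hs
      simp only at hs ⊢
      omega)
    simp only at h2 ⊢
    rw [show (2 * k + b.toNat + s) / 2 = k + (b.toNat + s) / 2 by omega,
      show (2 * occ h u + b.toNat + s) / 2 = occ h u + (b.toNat + s) / 2 by omega, h2]
  · intro s _
    rw [runPos, hw.up _ (by omega), hw.up _ (by omega)]

lemma UpperTail.runConf_recurrent (hw : UpperTail w i₀ h) {a : RunLetter}
    (ha : a.1 ∈ recurrentWords h) (N : ℕ) :
    ∃ i, N ≤ i ∧ (pinConf w (Finset.Ico i (i + a.len))).Iso (runConf w i₀ h a) := by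
  obtain ⟨k, hk, hk'⟩ := (frequently_atTop.1 (show ∃ᶠ k in atTop, _ from ha)) N
  exact ⟨_, by omega, hw.iso_runConf ha hk' rfl rfl⟩

lemma UpperTail.runConf_strongConn (hw : UpperTail w i₀ h) {a : RunLetter} (ha : a.Adm) :
    (runConf w i₀ h a).StrongConn := by
  have hl := ha.one_le_len
  obtain ⟨k, hk⟩ : ∃ k, a.len = k + 1 := ⟨a.len - 1, by omega⟩
  unfold runConf
  rw [hk]
  rcases Nat.eq_zero_or_pos k with rfl | hk0
  · exact strongConn_singleton w _
  · refine strongConn_Ico hw.pinSeq (Or.inr ⟨?_, ?_⟩)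
    · rw [runPos, hw.up _ (by omega), hw.up _ (by omega)]
    · obtain ⟨u, b, e⟩ := a
      unfold absY
      have h1 : isHor w (runPos i₀ h (u, b, e)) = !b := by
        cases b
        · exact hw.hor_even _
        · exact hw.hor_odd _
      rw [h1]
      cases b
      · simp; omega
      · unfold RunLetter.Adm at ha
        unfold RunLetter.len at hk
        cases e <;> simp at * <;> split_ifs <;> omega

lemma UpperTail.inQuadrant_up (hw : UpperTail w i₀ h) {a : RunLetter} (ha : a.Adm) {p q : Bool}
    (hq : (runConf w i₀ h a).InQuadrant p q) : q = true := by
  have hl := ha.one_le_len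
  have hm : runPos i₀ h a ∈ Finset.Ico (runPos i₀ h a) (runPos i₀ h a + a.len) :=
    Finset.mem_Ico.2 ⟨le_rfl, by omega⟩
  have h1 : isUp w (runPos i₀ h a) = q :=
    (hq (⟨_, hm⟩ : ↥(Finset.Ico (runPos i₀ h a) (runPos i₀ h a + a.len)))).2
  rw [← h1, hw.up _ (by unfold runPos; omega)]

/-- A permutation that keeps the order of an injective function is trivial. -/
lemma perm_apply_eq_of_lt_iff {α : Type*} (σ : Equiv.Perm α) (a : α → ℕ)
    (ha : Function.Injective a) (hσ : ∀ s t, a (σ s) < a (σ t) ↔ a s < a t) (s : α) : σ s = s := by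
  induction hn : a s using Nat.strong_induction_on generalizing s with
  | _ n ih =>
    subst hn
    by_contra hne
    rcases lt_trichotomy (a (σ s)) (a s) with h1 | h1 | h1
    · exact hne (σ.injective (ih _ h1 (σ s) rfl))
    · exact hne (ha h1)
    · have h2 : a (σ.symm s) < a s := by
        rw [← hσ]
        simpa using h1
      have h3 := ih _ h2 (σ.symm s) rfl
      rw [Equiv.apply_symm_apply] at h3
      rw [← h3] at h2
      exact lt_irrefl _ h2

/-- Two runs above the horizontal axis that start in the same axis are isomorphic only through the
shift of indices, since that is determined by the heights of the points. -/
lemma right_eq_of_iso_of_hor_eq (hw : IsPinSequence w) {i j n : ℕ}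
    (hh : isHor w i = isHor w j) (hi : ∀ s, isUp w (i + s) = true)
    (hiso : (pinConf w (Finset.Ico i (i + n))).Iso (pinConf w (Finset.Ico j (j + n)))) {s : ℕ}
    (hs : s < n) : isRight w (i + s) = isRight w (j + s) := by
  obtain ⟨e, hR, -, -, hY⟩ := pinConf_iso_iff.1 hiso
  have hhor : ∀ s, isHor w (i + s) = isHor w (j + s) := fun s => by
    rw [isHor_add hw, isHor_add hw j, hh]
  have hYs : ∀ s, absY w (j + s) + 2 * i = absY w (i + s) + 2 * j := fun s => by
    unfold absY; rw [hhor]; ring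
  let c : ↥(Finset.Ico j (j + n)) ≃ ↥(Finset.Ico i (i + n)) :=
    { toFun := fun b => ⟨b - j + i, by have := Finset.mem_Ico.1 b.2; rw [Finset.mem_Ico]; omega⟩
      invFun := fun b => ⟨b - i + j, by have := Finset.mem_Ico.1 b.2; rw [Finset.mem_Ico]; omega⟩
      left_inv := fun b => by have := Finset.mem_Ico.1 b.2; apply Subtype.ext; simp only; omega
      right_inv := fun b => by have := Finset.mem_Ico.1 b.2; apply Subtype.ext; simp only; omega }
  have hcY : ∀ b, absY w (c b) + 2 * j = absY w b + 2 * i := fun b => by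
    have h1 := Finset.mem_Ico.1 b.2
    have h2 := hYs (b - j)
    rw [Nat.add_sub_cancel' h1.1] at h2
    have h3 : (c b : ℕ) = i + (b - j) := by change (b : ℕ) - j + i = _; omega
    rw [h3]; omega
  have hup : ∀ a : ↥(Finset.Ico i (i + n)), isUp w a = true := fun a => by
    have := hi (a - i)
    rwa [Nat.add_sub_cancel' (Finset.mem_Ico.1 a.2).1] at this
  have key := perm_apply_eq_of_lt_iff (e.trans c) (fun a => absY w a)
    (fun a b hab => Subtype.ext (absY_injective w hab)) (fun a b => by
      have h1 := hcY (e a)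
      have h2 := hcY (e b)
      have h3 := hY a b (by rw [hup, hup])
      simp only [Equiv.trans_apply]
      omega)
  have hmem : i + s ∈ Finset.Ico i (i + n) := Finset.mem_Ico.2 ⟨by omega, by omega⟩
  have h1 := congrArg Subtype.val (key ⟨i + s, hmem⟩)
  have h2 := hR ⟨i + s, hmem⟩
  have h3 := Finset.mem_Ico.1 (e ⟨i + s, hmem⟩).2
  have h4 : ((e ⟨i + s, hmem⟩ : ↥(Finset.Ico j (j + n))) : ℕ) = j + s := by
    change ((e ⟨i + s, hmem⟩ : ↥(Finset.Ico j (j + n))) : ℕ) - j + i = i + s at h1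
    omega
  rw [h4] at h2
  exact h2.symm

/-- A run that starts with a vertical pin is isomorphic to one that starts with a horizontal pin
only if it has at most three pins, where the first one lies in a quadrant different from the
second. -/
lemma iso_of_hor_ne (hw : IsPinSequence w) {i j n : ℕ} (hhi : isHor w i = false)
    (hhj : isHor w j = true) (hi : ∀ s, isUp w (i + s) = true) (hn : 3 ≤ n)
    (hiso : (pinConf w (Finset.Ico i (i + n))).Iso (pinConf w (Finset.Ico j (j + n)))) :
    n = 3 ∧ isRight w i ≠ isRight w (i + 1) := by
  obtain ⟨e, hR, -, hX, hY⟩ := pinConf_iso_iff.1 hiso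
  have m : ∀ s, s < n → i + s ∈ Finset.Ico i (i + n) := fun s hs =>
    Finset.mem_Ico.2 ⟨by omega, by omega⟩
  have hi1 : isHor w (i + 1) = true := by rw [isHor_succ hw, hhi]; rfl
  have hi2 : isHor w (i + 2) = false := by rw [isHor_succ hw, hi1]; rfl
  have hi3 : isHor w (i + 3) = true := by rw [isHor_succ hw, hi2]; rfl
  have hj1 : isHor w (j + 1) = false := by rw [isHor_succ hw, hhj]; rfl
  have hup : ∀ a : ↥(Finset.Ico i (i + n)), isUp w a = true := fun a => by
    have := hi (a - i)
    rwa [Nat.add_sub_cancel' (Finset.mem_Ico.1 a.2).1] at this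
  have hY' : ∀ a b, absY w (e a) < absY w (e b) ↔ absY w a < absY w b := fun a b =>
    hY a b (by rw [hup, hup])
  have hej : ∀ a, j ≤ (e a : ℕ) := fun a => (Finset.mem_Ico.1 (e a).2).1
  have einj : ∀ a b, (e a : ℕ) = e b → a = b := fun a b hab => e.injective (Subtype.ext hab)
  have Yi : absY w i = 2 * i + 4 := by unfold absY; rw [hhi]; simp
  have Yi1 : absY w (i + 1) = 2 * i + 3 := by unfold absY; rw [hi1]; simp; ring
  have Yi2 : absY w (i + 2) = 2 * i + 8 := by unfold absY; rw [hi2]; simp; ring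
  have Yi3 : absY w (i + 3) = 2 * i + 7 := by unfold absY; rw [hi3]; simp; ring
  have Xi : absX w i = 2 * i + 1 := by unfold absX; rw [hhi]; simp
  have Xi1 : absX w (i + 1) = 2 * i + 6 := by unfold absX; rw [hi1]; simp; ring
  have Xi2 : absX w (i + 2) = 2 * i + 5 := by unfold absX; rw [hi2]; simp; ring
  have Yj : absY w j = 2 * j + 1 := by unfold absY; rw [hhj]; simp
  have Yj1 : absY w (j + 1) = 2 * j + 6 := by unfold absY; rw [hj1]; simp; ring
  have Xj : absX w j = 2 * j + 4 := by unfold absX; rw [hhj]; simp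
  have Xge : ∀ a, 2 * a + 1 ≤ absX w a := fun a => by unfold absX; omega
  have Yge : ∀ a, 2 * a + 1 ≤ absY w a := fun a => by unfold absY; omega
  -- the lowest points correspond
  have e1 : (e ⟨i + 1, m 1 (by omega)⟩ : ℕ) = j := by
    have hjm : j ∈ Finset.Ico j (j + n) := Finset.mem_Ico.2 ⟨le_rfl, by omega⟩
    by_contra hne
    have h1 : ¬absY w (i + 1) < absY w (e.symm ⟨j, hjm⟩) := by
      intro hlt
      have h2 := (hY' ⟨i + 1, m 1 (by omega)⟩ (e.symm ⟨j, hjm⟩)).2 hlt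
      rw [Equiv.apply_symm_apply] at h2
      have h3 := hej ⟨i + 1, m 1 (by omega)⟩
      have h4 := Yge (e ⟨i + 1, m 1 (by omega)⟩)
      simp only at h2
      omega
    have h2 := (Finset.mem_Ico.1 (e.symm ⟨j, hjm⟩).2).1
    have h3 : (e.symm ⟨j, hjm⟩ : ℕ) = i + 1 := by
      have h4 := Yge (e.symm ⟨j, hjm⟩)
      by_contra h5
      by_cases h6 : (e.symm ⟨j, hjm⟩ : ℕ) = i
      · rw [h6] at h1; omega
      · omega
    have h4 : e.symm ⟨j, hjm⟩ = ⟨i + 1, m 1 (by omega)⟩ := Subtype.ext h3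
    rw [← h4, Equiv.apply_symm_apply] at hne
    exact hne rfl
  have small : ∀ a, absX w (e a) < absX w j → (e a : ℕ) = j ∨ (e a : ℕ) = j + 1 := fun a ha => by
    have h1 := hej a
    have h2 := Xge (e a)
    omega
  have e2 : (e ⟨i + 2, m 2 (by omega)⟩ : ℕ) = j + 1 := by
    have h1 := (hX ⟨i + 2, m 2 (by omega)⟩ ⟨i + 1, m 1 (by omega)⟩ (isRight_succ hw hi1)).2
      (by simp only; omega)
    rw [e1] at h1
    rcases small _ h1 with h2 | h2
    · have := congrArg Subtype.val (einj _ _ (h2.trans e1.symm))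
      simp at this
    · exact h2
  constructor
  · by_contra hn3
    have low : ∀ a, absY w (e a) < absY w (j + 1) → (e a : ℕ) ≠ j → (e a : ℕ) = j + 2 :=
      fun a ha hne => by
        have h1 := hej a
        have h2 := Yge (e a)
        by_cases h3 : (e a : ℕ) = j + 1
        · rw [h3] at ha; omega
        · omega
    have e0 : (e ⟨i + 0, m 0 (by omega)⟩ : ℕ) = j + 2 := by
      refine low _ ?_ fun hc => ?_
      · rw [← e2, hY']
        simp only [add_zero]
        omega
      · have := congrArg Subtype.val (einj _ _ (hc.trans e1.symm))
        simp at this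
    have e3 : (e ⟨i + 3, m 3 (by omega)⟩ : ℕ) = j + 2 := by
      refine low _ ?_ fun hc => ?_
      · rw [← e2, hY']
        simp only
        omega
      · have := congrArg Subtype.val (einj _ _ (hc.trans e1.symm))
        simp at this
    have := congrArg Subtype.val (einj _ _ (e0.trans e3.symm))
    simp at this
  · intro hr
    have h1 := (hX ⟨i + 0, m 0 (by omega)⟩ ⟨i + 1, m 1 (by omega)⟩ hr).2
      (by simp only [add_zero]; omega)
    rw [e1] at h1
    rcases small _ h1 with h2 | h2
    · have := congrArg Subtype.val (einj _ _ (h2.trans e1.symm))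
      simp at this
    · have := congrArg Subtype.val (einj _ _ (h2.trans e2.symm))
      simp at this

/-- Letters with isomorphic configurations agree. -/
lemma UpperTail.eq_of_runConf_iso (hw : UpperTail w i₀ h) {a a' : RunLetter} (ha : a.Adm)
    (ha' : a'.Adm) (hu : a.1 ∈ recurrentWords h) (hu' : a'.1 ∈ recurrentWords h)
    (hiso : (runConf w i₀ h a).Iso (runConf w i₀ h a')) : a = a' := by
  have key : ∀ {a a' : RunLetter}, a.Adm → a'.Adm → a.1 ∈ recurrentWords h → a.len = a'.len →
      a.2.1 = true → a'.2.1 = false → ¬(runConf w i₀ h a).Iso (runConf w i₀ h a') := by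
    rintro ⟨u, b, e⟩ ⟨u', b', e'⟩ ha ha' hu hl hb hb' hiso
    simp only at hb hb' hu
    subst hb hb'
    have hl3 : 3 ≤ RunLetter.len (u, true, e) := by
      unfold RunLetter.Adm at ha
      unfold RunLetter.len
      cases e <;> simp at * <;> omega
    unfold runConf at hiso
    rw [← hl] at hiso
    obtain ⟨h1, h2⟩ := iso_of_hor_ne hw.pinSeq (hw.hor_odd _) (hw.hor_even _)
      (fun s => hw.up _ (by omega)) hl3 hiso
    have hlen : u.length = 2 ∧ u[0]? = u[1]? := by
      clear hiso h2
      unfold RunLetter.Adm at ha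
      unfold RunLetter.len at h1
      simp only [Bool.toNat_true] at ha h1
      rcases ha with ha | ha | ha
      · simp at ha
      · simp at ha; exact ⟨ha.1, ha.2.2⟩
      · have := Bool.toNat_le e
        omega
    apply h2
    have h3 := factor_occ hu
    rw [hlen.1] at h3
    rw [← h3] at hlen
    have h4 : h (occ h u) = h (occ h u + 1) := by
      simpa [factor, List.range_succ] using hlen.2
    rw [add_assoc i₀, add_assoc i₀, hw.right_div, hw.right_div]
    rw [show (2 * occ h u + 1) / 2 = occ h u by omega,
      show (2 * occ h u + 1 + 1) / 2 = occ h u + 1 by omega, h4]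
  have hl : a.len = a'.len := by
    have := card_eq_of_iso hiso
    simpa using this
  have hb : a.2.1 = a'.2.1 := by
    cases h1 : a.2.1 <;> cases h2 : a'.2.1
    · rfl
    · exact absurd hiso.symm (key ha' ha hu' hl.symm h2 h1)
    · exact absurd hiso (key ha ha' hu hl h1 h2)
    · rfl
  obtain ⟨u, b, e⟩ := a
  obtain ⟨u', b', e'⟩ := a'
  simp only at hb hu hu'
  subst hb
  have hlen : u.length = u'.length ∧ e = e' := by
    have h1 := ha.one_le_len
    have h2 := ha'.one_le_len
    unfold RunLetter.len at hl h1 h2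
    cases b <;> cases e <;> cases e' <;> simp at * <;> omega
  obtain ⟨hlen, rfl⟩ := hlen
  have hr : ∀ s < RunLetter.len (u, b, e), isRight w (runPos i₀ h (u, b, e) + s) =
      isRight w (runPos i₀ h (u', b, e) + s) := by
    intro s hs
    unfold runConf at hiso
    rw [← hl] at hiso
    refine right_eq_of_iso_of_hor_eq hw.pinSeq ?_ (fun s => hw.up _ (by unfold runPos; omega))
      hiso hs
    cases b
    · exact (hw.hor_even _).trans (hw.hor_even _).symm
    · exact (hw.hor_odd _).trans (hw.hor_odd _).symm
  have : u = u' := by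
    rw [← factor_occ hu, ← factor_occ hu', ← hlen, factor_eq_iff]
    intro j hj
    have h3 : b.toNat ≤ 1 := Bool.toNat_le b
    have h4 : e.toNat ≤ 1 := Bool.toNat_le e
    -- a pin of the run in the `j`-th pair
    obtain ⟨s, hs, hsj⟩ : ∃ s < RunLetter.len (u, b, e), (b.toNat + s) / 2 = j := by
      have h5 := ha
      have h6 := ha.one_le_len
      unfold RunLetter.Adm at h5
      unfold RunLetter.len at h6 ⊢
      simp only at h5 h6 ⊢
      refine ⟨2 * j + 1 - b.toNat - e.toNat, ?_, ?_⟩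
      · cases b <;> cases e <;> simp at * <;> omega
      · cases b <;> cases e <;> simp at * <;> omega
    have h5 := hr s hs
    rw [runPos, runPos, add_assoc i₀, add_assoc i₀, hw.right_div, hw.right_div] at h5
    simp only at h5
    rwa [show (2 * occ h u + b.toNat + s) / 2 = occ h u + j by omega,
      show (2 * occ h u' + b.toNat + s) / 2 = occ h u' + j by omega] at h5
  rw [this]

end Upper

/-! ### Counting letters of a given length -/

section Weights

variable (h : ℕ → Bool)

/-- The number of recurrent words of length `m`. -/
noncomputable def complexity (m : ℕ) : ℕ := (words h m).card

/-- The number of recurrent words of length two with equal letters. -/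
noncomputable def numDoubles : ℕ := ((words h 2).filter fun u => u[0]? = u[1]?).card

/-- The letters whose word has length `m`. -/
noncomputable def lettersOf (m : ℕ) : Finset RunLetter :=
  (words h m ×ˢ (Finset.univ : Finset (Bool × Bool))).filter RunLetter.Adm

/-- The letters whose word has length at most `M`. -/
noncomputable def lettersUpTo (M : ℕ) : Finset RunLetter :=
  (Finset.Icc 1 M).biUnion (lettersOf h)

/-- The generating function of the letters whose word has length at most `M`, for `M ≥ 2`. -/
noncomputable def runGF (M : ℕ) (x : ℝ) : ℝ :=
  complexity h 1 * (x + x ^ 2) + complexity h 2 * (x ^ 3 + x ^ 4) + numDoubles h * x ^ 3 +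
    (1 + x) ^ 2 * ∑ m ∈ Finset.Icc 3 M, complexity h m * x ^ (2 * m - 2)

variable {h}

lemma mem_lettersOf {m : ℕ} {a : RunLetter} :
    a ∈ lettersOf h m ↔ (a.1.length = m ∧ a.1 ∈ recurrentWords h) ∧ a.Adm := by
  simp [lettersOf, mem_words]

lemma mem_lettersUpTo {M : ℕ} {a : RunLetter} :
    a ∈ lettersUpTo h M ↔ (a.1.length ≤ M ∧ a.1 ∈ recurrentWords h) ∧ a.Adm := by
  simp only [lettersUpTo, Finset.mem_biUnion, mem_lettersOf, Finset.mem_Icc]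
  constructor
  · rintro ⟨m, ⟨h1, h2⟩, ⟨h3, h4⟩, h5⟩
    exact ⟨⟨by omega, h4⟩, h5⟩
  · rintro ⟨⟨h3, h4⟩, h5⟩
    refine ⟨_, ⟨?_, h3⟩, ⟨rfl, h4⟩, h5⟩
    unfold RunLetter.Adm at h5
    omega

lemma sum_lettersOf (m : ℕ) (x : ℝ) : ∑ a ∈ lettersOf h m, x ^ a.len =
    ∑ u ∈ words h m, ∑ be : Bool × Bool,
      if RunLetter.Adm (u, be) then x ^ RunLetter.len (u, be) else 0 := by
  rw [lettersOf, Finset.sum_filter, Finset.sum_product]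

lemma sum_lettersOf_one (x : ℝ) :
    ∑ a ∈ lettersOf h 1, x ^ a.len = complexity h 1 * (x + x ^ 2) := by
  rw [sum_lettersOf, complexity, ← nsmul_eq_mul, ← Finset.sum_const]
  refine Finset.sum_congr rfl fun u hu => ?_
  have hl := (mem_words.1 hu).1
  simp [Fintype.sum_prod_type, RunLetter.Adm, RunLetter.len, hl]

lemma sum_lettersOf_two (x : ℝ) : ∑ a ∈ lettersOf h 2, x ^ a.len =
    complexity h 2 * (x ^ 3 + x ^ 4) + numDoubles h * x ^ 3 := by
  rw [sum_lettersOf, complexity, numDoubles, ← nsmul_eq_mul, ← nsmul_eq_mul, ← Finset.sum_const,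
    ← Finset.sum_const, Finset.sum_filter, ← Finset.sum_add_distrib]
  refine Finset.sum_congr rfl fun u hu => ?_
  have hl := (mem_words.1 hu).1
  simp [Fintype.sum_prod_type, RunLetter.Adm, RunLetter.len, hl]
  ring

lemma sum_lettersOf_of_three_le {m : ℕ} (hm : 3 ≤ m) (x : ℝ) :
    ∑ a ∈ lettersOf h m, x ^ a.len = (1 + x) ^ 2 * (complexity h m * x ^ (2 * m - 2)) := by
  rw [sum_lettersOf, complexity, mul_left_comm, ← nsmul_eq_mul, ← Finset.sum_const]
  refine Finset.sum_congr rfl fun u hu => ?_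
  have hl := (mem_words.1 hu).1
  have h1 : 2 * m = 2 * m - 2 + 2 := by omega
  have h2 : 2 * m - 1 = 2 * m - 2 + 1 := by omega
  simp only [Fintype.sum_prod_type, RunLetter.Adm, RunLetter.len, hl, hm, or_true, if_true,
    Fintype.sum_bool, Bool.toNat_true, Bool.toNat_false, Nat.sub_zero, Nat.sub_sub, Nat.add_zero, Nat.zero_add,
    Nat.reduceAdd, h2]
  have h4 : x ^ (2 * m) = x ^ (2 * m - 2) * x ^ 2 := by rw [← pow_add, ← h1]
  rw [h4]
  ring

lemma sum_lettersUpTo {M : ℕ} (hM : 2 ≤ M) (x : ℝ) :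
    ∑ a ∈ lettersUpTo h M, x ^ a.len = runGF h M x := by
  rw [lettersUpTo, Finset.sum_biUnion]
  · have : Finset.Icc 1 M = {1, 2} ∪ Finset.Icc 3 M := by
      ext m; simp only [Finset.mem_union, Finset.mem_insert, Finset.mem_singleton, Finset.mem_Icc]
      omega
    rw [this, Finset.sum_union, Finset.sum_pair (by norm_num), sum_lettersOf_one, sum_lettersOf_two,
      runGF, Finset.mul_sum, ← add_assoc]
    · congr 1
      exact Finset.sum_congr rfl fun m hm => sum_lettersOf_of_three_le (Finset.mem_Icc.1 hm).1 x
    · rw [Finset.disjoint_left]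
      intro m
      simp only [Finset.mem_insert, Finset.mem_singleton, Finset.mem_Icc]
      omega
  · intro m _ m' _ hmm
    rw [Function.onFun, Finset.disjoint_left]
    intro a ha ha'
    exact hmm ((mem_lettersOf.1 ha).1.1.symm.trans (mem_lettersOf.1 ha').1.1)

lemma words_nonempty (h : ℕ → Bool) (m : ℕ) : (words h m).Nonempty := by
  have h1 : ∃ᶠ k in (atTop : Filter ℕ), ∃ u ∈ (List.finite_length_eq Bool m).toFinset,
      factor h k m = u :=
    Frequently.of_forall fun k => ⟨_, by simp, rfl⟩
  by_contra hne
  rw [Finset.not_nonempty_iff_eq_empty] at hne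
  have h2 : ∀ u ∈ (List.finite_length_eq Bool m).toFinset, ∀ᶠ k in atTop, factor h k m ≠ u := by
    intro u _
    have : u ∉ words h m := by rw [hne]; simp
    rw [mem_words_iff_frequently] at this
    exact not_frequently.1 this
  have h3 := (Filter.eventually_all_finset _).2 h2
  obtain ⟨k, ⟨u, hu, hk⟩, h4⟩ := (h1.and_eventually h3).exists
  exact h4 u hu hk

end Weights

/-! ### Bounds for pin sequences above the horizontal axis -/

section Upper

variable {w : ℕ → PinLetter} {i₀ : ℕ} {h : ℕ → Bool}

/-- The lower bound from the recurrent words. -/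
theorem UpperTail.exists_le_pinClassCount (hw : UpperTail w i₀ h) {t : ℝ} (ht : 1 < t) {M : ℕ}
    (hM : 2 ≤ M) (hG : 1 ≤ runGF h M (1 / t)) :
    ∃ C : ℝ, 0 < C ∧ ∀ n, C * t ^ n ≤ pinClassCount w n := by
  obtain ⟨u, hu⟩ := words_nonempty h 1
  have hu' := mem_words.1 hu
  have hone : (u, false, true) ∈ lettersUpTo h M :=
    mem_lettersUpTo.2 ⟨⟨by simp only; omega, hu'.2⟩, Or.inl ⟨hu'.1, rfl⟩⟩
  refine _root_.exists_le_pinClassCount w (lettersUpTo h M) (runConf w i₀ h) RunLetter.len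
    (fun _ _ => True) (fun _ => 1) ht ⟨_, hone⟩
    (fun a ha => (mem_lettersUpTo.1 ha).2.one_le_len)
    (fun a ha => hw.runConf_recurrent (mem_lettersUpTo.1 ha).1.2)
    (fun a ha => hw.runConf_strongConn (mem_lettersUpTo.1 ha).2)
    (fun a ha b hb => hw.eq_of_runConf_iso (mem_lettersUpTo.1 ha).2 (mem_lettersUpTo.1 hb).2
      (mem_lettersUpTo.1 ha).1.2 (mem_lettersUpTo.1 hb).1.2) ?_ (fun _ _ => one_pos) ?_ ?_
  · intro a ha b hb _ q hq hq'
    have h1 := hw.inQuadrant_up (mem_lettersUpTo.1 ha).2 hq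
    have h2 := hw.inQuadrant_up (mem_lettersUpTo.1 hb).2 hq'
    rw [h1] at h2
    simp at h2
  · exact fun a _ => ⟨_, hone, trivial, by simp [RunLetter.len, hu'.1]⟩
  · intro a _
    rw [Finset.filter_true]
    refine hG.trans_eq ?_
    rw [← sum_lettersUpTo hM]
    simp

lemma single_iso {w w' : ℕ → PinLetter} {i j : ℕ} (hR : isRight w i = isRight w' j)
    (hU : isUp w i = isUp w' j) :
    (pinConf w (Finset.Ico i (i + 1))).Iso (pinConf w' (Finset.Ico j (j + 1))) := by
  simp only [Nat.Ico_succ_singleton]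
  refine pinConf_iso_of_maps (fun _ => j) (fun _ => i) ?_ ?_ ?_ ?_ ?_ ?_ ?_ ?_ <;>
    simp [hR, hU]

/-- Two successive pins in one quadrant form the same configuration whether the first of them is
horizontal or vertical; the isomorphism exchanges the two pins. -/
lemma pair_iso {w : ℕ → PinLetter} {i j : ℕ} (hh : isHor w (i + 1) = isHor w j)
    (hh' : isHor w i = isHor w (j + 1)) (hij : isHor w i = !isHor w j)
    (hR0 : isRight w i = isRight w (j + 1)) (hR1 : isRight w (i + 1) = isRight w j)
    (hU0 : isUp w i = isUp w (j + 1)) (hU1 : isUp w (i + 1) = isUp w j) :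
    (pinConf w (Finset.Ico i (i + 2))).Iso (pinConf w (Finset.Ico j (j + 2))) := by
  have hI : ∀ i : ℕ, Finset.Ico i (i + 2) = {i, i + 1} := fun i => by
    ext a; simp only [Finset.mem_Ico, Finset.mem_insert, Finset.mem_singleton]; omega
  have f0 : j + (i + 1 - i) = j + 1 := by omega
  have f1 : j + (i + 1 - (i + 1)) = j := by omega
  simp only [hI]
  refine pinConf_iso_of_maps (fun a => j + (i + 1 - a)) (fun b => i + (j + 1 - b))
    ?_ ?_ ?_ ?_ ?_ ?_ ?_ ?_
  · simp
  · simp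
  · simp
  · simp
  · simp [hR0, hR1]
  · simp [hU0, hU1]
  · simp only [Finset.mem_insert, Finset.mem_singleton]
    rintro a (rfl | rfl) b (rfl | rfl) _ <;>
      simp only [f0, f1, absX, hh, ← hh', hij] <;> cases isHor w j <;> simp <;> omega
  · simp only [Finset.mem_insert, Finset.mem_singleton]
    rintro a (rfl | rfl) b (rfl | rfl) _ <;>
      simp only [f0, f1, absY, hh, ← hh', hij] <;> cases isHor w j <;> simp <;> omega

/-- A vertical pin and two successors in the other upper quadrant form the same configuration as two
pins in that quadrant which start with a horizontal one, and a third pin in the first quadrant. -/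
lemma triple_iso {w : ℕ → PinLetter} (hw : IsPinSequence w) {i j : ℕ} (hhi : isHor w i = false)
    (hhj : isHor w j = true) (hR0 : isRight w i = isRight w (j + 2))
    (hR1 : isRight w (i + 1) = isRight w j) (hR2 : isRight w (i + 2) = isRight w (j + 1))
    (hne : isRight w i ≠ isRight w (i + 1)) (hR : isRight w (i + 2) = isRight w (i + 1))
    (hUi : ∀ s, isUp w (i + s) = true) (hUj : ∀ s, isUp w (j + s) = true) :
    (pinConf w (Finset.Ico i (i + 3))).Iso (pinConf w (Finset.Ico j (j + 3))) := by
  have hI : ∀ i : ℕ, Finset.Ico i (i + 3) = {i, i + 1, i + 2} := fun i => by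
    ext a; simp only [Finset.mem_Ico, Finset.mem_insert, Finset.mem_singleton]; omega
  have hi1 : isHor w (i + 1) = true := by rw [isHor_succ hw, hhi]; rfl
  have hi2 : isHor w (i + 2) = false := by rw [isHor_succ hw, hi1]; rfl
  have hj1 : isHor w (j + 1) = false := by rw [isHor_succ hw, hhj]; rfl
  have hj2 : isHor w (j + 2) = true := by rw [isHor_succ hw, hj1]; rfl
  set f : ℕ → ℕ := fun a => if a = i then j + 2 else j + (a - i - 1) with hf
  set g : ℕ → ℕ := fun b => if b = j + 2 then i else i + (b - j + 1) with hg
  have f0 : f i = j + 2 := by simp [hf]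
  have f1 : f (i + 1) = j := by simp [hf]
  have f2 : f (i + 2) = j + 1 := by simp [hf]
  have g0 : g j = i + 1 := by simp [hg]
  have g1 : g (j + 1) = i + 2 := by simp [hg]
  have g2 : g (j + 2) = i := by simp [hg]
  have u0 := hUi 0
  have v0 := hUj 0
  rw [add_zero] at u0 v0
  simp only [hI]
  refine pinConf_iso_of_maps f g ?_ ?_ ?_ ?_ ?_ ?_ ?_ ?_
  · simp [f0, f1, f2]
  · simp [g0, g1, g2]
  · simp [f0, f1, f2, g0, g1, g2]
  · simp [f0, f1, f2, g0, g1, g2]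
  · simp [f0, f1, f2, hR0, hR1, hR2]
  · simp [f0, f1, f2, hUi, hUj, u0, v0]
  · simp only [Finset.mem_insert, Finset.mem_singleton]
    rintro a (rfl | rfl | rfl) b (rfl | rfl | rfl) hab
    all_goals first
      | exact absurd hab hne
      | exact absurd hab.symm hne
      | exact absurd (hab.trans hR) hne
      | exact absurd (hab.symm.trans hR) hne
      | (simp only [f0, f1, f2, absX, hhi, hi1, hi2, hhj, hj1, hj2]; simp; try omega)
  · simp only [Finset.mem_insert, Finset.mem_singleton]
    rintro a (rfl | rfl | rfl) b (rfl | rfl | rfl) _ <;>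
      simp only [f0, f1, f2, absY, hhi, hi1, hi2, hhj, hj1, hj2] <;> simp <;> try omega

/-- All runs of pins are box sums of letters if all words that occur recur. -/
lemma UpperTail.exists_list_iso_run (hw : UpperTail w i₀ h)
    (hall : ∀ k m, factor h k m ∈ recurrentWords h) {i : ℕ} (hi : i₀ ≤ i) {k : ℕ} (hk : 1 ≤ k) :
    ∃ l : List RunLetter, (∀ a ∈ l, a ∈ {a : RunLetter | a.1 ∈ recurrentWords h ∧ a.Adm}) ∧
      (l.map RunLetter.len).sum = k ∧
      (pinConf w (Finset.Ico i (i + k))).Iso (Conf.list (runConf w i₀ h) l) := by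
  -- a single letter
  have single : ∀ a : RunLetter, a.1 ∈ recurrentWords h → a.Adm → a.len = k →
      (pinConf w (Finset.Ico i (i + k))).Iso (runConf w i₀ h a) →
      ∃ l : List RunLetter, (∀ a ∈ l, a ∈ {a : RunLetter | a.1 ∈ recurrentWords h ∧ a.Adm}) ∧
        (l.map RunLetter.len).sum = k ∧
        (pinConf w (Finset.Ico i (i + k))).Iso (Conf.list (runConf w i₀ h) l) :=
    fun a h1 h2 h3 h4 => ⟨[a], by simpa using ⟨h1, h2⟩, by simpa using h3,
      h4.trans (Conf.sum_empty_iso _).symm⟩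
  obtain ⟨s, rfl⟩ := Nat.exists_eq_add_of_le hi
  obtain ⟨q, rfl | rfl⟩ := Nat.even_or_odd' s
  · refine single (factor h q ((k + 1) / 2), false, decide (k % 2 = 1)) (hall _ _) ?_ ?_ ?_
    · unfold RunLetter.Adm
      simp only [length_factor]
      rcases Nat.lt_or_ge k 3 with h1 | h1
      · exact Or.inl ⟨by omega, trivial⟩
      · rcases Nat.lt_or_ge k 5 with h2 | h2
        · exact Or.inr (Or.inl ⟨by omega, Or.inl trivial⟩)
        · exact Or.inr (Or.inr (by omega))
    · unfold RunLetter.len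
      rcases Nat.mod_two_eq_zero_or_one k with h1 | h1 <;> simp [h1] <;> omega
    · refine hw.iso_runConf (hall _ _) (k := q) (by simp) (by simp) ?_
      unfold RunLetter.len
      rcases Nat.mod_two_eq_zero_or_one k with h1 | h1 <;> simp [h1] <;> omega
  · have hR0 : isRight w (i₀ + (2 * q + 1)) = h q := by
      rw [hw.right_div]; congr 1; omega
    have hR1 : isRight w (i₀ + (2 * q + 1) + 1) = h (q + 1) := by
      rw [add_assoc, hw.right_div]; congr 1; omega
    have hR2 : isRight w (i₀ + (2 * q + 1) + 2) = h (q + 1) := by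
      rw [add_assoc, hw.right_div]; congr 1; omega
    have hh0 : isHor w (i₀ + (2 * q + 1)) = false := hw.hor_odd q
    have hh1 : isHor w (i₀ + (2 * q + 1) + 1) = true := by rw [isHor_succ hw.pinSeq, hh0]; rfl
    have hh2 : isHor w (i₀ + (2 * q + 1) + 2) = false := by
      rw [isHor_succ hw.pinSeq, hh1]; rfl
    -- a single pin in the quadrant of a given pair
    have one : ∀ (j k : ℕ), i₀ ≤ j → isRight w j = h k → (pinConf w (Finset.Ico j (j + 1))).Iso
        (runConf w i₀ h (factor h k 1, false, true)) := fun j k hj hjk =>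
      (single_iso (by rw [hw.right, hjk]) (by rw [hw.up _ hj, hw.up _ (by omega)])).trans
        (hw.iso_runConf (hall _ _) (k := k) (i := i₀ + 2 * k) (by simp) (by simp)
          (by simp [RunLetter.len]))
    rcases Nat.lt_or_ge k 4 with hk4 | hk4
    · interval_cases k
      · exact single (factor h q 1, false, true) (hall _ _) (Or.inl ⟨by simp, by rfl⟩)
          (by simp [RunLetter.len]) (one _ _ (by omega) hR0)
      · by_cases hq : h q = h (q + 1)
        · refine single (factor h q 1, false, false) (hall _ _) (Or.inl ⟨by simp, by rfl⟩)
            (by simp [RunLetter.len]) ?_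
          refine Conf.Iso.trans ?_ (hw.iso_runConf (hall _ _) (k := q) (i := i₀ + 2 * q) (n := 2)
            (by simp) (by simp) (by simp [RunLetter.len]))
          refine pair_iso ?_ rfl ?_ rfl ?_ rfl ?_
          · rw [hh1, hw.hor_even]
          · rw [hh0, hw.hor_even]; rfl
          · rw [hR1, hw.right, hq]
          · rw [hw.up _ (by omega), hw.up _ (by omega)]
        · -- the second pin is closer to the origin, and the first one is on the other side
          refine ⟨[(factor h (q + 1) 1, false, true), (factor h q 1, false, true)], ?_,
            by simp [RunLetter.len], ?_⟩
          · intro a ha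
            simp only [List.mem_cons, List.not_mem_nil, or_false] at ha
            rcases ha with rfl | rfl <;> exact ⟨hall _ _, Or.inl ⟨by simp, by rfl⟩⟩
          · have h1 : Finset.Ico (i₀ + (2 * q + 1)) (i₀ + (2 * q + 1) + 2) =
                Finset.Ico (i₀ + (2 * q + 1) + 1) (i₀ + (2 * q + 1) + 1 + 1) ∪
                  Finset.Ico (i₀ + (2 * q + 1)) (i₀ + (2 * q + 1) + 1) := by
              ext a; simp only [Finset.mem_Ico, Finset.mem_union]; omega
            refine (pinConf_congr_iso h1).trans
              ((pinConf_union_iso_of_lt w ?_ ?_).trans ((one _ _ (by omega) hR1).sum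
                ((one _ _ (by omega) hR0).trans (Conf.sum_empty_iso _).symm)))
            · simp only [Nat.Ico_succ_singleton, Finset.mem_singleton]
              rintro _ rfl _ rfl hR
              rw [hR0, hR1] at hR
              exact absurd hR.symm hq
            · simp only [Nat.Ico_succ_singleton, Finset.mem_singleton]
              rintro _ rfl _ rfl _
              simp only [absY, hh0, hh1]
              simp
              omega
      · by_cases hq : h q = h (q + 1)
        · refine single (factor h q 2, true, false) (hall _ _)
            (Or.inr (Or.inl ⟨by simp, Or.inr ⟨rfl, by simp [factor, List.range_succ, hq]⟩⟩))
            (by simp [RunLetter.len]) ?_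
          exact hw.iso_runConf (hall _ _) (k := q) (by simp) (by simp) (by simp [RunLetter.len])
        · -- the opposite change of sides recurs as well
          have hsw : [h (q + 1), h q] ∈ recurrentWords h := by
            refine change_mem_recurrentWords (Ne.symm hq) ?_ ?_
            · have h1 : ∃ᶠ k in atTop, factor h k 1 = factor h (q + 1) 1 := by
                simpa [recurrentWords] using hall (q + 1) 1
              exact h1.mono fun k hk => by simpa [factor] using hk
            · have h1 : ∃ᶠ k in atTop, factor h k 1 = factor h q 1 := by
                simpa [recurrentWords] using hall q 1
              exact h1.mono fun k hk => by simpa [factor] using hk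
          refine single ([h (q + 1), h q], false, true) hsw
            (Or.inr (Or.inl ⟨by simp, Or.inl (by rfl)⟩)) (by simp [RunLetter.len]) ?_
          obtain ⟨k, hk⟩ := hsw.exists
          refine Conf.Iso.trans ?_ (hw.iso_runConf hsw (k := k) (i := i₀ + 2 * k) (n := 3)
            hk (by simp) (by simp [RunLetter.len]))
          have hk' : h k = h (q + 1) ∧ h (k + 1) = h q := by
            simpa [factor, List.range_succ] using hk
          have r0 : isRight w (i₀ + 2 * k) = h k := hw.right k
          have r1 : isRight w (i₀ + 2 * k + 1) = h k := by
            rw [isRight_succ hw.pinSeq (hw.hor_even k), r0]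
          have r2 : isRight w (i₀ + 2 * k + 2) = h (k + 1) := hw.right (k + 1)
          refine triple_iso hw.pinSeq hh0 (hw.hor_even k) ?_ ?_ ?_ ?_ ?_
            (fun s => hw.up _ (by omega)) (fun s => hw.up _ (by omega))
          · rw [hR0, r2, hk'.2]
          · rw [hR1, r0, hk'.1]
          · rw [hR2, r1, hk'.1]
          · rw [hR0, hR1]; exact hq
          · rw [hR1, hR2]
    · refine single (factor h q ((k + 2) / 2), true, decide (k % 2 = 0)) (hall _ _) ?_ ?_ ?_
      · exact Or.inr (Or.inr (by simp; omega))
      · unfold RunLetter.len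
        rcases Nat.mod_two_eq_zero_or_one k with h1 | h1 <;> simp [h1] <;> omega
      · refine hw.iso_runConf (hall _ _) (k := q) (by simp) (by simp) ?_
        unfold RunLetter.len
        rcases Nat.mod_two_eq_zero_or_one k with h1 | h1 <;> simp [h1] <;> omega

/-- The upper bound if all words that occur recur. -/
theorem UpperTail.pinClassCount_le (hw : UpperTail w i₀ h)
    (hall : ∀ k m, factor h k m ∈ recurrentWords h) {t : ℝ} (ht : 1 ≤ t)
    (hG : ∀ M, 2 ≤ M → runGF h M (1 / t) ≤ 1) (n : ℕ) :
    (pinClassCount w n : ℝ) ≤ 2 ^ i₀ * ((n + 1 : ℕ) : ℝ) ^ 2 * t ^ n := by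
  refine exists_pinClassCount_le w (runConf w i₀ h) RunLetter.len
    {a : RunLetter | a.1 ∈ recurrentWords h ∧ a.Adm} i₀ ht (fun a ha => ha.2.one_le_len)
    (fun n => ⟨lettersUpTo h (n + 2), ?_, ?_⟩)
    (fun i hi k hk => hw.exists_list_iso_run hall hi hk) n
  · intro a ha hn
    refine mem_lettersUpTo.2 ⟨⟨?_, ha.1⟩, ha.2⟩
    unfold RunLetter.len at hn
    have := Bool.toNat_le a.2.1
    have := Bool.toNat_le a.2.2
    omega
  · refine le_trans (le_of_eq ?_) (hG (n + 2) (by omega))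
    rw [← sum_lettersUpTo (by omega)]
    simp

end Upper

/-! ### Complexity of binary sequences -/

section Complexity

variable {h : ℕ → Bool}

lemma factor_succ (h : ℕ → Bool) (k m : ℕ) : factor h k (m + 1) = factor h k m ++ [h (k + m)] := by
  simp [factor, List.range_succ]

lemma take_factor (h : ℕ → Bool) (k : ℕ) {m n : ℕ} (hmn : m ≤ n) :
    (factor h k n).take m = factor h k m := by
  apply List.ext_getElem
  · simp [hmn]
  · intro i h1 h2
    simp [factor]

lemma take_mem_words {m n : ℕ} (hmn : m ≤ n) {u : List Bool} (hu : u ∈ words h n) :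
    u.take m ∈ words h m := by
  rw [mem_words_iff_frequently] at *
  exact hu.mono fun k hk => by rw [← hk, take_factor h k hmn]

lemma exists_extension {m : ℕ} {u : List Bool} (hu : u ∈ words h m) :
    ∃ b, u ++ [b] ∈ words h (m + 1) := by
  simp only [mem_words_iff_frequently] at *
  have h1 : ∃ᶠ k in atTop, factor h k (m + 1) = u ++ [true] ∨ factor h k (m + 1) = u ++ [false] :=
    hu.mono fun k hk => by
      rw [factor_succ, hk]
      cases h (k + m) <;> simp
  rcases frequently_or_distrib.1 h1 with h2 | h2
  · exact ⟨_, h2⟩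
  · exact ⟨_, h2⟩

lemma image_take_words (h : ℕ → Bool) (m : ℕ) :
    (words h (m + 1)).image (List.take m) = words h m := by
  ext u
  rw [Finset.mem_image]
  constructor
  · rintro ⟨v, hv, rfl⟩
    exact take_mem_words (Nat.le_succ m) hv
  · intro hu
    obtain ⟨b, hb⟩ := exists_extension hu
    refine ⟨_, hb, ?_⟩
    have := (mem_words.1 hu).1
    simp [← this]

lemma complexity_le_succ (h : ℕ → Bool) (m : ℕ) : complexity h m ≤ complexity h (m + 1) := by
  unfold complexity
  rw [← image_take_words]
  exact Finset.card_image_le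

lemma complexity_mono (h : ℕ → Bool) : Monotone (complexity h) :=
  monotone_nat_of_le_succ (complexity_le_succ h)

lemma complexity_zero (h : ℕ → Bool) : complexity h 0 = 1 := by
  have : words h 0 = {[]} := by
    ext u
    rw [mem_words_iff_frequently, Finset.mem_singleton]
    constructor
    · intro hu
      obtain ⟨k, rfl⟩ := hu.exists
      simp [factor]
    · rintro rfl
      exact Frequently.of_forall fun k => by simp [factor]
  simp [complexity, this]

/-- Far out, all factors of a given length recur. -/
lemma eventually_factor_mem_words (h : ℕ → Bool) (m : ℕ) :
    ∀ᶠ k in atTop, factor h k m ∈ words h m := by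
  have h1 : ∀ u ∈ (List.finite_length_eq Bool m).toFinset, ∀ᶠ k in atTop,
      factor h k m = u → u ∈ words h m := by
    intro u _
    by_cases hu : u ∈ words h m
    · exact Eventually.of_forall fun _ _ => hu
    · rw [mem_words_iff_frequently, not_frequently] at hu
      exact hu.mono fun k hk h => absurd h hk
  filter_upwards [(Filter.eventually_all_finset _).2 h1] with k hk
  exact hk _ (by simp) rfl

/-- If the complexity does not increase from `m` to `m + 1`, then far out a factor of length `m`
determines the sequence that follows. -/
lemma exists_determined {m : ℕ} (hm : complexity h m = complexity h (m + 1)) :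
    ∃ K, ∀ k k', K ≤ k → K ≤ k' → factor h k m = factor h k' m → ∀ j, h (k + j) = h (k' + j) := by
  obtain ⟨K, hK⟩ := eventually_atTop.1 (eventually_factor_mem_words h (m + 1))
  have hinj : Set.InjOn (List.take m) (words h (m + 1) : Set (List Bool)) := by
    rw [← Finset.card_image_iff, image_take_words]
    exact hm
  have step : ∀ k k', K ≤ k → K ≤ k' → factor h k m = factor h k' m →
      factor h k (m + 1) = factor h k' (m + 1) := by
    intro k k' hk hk' heq
    refine hinj (hK k hk) (hK k' hk') ?_
    rwa [take_factor h k (Nat.le_succ m), take_factor h k' (Nat.le_succ m)]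
  refine ⟨K, fun k k' hk hk' heq => ?_⟩
  have hall : ∀ d, factor h (k + d) m = factor h (k' + d) m := by
    intro d
    induction d with
    | zero => exact heq
    | succ d ih =>
      have h1 := step _ _ (by omega) (by omega) ih
      rw [factor_eq_iff] at h1 ⊢
      intro j hj
      have h2 := h1 (j + 1) (by omega)
      rw [show k + (d + 1) + j = k + d + (j + 1) by ring,
        show k' + (d + 1) + j = k' + d + (j + 1) by ring, h2]
  intro j
  rcases Nat.lt_or_ge j m with hj | hj
  · exact factor_eq_iff.1 heq j hj
  · have h1 := step _ _ (by omega) (by omega) (hall (j - m))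
    have h2 := factor_eq_iff.1 h1 m (by omega)
    rwa [show k + (j - m) + m = k + j by omega, show k' + (j - m) + m = k' + j by omega] at h2

/-- Once the complexity stagnates, it is constant. -/
lemma complexity_eq_of_le {m n : ℕ} (hm : complexity h m = complexity h (m + 1)) (hmn : m ≤ n) :
    complexity h n = complexity h m := by
  refine le_antisymm ?_ (complexity_mono h hmn)
  obtain ⟨K, hK⟩ := exists_determined hm
  refine Finset.card_le_card_of_injOn (List.take m) (fun u hu => take_mem_words hmn hu) ?_
  intro u hu v hv huv
  obtain ⟨k, hk, rfl⟩ := (frequently_atTop.1 (mem_words_iff_frequently.1 hu)) K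
  obtain ⟨k', hk', rfl⟩ := (frequently_atTop.1 (mem_words_iff_frequently.1 hv)) K
  rw [take_factor h k hmn, take_factor h k' hmn] at huv
  exact factor_eq_iff.2 fun j _ => hK k k' hk hk' huv j

/-- Once the complexity stagnates, the sequence is eventually periodic (Morse and Hedlund). -/
lemma exists_periodic {m : ℕ} (hm : complexity h m = complexity h (m + 1)) :
    ∃ N p, 0 < p ∧ ∀ k, N ≤ k → h (k + p) = h k := by
  obtain ⟨K, hK⟩ := exists_determined hm
  obtain ⟨a, b, hab, heq⟩ : ∃ a b, a < b ∧ factor h (K + a) m = factor h (K + b) m := by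
    have : Finite {u : List Bool | u.length = m} := List.finite_length_eq Bool m
    obtain ⟨a, b, hne, heq⟩ := Finite.exists_ne_map_eq_of_infinite
      (fun a : ℕ => (⟨factor h (K + a) m, by simp⟩ : {u : List Bool | u.length = m}))
    have heq' := congrArg Subtype.val heq
    rcases lt_or_gt_of_ne hne with hlt | hlt
    · exact ⟨a, b, hlt, heq'⟩
    · exact ⟨b, a, hlt, heq'.symm⟩
  refine ⟨K + a, b - a, by omega, fun k hk => ?_⟩
  have := hK (K + a) (K + b) (by omega) (by omega) heq (k - (K + a))
  rw [show K + a + (k - (K + a)) = k by omega, show K + b + (k - (K + a)) = k + (b - a) by omega]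
    at this
  exact this.symm

lemma mem_recurrentWords_of_periodic {p : ℕ} (hp : 0 < p) (hper : ∀ k, h (k + p) = h k)
    (k m : ℕ) : factor h k m ∈ recurrentWords h := by
  have h1 : ∀ j k, h (k + p * j) = h k := by
    intro j
    induction j with
    | zero => simp
    | succ j ih =>
      intro k
      rw [Nat.mul_succ, ← add_assoc, hper, ih]
  change ∃ᶠ k' in atTop, factor h k' _ = _
  rw [frequently_atTop, length_factor]
  intro N
  refine ⟨k + p * N, ?_, ?_⟩
  · have := Nat.le_mul_of_pos_left N hp
    omega
  · rw [factor_eq_iff]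
    intro j _
    rw [show k + p * N + j = k + j + p * N by ring, h1]

lemma words_shift (h : ℕ → Bool) (K m : ℕ) : words (fun k => h (k + K)) m = words h m := by
  ext u
  have h1 : ∀ k, factor (fun k => h (k + K)) k m = factor h (k + K) m := fun k => by
    rw [factor_eq_iff]
    intro j _
    congr 1
    ring
  rw [mem_words_iff_frequently, mem_words_iff_frequently]
  simp only [h1]
  rw [frequently_atTop, frequently_atTop]
  constructor
  · intro hu N
    obtain ⟨k, hk, hk'⟩ := hu N
    exact ⟨k + K, by omega, hk'⟩
  · intro hu N
    obtain ⟨k, hk, hk'⟩ := hu (N + K)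
    exact ⟨k - K, by omega, by rwa [Nat.sub_add_cancel (by omega)]⟩

lemma complexity_shift (h : ℕ → Bool) (K m : ℕ) :
    complexity (fun k => h (k + K)) m = complexity h m := by
  unfold complexity
  rw [words_shift]

lemma mem_words_one {b : Bool} : [b] ∈ words h 1 ↔ ∃ᶠ k in atTop, h k = b := by
  rw [mem_words_iff_frequently]
  exact frequently_congr (Eventually.of_forall fun k => by simp [factor])

lemma mem_words_two {a b : Bool} :
    [a, b] ∈ words h 2 ↔ ∃ᶠ k in atTop, h k = a ∧ h (k + 1) = b := by
  rw [mem_words_iff_frequently]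
  exact frequently_congr (Eventually.of_forall fun k => by simp [factor, List.range_succ])

lemma frequently_of_mem_words_two {a b : Bool} (hab : [a, b] ∈ words h 2) :
    (∃ᶠ k in atTop, h k = a) ∧ ∃ᶠ k in atTop, h k = b := by
  rw [mem_words_two] at hab
  refine ⟨hab.mono fun k hk => hk.1, ?_⟩
  rw [frequently_atTop] at hab ⊢
  intro N
  obtain ⟨k, hk, hk'⟩ := hab N
  exact ⟨k + 1, by omega, hk'.2⟩

lemma filter_words_two_subset (h : ℕ → Bool) :
    (words h 2).filter (fun u => ¬u[0]? = u[1]?) ⊆ {[true, false], [false, true]} := by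
  intro u hu
  obtain ⟨hu1, hu2⟩ := Finset.mem_filter.1 hu
  have hl := (mem_words.1 hu1).1
  obtain ⟨a, b, rfl⟩ := List.length_eq_two.1 hl
  cases a <;> cases b <;> simp at hu2 ⊢

lemma complexity_two_eq (h : ℕ → Bool) : complexity h 2 =
    numDoubles h + ((words h 2).filter fun u => ¬u[0]? = u[1]?).card := by
  unfold complexity numDoubles
  rw [Finset.card_filter_add_card_filter_not]

lemma words_one_subset (h : ℕ → Bool) : words h 1 ⊆ {[true], [false]} := by
  intro u hu
  obtain ⟨a, rfl⟩ := List.length_eq_one_iff.1 (mem_words.1 hu).1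
  cases a <;> simp

lemma complexity_one_le (h : ℕ → Bool) : complexity h 1 ≤ 2 :=
  Finset.card_le_card (words_one_subset h)

/-- If both letters recur, then so do both changes. -/
lemma complexity_two_of_one (h1 : complexity h 1 = 2) : complexity h 2 = numDoubles h + 2 := by
  have hw : words h 1 = {[true], [false]} :=
    Finset.eq_of_subset_of_card_le (words_one_subset h) (by unfold complexity at h1; rw [h1]; decide)
  have ht : ∃ᶠ k in atTop, h k = true := mem_words_one.1 (by rw [hw]; simp)
  have hf : ∃ᶠ k in atTop, h k = false := mem_words_one.1 (by rw [hw]; simp)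
  have : (words h 2).filter (fun u => ¬u[0]? = u[1]?) = {[true, false], [false, true]} := by
    refine Finset.Subset.antisymm (filter_words_two_subset h) fun u hu => ?_
    rcases Finset.mem_insert.1 hu with rfl | hu
    · exact Finset.mem_filter.2
        ⟨mem_words.2 ⟨rfl, change_mem_recurrentWords (by simp) ht hf⟩, by simp⟩
    · rw [Finset.mem_singleton] at hu
      subst hu
      exact Finset.mem_filter.2
        ⟨mem_words.2 ⟨rfl, change_mem_recurrentWords (by simp) hf ht⟩, by simp⟩
  rw [complexity_two_eq, this]
  rfl

/-- If only one letter recurs, then no change does. -/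
lemma complexity_two_of_one' (h1 : complexity h 1 = 1) : complexity h 2 = numDoubles h := by
  have : (words h 2).filter (fun u => ¬u[0]? = u[1]?) = ∅ := by
    rw [Finset.filter_eq_empty_iff]
    intro u hu
    obtain ⟨a, b, rfl⟩ := List.length_eq_two.1 (mem_words.1 hu).1
    obtain ⟨ha, hb⟩ := frequently_of_mem_words_two hu
    have := Finset.card_le_one.1 h1.le _ (mem_words_one.2 ha) _ (mem_words_one.2 hb)
    simpa using this
  rw [complexity_two_eq, this]
  rfl

end Complexity

section UpperPeriodic

variable {w : ℕ → PinLetter} {i₀ : ℕ} {h : ℕ → Bool}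

lemma UpperTail.shift (hw : UpperTail w i₀ h) (K : ℕ) :
    UpperTail w (i₀ + 2 * K) fun k => h (k + K) where
  pinSeq := hw.pinSeq
  hor := hw.hor_even K
  up i hi := hw.up i (by omega)
  right k := by rw [add_assoc, ← mul_add, hw.right, add_comm]

lemma pinLetter_eq_of_sides {w : ℕ → PinLetter} {i j : ℕ} (h1 : isHor w i = isHor w j)
    (h2 : isRight w i = isRight w j) (h3 : isUp w i = isUp w j) : w i = w j := by
  rw [isRight_eq, isRight_eq] at h2
  rw [isUp_eq, isUp_eq] at h3
  unfold isHor at h1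
  revert h1 h2 h3
  cases w i <;> cases w j <;> simp [PinLetter.dir]

lemma UpperTail.isEventuallyPeriodic (hw : UpperTail w i₀ h) {N p : ℕ} (hp : 0 < p)
    (hper : ∀ k, N ≤ k → h (k + p) = h k) : IsEventuallyPeriodic w := by
  refine ⟨i₀ + 2 * N, 2 * p, by omega, fun i hi => ?_⟩
  obtain ⟨s, rfl⟩ := Nat.exists_eq_add_of_le (show i₀ ≤ i by omega)
  refine pinLetter_eq_of_sides ?_ ?_ ?_
  · rw [isHor_add hw.pinSeq]; simp
  · rw [add_assoc, hw.right_div, hw.right_div, ← hper (s / 2) (by omega)]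
    congr 1
    omega
  · rw [hw.up _ (by omega), hw.up _ (by omega)]

end UpperPeriodic

/-! ### The words `(l u (r u)^ℓ)^∞` -/

lemma isPinSequence_oneEllWord (ℓ : ℕ) : IsPinSequence (oneEllWord ℓ) := by
  intro i
  unfold oneEllWord
  rcases Nat.mod_two_eq_zero_or_one i with hi | hi
  · rw [show (i + 1) / 2 = i / 2 by omega, show (i + 1) % 2 = 1 by omega, hi]
    split_ifs <;> simp_all [PinLetter.prev, PinLetter.dir]
  · rw [show (i + 1) % 2 = 0 by omega, hi]
    split_ifs <;> simp_all [PinLetter.prev, PinLetter.dir]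

lemma upperTail_oneEllWord (ℓ : ℕ) :
    UpperTail (oneEllWord ℓ) 0 fun k => decide (k % (ℓ + 1) ≠ 0) where
  pinSeq := isPinSequence_oneEllWord ℓ
  hor := by simp [isHor, oneEllWord, PinLetter.dir]
  up i _ := by
    rw [isUp_eq]
    unfold oneEllWord
    split_ifs <;> rfl
  right k := by
    rw [isRight_eq]
    unfold oneEllWord
    by_cases hk : k % (ℓ + 1) = 0 <;> simp [hk]

lemma complexity_oneEll (ℓ m : ℕ) :
    complexity (fun k => decide (k % (ℓ + 1) ≠ 0)) m = min m ℓ + 1 := by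
  set h : ℕ → Bool := fun k => decide (k % (ℓ + 1) ≠ 0) with hh
  have hper : ∀ k, h (k + (ℓ + 1)) = h k := fun k => by simp [hh]
  have hfalse : ∀ k, h k = false ↔ k % (ℓ + 1) = 0 := fun k => by simp [hh]
  have htrue : ∀ k, 1 ≤ k → k ≤ ℓ → h k = true := fun k h1 h2 => by
    simp only [hh, decide_eq_true_eq]
    rw [Nat.mod_eq_of_lt (by omega)]
    omega
  have hw : words h m =
      (Finset.range (min m ℓ + 1)).image fun r => factor h (ℓ + 1 - r) m := by
    ext u
    rw [Finset.mem_image]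
    constructor
    · intro hu
      obtain ⟨k, rfl⟩ := (mem_words_iff_frequently.1 hu).exists
      have hk : k % (ℓ + 1) < ℓ + 1 := Nat.mod_lt _ (by omega)
      -- the distance from `k` to the next multiple of `ℓ + 1`
      obtain ⟨r, hr, hkr⟩ : ∃ r, r ≤ ℓ ∧ (k + r) % (ℓ + 1) = 0 := by
        rcases Nat.eq_zero_or_pos (k % (ℓ + 1)) with h0 | h0
        · exact ⟨0, by omega, by simpa using h0⟩
        · refine ⟨ℓ + 1 - k % (ℓ + 1), by omega, ?_⟩
          have := Nat.div_add_mod k (ℓ + 1)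
          have h2 : k + (ℓ + 1 - k % (ℓ + 1)) = (ℓ + 1) * (k / (ℓ + 1) + 1) := by
            rw [mul_add]; omega
          rw [h2]; simp
      have hmod : ∀ j, (k + j) % (ℓ + 1) = (ℓ + 1 - r + j) % (ℓ + 1) := by
        intro j
        have h1 : (k + r + j) ≡ (ℓ + 1 - r + r + j) [MOD ℓ + 1] := by
          refine Nat.ModEq.add_right j ?_
          rw [Nat.sub_add_cancel (by omega)]
          exact hkr.trans (by simp)
        have h2 : (k + j) + r ≡ (ℓ + 1 - r + j) + r [MOD ℓ + 1] := by
          rwa [add_right_comm, add_right_comm (ℓ + 1 - r)]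
        exact Nat.ModEq.add_right_cancel' r h2
      have hf : factor h k m = factor h (ℓ + 1 - r) m := by
        rw [factor_eq_iff]
        intro j _
        simp only [hh, hmod j]
      rcases le_or_gt r (min m ℓ) with hrm | hrm
      · exact ⟨r, Finset.mem_range.2 (by omega), hf.symm⟩
      · refine ⟨m, Finset.mem_range.2 (by omega), ?_⟩
        rw [hf, factor_eq_iff]
        intro j hj
        rw [htrue _ (by omega) (by omega), htrue _ (by omega) (by omega)]
    · rintro ⟨r, -, rfl⟩
      exact mem_words.2 ⟨by simp, mem_recurrentWords_of_periodic (by omega) hper _ _⟩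
  unfold complexity
  rw [hw, Finset.card_image_of_injOn, Finset.card_range]
  have key : ∀ r r', r < r' → r' ≤ min m ℓ →
      factor h (ℓ + 1 - r) m ≠ factor h (ℓ + 1 - r') m := by
    intro r r' hlt hr' heq
    have h1 := factor_eq_iff.1 heq r (by omega)
    rw [htrue (ℓ + 1 - r' + r) (by omega) (by omega), Nat.sub_add_cancel (by omega)] at h1
    have h2 := (hfalse (ℓ + 1)).2 (by simp)
    rw [h1] at h2
    simp at h2
  intro r hr r' hr' heq
  have hr := Finset.mem_range.1 hr
  have hr' := Finset.mem_range.1 hr'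
  by_contra hne
  rcases lt_or_gt_of_ne hne with hlt | hlt
  · exact key r r' hlt (by omega) heq
  · exact key r' r hlt (by omega) heq.symm

/-! ### Evaluating the generating function -/

lemma hasSum_indicator_geometric {y : ℝ} (hy0 : 0 ≤ y) (hy1 : y < 1) (j : ℕ) :
    HasSum (fun i => (if j ≤ i then 1 else 0) * y ^ (i + 2)) (y ^ (j + 2) / (1 - y)) := by
  have h1 : HasSum (fun i => y ^ (j + 2) * y ^ i) (y ^ (j + 2) / (1 - y)) :=
    (hasSum_geometric_of_lt_one hy0 hy1).mul_left _
  rw [← (add_left_injective j).hasSum_iff]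
  · refine h1.congr_fun fun i => ?_
    simp only [Function.comp, le_add_iff_nonneg_left, Nat.zero_le, if_true, one_mul]
    ring
  · intro i hi
    rw [if_neg, zero_mul]
    intro hji
    exact hi ⟨i - j, Nat.sub_add_cancel hji⟩

lemma hasSum_affine_geometric {y : ℝ} (hy0 : 0 ≤ y) (hy1 : y < 1) :
    HasSum (fun i : ℕ => ((i + 4 : ℕ) : ℝ) * y ^ (i + 2))
      (4 * y ^ 2 / (1 - y) + y ^ 3 / (1 - y) ^ 2) := by
  have h1 := (hasSum_geometric_of_lt_one hy0 hy1).mul_left (4 * y ^ 2)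
  have h2 := (hasSum_coe_mul_geometric_of_norm_lt_one
    (by rwa [Real.norm_of_nonneg hy0] : ‖y‖ < 1)).mul_left (y ^ 2)
  rw [show 4 * y ^ 2 / (1 - y) + y ^ 3 / (1 - y) ^ 2 =
    4 * y ^ 2 * (1 - y)⁻¹ + y ^ 2 * (y / (1 - y) ^ 2) by ring]
  exact (h1.add h2).congr_fun fun i => by push_cast; ring

lemma hasSum_min_geometric {y : ℝ} (hy0 : 0 ≤ y) (hy1 : y < 1) {ℓ : ℕ} (hℓ : 2 ≤ ℓ) :
    HasSum (fun i : ℕ => ((min (i + 3) ℓ + 1 : ℕ) : ℝ) * y ^ (i + 2))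
      (4 * y ^ 2 / (1 - y) + y ^ 3 / (1 - y) ^ 2 - y ^ ℓ / (1 - y) ^ 2) := by
  have hy : 1 - y ≠ 0 := by linarith
  induction ℓ, hℓ using Nat.le_induction with
  | base =>
    have h1 := (hasSum_indicator_geometric hy0 hy1 0).mul_left 3
    rw [show 4 * y ^ 2 / (1 - y) + y ^ 3 / (1 - y) ^ 2 - y ^ 2 / (1 - y) ^ 2 =
      3 * (y ^ (0 + 2) / (1 - y)) by field_simp; ring]
    refine h1.congr_fun fun i => ?_
    rw [show min (i + 3) 2 = 2 by omega]
    norm_num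
  | succ ℓ hℓ ih =>
    have h1 := hasSum_indicator_geometric hy0 hy1 (ℓ - 2)
    rw [Nat.sub_add_cancel hℓ] at h1
    rw [show 4 * y ^ 2 / (1 - y) + y ^ 3 / (1 - y) ^ 2 - y ^ (ℓ + 1) / (1 - y) ^ 2 =
      4 * y ^ 2 / (1 - y) + y ^ 3 / (1 - y) ^ 2 - y ^ ℓ / (1 - y) ^ 2 + y ^ ℓ / (1 - y) by
        field_simp; ring]
    refine (ih.add h1).congr_fun fun i => ?_
    rw [← add_mul]
    congr 1
    split_ifs with h
    · rw [show min (i + 3) (ℓ + 1) = min (i + 3) ℓ + 1 by omega]; push_cast; ring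
    · rw [show min (i + 3) (ℓ + 1) = min (i + 3) ℓ by omega]; push_cast; ring

lemma runGF_add_two (h : ℕ → Bool) (n : ℕ) (x : ℝ) : runGF h (n + 2) x =
    complexity h 1 * (x + x ^ 2) + complexity h 2 * (x ^ 3 + x ^ 4) + numDoubles h * x ^ 3 +
      (1 + x) ^ 2 * ∑ i ∈ Finset.range n, complexity h (i + 3) * (x ^ 2) ^ (i + 2) := by
  rw [runGF, show Finset.Icc 3 (n + 2) = Finset.Ico 3 (n + 3) by ext; simp; omega,
    Finset.sum_Ico_eq_sum_range]
  congr 2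
  refine Finset.sum_congr (by simp) fun i _ => ?_
  rw [← pow_mul, add_comm 3 i, show 2 * (i + 3) - 2 = 2 * (i + 2) by omega]

lemma mul_runGF_le (h : ℕ → Bool) (M : ℕ) {x r : ℝ} (hx : 0 ≤ x) (hr : 1 ≤ r) :
    r * runGF h M x ≤ runGF h M (r * x) := by
  have hpow : ∀ k, 1 ≤ k → r * x ^ k ≤ (r * x) ^ k := fun k hk => by
    rw [mul_pow]
    exact mul_le_mul_of_nonneg_right (le_self_pow₀ hr (by omega)) (by positivity)
  have h1 := hpow 1 le_rfl
  have h2 := hpow 2 (by omega)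
  have h3 := hpow 3 (by omega)
  have h4 := hpow 4 (by omega)
  rw [pow_one] at h1
  have e1 : (complexity h 1 : ℝ) * (r * x + r * x ^ 2) ≤ complexity h 1 * (r * x + (r * x) ^ 2) := by
    gcongr
  have e2 : (complexity h 2 : ℝ) * (r * x ^ 3 + r * x ^ 4) ≤
      complexity h 2 * ((r * x) ^ 3 + (r * x) ^ 4) := by
    gcongr
  have e3 : (numDoubles h : ℝ) * (r * x ^ 3) ≤ numDoubles h * (r * x) ^ 3 := by gcongr
  have e4 : (1 + x) ^ 2 * (r * ∑ m ∈ Finset.Icc 3 M, complexity h m * x ^ (2 * m - 2)) ≤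
      (1 + r * x) ^ 2 * ∑ m ∈ Finset.Icc 3 M, complexity h m * (r * x) ^ (2 * m - 2) := by
    have hxr : x ≤ r * x := le_mul_of_one_le_left hx hr
    rw [Finset.mul_sum]
    refine mul_le_mul (by gcongr) (Finset.sum_le_sum fun m hm => ?_)
      (Finset.sum_nonneg fun m _ => by positivity) (by positivity)
    rw [mul_left_comm]
    have := (Finset.mem_Icc.1 hm).1
    exact mul_le_mul_of_nonneg_left (hpow _ (by omega)) (by positivity)
  unfold runGF
  calc _ = (complexity h 1 : ℝ) * (r * x + r * x ^ 2) + complexity h 2 * (r * x ^ 3 + r * x ^ 4) +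
        numDoubles h * (r * x ^ 3) +
        (1 + x) ^ 2 * (r * ∑ m ∈ Finset.Icc 3 M, complexity h m * x ^ (2 * m - 2)) := by ring
    _ ≤ _ := by gcongr

/-- If lower bounds for the complexity make the full generating function at least `1` at `1 / g`,
then already a partial sum is at least `1` at any larger argument, as all terms have positive
degree. -/
lemma exists_one_le_runGF {h : ℕ → Bool} {a₁ a₂ d : ℝ} {c : ℕ → ℝ} {S g t : ℝ}
    (h1 : a₁ ≤ complexity h 1) (h2 : a₂ ≤ complexity h 2) (hd : d ≤ numDoubles h)
    (hc : ∀ i, c i ≤ complexity h (i + 3))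
    (hS : HasSum (fun i => c i * ((1 / g) ^ 2) ^ (i + 2)) S)
    (hV : 1 ≤ a₁ * (1 / g + (1 / g) ^ 2) + a₂ * ((1 / g) ^ 3 + (1 / g) ^ 4) + d * (1 / g) ^ 3 +
      (1 + 1 / g) ^ 2 * S)
    (ht : 1 < t) (htg : t < g) : ∃ M, 2 ≤ M ∧ 1 ≤ runGF h M (1 / t) := by
  have hg : 0 < g := by linarith
  have hlim := (hS.tendsto_sum_nat.const_mul ((1 + 1 / g) ^ 2)).const_add
    (a₁ * (1 / g + (1 / g) ^ 2) + a₂ * ((1 / g) ^ 3 + (1 / g) ^ 4) + d * (1 / g) ^ 3)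
  have hlt : t / g < 1 := (div_lt_one hg).2 htg
  obtain ⟨n, hn⟩ := (hlim.eventually (eventually_gt_nhds (hlt.trans_le hV))).exists
  refine ⟨n + 2, by omega, ?_⟩
  have hle : t / g ≤ runGF h (n + 2) (1 / g) := by
    refine hn.le.trans ?_
    rw [runGF_add_two]
    gcongr
    exact hc _
  have hr : 1 ≤ g / t := (one_le_div (by linarith)).2 htg.le
  have := mul_runGF_le h (n + 2) (by positivity : 0 ≤ 1 / g) hr
  rw [show g / t * (1 / g) = 1 / t by field_simp] at this
  refine le_trans ?_ this
  calc (1 : ℝ) = g / t * (t / g) := by field_simp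
    _ ≤ _ := by gcongr

/-- The growth rate is at least `g` if lower bounds for the complexity make the generating function
at least `1` at `1 / g`. -/
theorem UpperTail.ofReal_le_lowerGrowthRate {w : ℕ → PinLetter} {i₀ : ℕ} {h : ℕ → Bool}
    (hw : UpperTail w i₀ h) {a₁ a₂ d : ℝ} {c : ℕ → ℝ} {S g : ℝ} (hg : 1 < g)
    (h1 : a₁ ≤ complexity h 1) (h2 : a₂ ≤ complexity h 2) (hd : d ≤ numDoubles h)
    (hc : ∀ i, c i ≤ complexity h (i + 3))
    (hS : HasSum (fun i => c i * ((1 / g) ^ 2) ^ (i + 2)) S)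
    (hV : 1 ≤ a₁ * (1 / g + (1 / g) ^ 2) + a₂ * ((1 / g) ^ 3 + (1 / g) ^ 4) + d * (1 / g) ^ 3 +
      (1 + 1 / g) ^ 2 * S) :
    ENNReal.ofReal g ≤ lowerGrowthRate (pinClassCount w) :=
  _root_.ofReal_le_lowerGrowthRate hg fun _ ht htg =>
    let ⟨_, hM, hG⟩ := exists_one_le_runGF h1 h2 hd hc hS hV ht htg
    hw.exists_le_pinClassCount ht hM hG

/-- For an eventually periodic sequence the growth rate is `g` if the generating function equals `1`
at `1 / g`. -/
theorem UpperTail.hasGrowthRate {w : ℕ → PinLetter} {i₀ : ℕ} {h : ℕ → Bool}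
    (hw : UpperTail w i₀ h) {N p : ℕ} (hp : 0 < p) (hper : ∀ k, N ≤ k → h (k + p) = h k)
    {S g : ℝ} (hg : 1 < g)
    (hS : HasSum (fun i => complexity h (i + 3) * ((1 / g) ^ 2) ^ (i + 2)) S)
    (hV : complexity h 1 * (1 / g + (1 / g) ^ 2) + complexity h 2 * ((1 / g) ^ 3 + (1 / g) ^ 4) +
      numDoubles h * (1 / g) ^ 3 + (1 + 1 / g) ^ 2 * S = 1) :
    HasGrowthRate (pinClassCount w) g := by
  -- from position `N` on every factor recurs
  have hall := mem_recurrentWords_of_periodic (h := fun k => h (k + N)) hp fun k => by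
    rw [← hper (k + N) (by omega)]; congr 1; ring
  refine hasGrowthRate_of_bounds hg (fun t ht htg => ?_)
    ((hw.shift N).pinClassCount_le hall hg.le fun M hM => ?_)
  · obtain ⟨M, hM, hG⟩ := exists_one_le_runGF le_rfl le_rfl le_rfl (fun _ => le_rfl) hS hV.ge ht htg
    exact hw.exists_le_pinClassCount ht hM hG
  · obtain ⟨n, rfl⟩ := Nat.exists_eq_add_of_le' hM
    have hd : numDoubles (fun k => h (k + N)) = numDoubles h := by
      unfold numDoubles; rw [words_shift]
    rw [runGF_add_two, hd]
    simp only [complexity_shift]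
    refine le_of_le_of_eq ?_ hV
    have h0 : 0 ≤ 1 / g := by positivity
    gcongr
    exact sum_le_hasSum _ (fun i _ => by positivity) hS

/-! ### The polynomials -/

lemma exists_isLargestRealZero {f : ℝ → ℝ} (hf : Continuous f) {a b : ℝ} (hab : a ≤ b)
    (ha : f a ≤ 0) (hb : ∀ z, b ≤ z → 0 < f z) : ∃ ν, IsLargestRealZero f ν ∧ a ≤ ν := by
  obtain ⟨z, hz, hz0⟩ := intermediate_value_Icc hab hf.continuousOn ⟨ha, (hb b le_rfl).le⟩
  have hK : IsCompact (Set.Icc a b ∩ {z | f z = 0}) :=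
    isCompact_Icc.inter_right (isClosed_singleton.preimage hf)
  obtain ⟨ν, hν, hmax⟩ := hK.exists_isGreatest ⟨z, hz, hz0⟩
  refine ⟨ν, ⟨hν.2, fun y hy => ?_⟩, hν.1.1⟩
  rcases lt_or_ge y a with h | h
  · exact h.le.trans hν.1.1
  · exact hmax ⟨⟨h, not_lt.1 fun hby => (hb y hby.le).ne' hy⟩, hy⟩

lemma muPoly_pos {z : ℝ} (hz : 3.3 ≤ z) :
    0 < z ^ 5 - 4 * z ^ 4 + 3 * z ^ 3 - 2 * z ^ 2 - z + 2 := by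
  have h1 : 0.69 ≤ (z - 1) * (z - 3) := by nlinarith
  have h2 : 0.69 * z ^ 3 ≤ (z - 1) * (z - 3) * z ^ 3 := by gcongr
  have h3 : 3.3 * z ^ 2 ≤ z * z ^ 2 := by gcongr
  nlinarith [sq_nonneg (z - 1.8)]

lemma nuPoly_eq {ℓ : ℕ} (hℓ : 3 ≤ ℓ) (z : ℝ) : nuPoly ℓ z =
    z ^ (2 * ℓ - 5) * (z ^ 5 - 4 * z ^ 4 + 3 * z ^ 3 - 2 * z ^ 2 - z + 2) + 1 := by
  rw [nuPoly, if_neg (by omega), if_neg (by omega)]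
  obtain ⟨k, rfl⟩ := Nat.exists_eq_add_of_le' hℓ
  rw [show 2 * (k + 3) = 2 * k + 1 + 5 by omega]
  simp only [Nat.add_sub_cancel, show 2 * k + 1 + 5 - 1 = 2 * k + 1 + 4 by omega,
    show 2 * k + 1 + 5 - 2 = 2 * k + 1 + 3 by omega,
    show 2 * k + 1 + 5 - 3 = 2 * k + 1 + 2 by omega,
    show 2 * k + 1 + 5 - 4 = 2 * k + 1 + 1 by omega, pow_add]
  ring

lemma exists_nu {ℓ : ℕ} (hℓ : 1 ≤ ℓ) : ∃ ν, IsLargestRealZero (nuPoly ℓ) ν ∧ 3 ≤ ν := by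
  refine exists_isLargestRealZero (b := 4) ?_ (by norm_num) ?_ fun z hz => ?_
  · unfold nuPoly
    split_ifs <;> fun_prop
  · rcases show ℓ = 1 ∨ ℓ = 2 ∨ 3 ≤ ℓ by omega with rfl | rfl | hℓ
    · norm_num [nuPoly]
    · norm_num [nuPoly]
    · rw [nuPoly_eq hℓ]
      have : (1 : ℝ) ≤ 3 ^ (2 * ℓ - 5) := one_le_pow₀ (by norm_num)
      linarith
  · rcases show ℓ = 1 ∨ ℓ = 2 ∨ 3 ≤ ℓ by omega with rfl | rfl | hℓ
    · simp only [nuPoly, if_true]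
      have : z ^ 3 * 1 ≤ z ^ 3 * (z - 3) := by gcongr; linarith
      have : (4 : ℝ) ^ 3 ≤ z ^ 3 := by gcongr
      linarith
    · simp only [nuPoly, if_true]
      norm_num
      have : z ^ 3 * 1 ≤ z ^ 3 * (z - 3) := by gcongr; linarith
      have : z * 4 ^ 2 ≤ z * z ^ 2 := by gcongr
      linarith
    · rw [nuPoly_eq hℓ]
      have := muPoly_pos (by linarith : (3.3 : ℝ) ≤ z)
      positivity

lemma exists_kappa : ∃ κ : ℝ, IsLargestRealZero (fun z => z ^ 3 - 2 * z ^ 2 - 1) κ ∧ 2 ≤ κ := by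
  refine exists_isLargestRealZero (b := 3) (by fun_prop) (by norm_num) (by norm_num) fun z hz => ?_
  have : z ^ 2 * 1 ≤ z ^ 2 * (z - 2) := by gcongr; linarith
  have : (3 : ℝ) ^ 2 ≤ z ^ 2 := by gcongr
  linarith

lemma mu_bounds {μ : ℝ}
    (hμ : IsLargestRealZero (fun z => z ^ 5 - 4 * z ^ 4 + 3 * z ^ 3 - 2 * z ^ 2 - z + 2) μ) :
    3 ≤ μ ∧ μ < 3.3 := by
  constructor
  · obtain ⟨μ', h, h'⟩ := exists_isLargestRealZero (a := 3) (b := 3.3)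
      (f := fun z => z ^ 5 - 4 * z ^ 4 + 3 * z ^ 3 - 2 * z ^ 2 - z + 2) (by fun_prop)
      (by norm_num) (by norm_num) fun z hz => muPoly_pos hz
    rwa [h.unique hμ] at h'
  · by_contra hge
    exact (muPoly_pos (not_lt.1 hge)).ne' hμ.1

/-- The reciprocal form of the equation for `μ`. -/
lemma muPoly_inv {z : ℝ} (hz : z ≠ 0)
    (h : z ^ 5 - 4 * z ^ 4 + 3 * z ^ 3 - 2 * z ^ 2 - z + 2 = 0) :
    1 - 4 * (1 / z) + 3 * (1 / z) ^ 2 - 2 * (1 / z) ^ 3 - (1 / z) ^ 4 + 2 * (1 / z) ^ 5 = 0 := by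
  field_simp
  linear_combination h

/-- The reciprocal form of the equation for `ν_ℓ`, for `ℓ ≥ 2`. -/
lemma nuPoly_inv {ℓ : ℕ} (hℓ : 2 ≤ ℓ) {z : ℝ} (hz : 1 < z) (h : nuPoly ℓ z = 0) :
    1 - 4 * (1 / z) + 3 * (1 / z) ^ 2 - 2 * (1 / z) ^ 3 - (1 / z) ^ 4 + 2 * (1 / z) ^ 5 +
      ((1 / z) ^ 2) ^ ℓ = 0 := by
  have hz0 : z ≠ 0 := by linarith
  rcases hℓ.lt_or_eq with hℓ | rfl
  · rw [nuPoly_eq hℓ] at h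
    obtain ⟨k, rfl⟩ := Nat.exists_eq_add_of_le' hℓ
    rw [show 2 * (k + 2 + 1) - 5 = 2 * k + 1 by omega] at h
    rw [← pow_mul, show 2 * (k + 2 + 1) = 2 * k + 1 + 5 by omega, pow_add (1 / z) (2 * k + 1) 5,
      one_div_pow z (2 * k + 1)]
    have hzk : z ^ (2 * k + 1) ≠ 0 := pow_ne_zero _ hz0
    generalize z ^ (2 * k + 1) = Z at h hzk
    field_simp
    linear_combination h
  · simp only [nuPoly, OfNat.ofNat_ne_one, if_false, if_true] at h
    field_simp
    linear_combination (z - 1) * h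

/-- The total of the generating function for the complexity function `min m ℓ + 1` with `ℓ ≥ 2`,
where `Y = x ^ (2 * ℓ)`. The case `Y = 0` belongs to the complexity function `m + 1`. -/
lemma total_eq {x Y : ℝ} (hx : x ≠ 1) (hx' : x ≠ -1) :
    2 * (x + x ^ 2) + 3 * (x ^ 3 + x ^ 4) + 1 * x ^ 3 + (1 + x) ^ 2 *
      (4 * (x ^ 2) ^ 2 / (1 - x ^ 2) + (x ^ 2) ^ 3 / (1 - x ^ 2) ^ 2 - Y / (1 - x ^ 2) ^ 2) =
    1 - (1 - 4 * x + 3 * x ^ 2 - 2 * x ^ 3 - x ^ 4 + 2 * x ^ 5 + Y) / (1 - x) ^ 2 := by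
  have h1 : 1 - x ≠ 0 := sub_ne_zero.2 hx.symm
  have h2 : 1 + x ≠ 0 := fun h => hx' (by linarith)
  rw [show 1 - x ^ 2 = (1 - x) * (1 + x) by ring]
  field_simp
  ring

/-! ### Sequences that avoid one direction from some point on -/

section UpperClassification

variable {w : ℕ → PinLetter} {i₀ : ℕ} {h : ℕ → Bool}

/-- Periodic tails with complexity function `min m ℓ + 1`, where `ℓ ≥ 1`. -/
lemma UpperTail.hasGrowthRate_nu (hw : UpperTail w i₀ h) {N p : ℕ} (hp : 0 < p)
    (hper : ∀ k, N ≤ k → h (k + p) = h k) {ℓ : ℕ} (hℓ : 1 ≤ ℓ)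
    (hc : ∀ m, complexity h m = min m ℓ + 1) {ν : ℝ} (hν : nuPoly ℓ ν = 0) (hν3 : 3 ≤ ν) :
    HasGrowthRate (pinClassCount w) ν := by
  have h1 : complexity h 1 = 2 := by rw [hc]; omega
  have hd := complexity_two_of_one h1
  have hx0 : 0 < 1 / ν := by positivity
  have hx1 : 1 / ν < 1 := (div_lt_one (by linarith)).2 (by linarith)
  have hy0 : 0 ≤ (1 / ν) ^ 2 := by positivity
  have hy1 : (1 / ν) ^ 2 < 1 := pow_lt_one₀ hx0.le hx1 (by norm_num)
  rcases hℓ.lt_or_eq with hℓ | rfl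
  · have h2 : complexity h 2 = 3 := by rw [hc]; omega
    have hd1 : numDoubles h = 1 := by omega
    have hS := hasSum_min_geometric hy0 hy1 (show 2 ≤ ℓ from hℓ)
    refine hw.hasGrowthRate hp hper (by linarith) (hS.congr_fun fun i => by rw [hc]) ?_
    rw [h1, h2, hd1]
    push_cast
    rw [total_eq hx1.ne (by linarith), nuPoly_inv hℓ (by linarith) hν]
    simp
  · have h2 : complexity h 2 = 2 := by rw [hc]; omega
    have hd0 : numDoubles h = 0 := by omega
    have hS := (hasSum_indicator_geometric hy0 hy1 0).mul_left 2
    refine hw.hasGrowthRate hp hper (by linarith) (hS.congr_fun fun i => ?_) ?_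
    · rw [hc, show min (i + 3) 1 = 1 by omega]; norm_num
    · rw [h1, h2, hd0]
      simp only [nuPoly, if_true] at hν
      have h3 : 1 - 3 * (1 / ν) - 2 * (1 / ν) ^ 4 = 0 := by
        have : ν ≠ 0 := by linarith
        field_simp
        linear_combination hν
      generalize 1 / ν = x at *
      have h4 : 1 - x ≠ 0 := by linarith
      have h5 : 1 + x ≠ 0 := by linarith
      rw [show 1 - x ^ 2 = (1 - x) * (1 + x) by ring]
      push_cast
      field_simp
      linear_combination -h3

/-- Tails with only one recurrent word of each length. -/
lemma UpperTail.hasGrowthRate_kappa (hw : UpperTail w i₀ h) {N p : ℕ} (hp : 0 < p)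
    (hper : ∀ k, N ≤ k → h (k + p) = h k) (hc : ∀ m, complexity h m = 1) {κ : ℝ}
    (hκ : κ ^ 3 - 2 * κ ^ 2 - 1 = 0) (hκ2 : 2 ≤ κ) : HasGrowthRate (pinClassCount w) κ := by
  have hd : numDoubles h = 1 := by rw [← complexity_two_of_one' (hc 1), hc]
  have hx0 : 0 < 1 / κ := by positivity
  have hx1 : 1 / κ < 1 := (div_lt_one (by linarith)).2 (by linarith)
  have hy1 : (1 / κ) ^ 2 < 1 := pow_lt_one₀ hx0.le hx1 (by norm_num)
  have hS := hasSum_indicator_geometric (by positivity : 0 ≤ (1 / κ) ^ 2) hy1 0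
  refine hw.hasGrowthRate hp hper (by linarith) (hS.congr_fun fun i => by rw [hc]; simp) ?_
  rw [hc, hc, hd]
  have h3 : 1 - 2 * (1 / κ) - (1 / κ) ^ 3 = 0 := by
    have : κ ≠ 0 := by linarith
    field_simp
    linear_combination hκ
  generalize 1 / κ = x at *
  have h4 : 1 - x ≠ 0 := by linarith
  have h5 : 1 + x ≠ 0 := by linarith
  rw [show 1 - x ^ 2 = (1 - x) * (1 + x) by ring]
  push_cast
  field_simp
  linear_combination -h3

/-- If the complexity is at least `m + 1` for `m < j` and at least `j + 2` from `j` on, then the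
growth rate is at least `μ`, as for the complexity `m + 1`: the surplus of one at `m = j` outweighs
the deficit for large `m`, since the terms decrease geometrically. For `j = 2` a part of the surplus is
a second doubled letter. -/
lemma UpperTail.mu_le_of_jump (hw : UpperTail w i₀ h) {j : ℕ} (hj : 2 ≤ j)
    (hlow : ∀ m, m < j → m + 1 ≤ complexity h m) (hhigh : ∀ m, j ≤ m → j + 2 ≤ complexity h m)
    {μ : ℝ} (hμ : μ ^ 5 - 4 * μ ^ 4 + 3 * μ ^ 3 - 2 * μ ^ 2 - μ + 2 = 0) (hμ3 : 3 ≤ μ) :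
    ENNReal.ofReal μ ≤ lowerGrowthRate (pinClassCount w) := by
  have h1 : complexity h 1 = 2 := le_antisymm (complexity_one_le h) (hlow 1 (by omega))
  have hd := complexity_two_of_one h1
  have hx0 : 0 < 1 / μ := by positivity
  have hx1 : 1 / μ ≤ 1 / 3 := one_div_le_one_div_of_le (by norm_num) hμ3
  have hy0 : 0 ≤ (1 / μ) ^ 2 := by positivity
  have hy1 : (1 / μ) ^ 2 ≤ (1 / 3) ^ 2 := by gcongr
  have hQ := muPoly_inv (by linarith) hμ
  rcases hj.lt_or_eq with hj | rfl
  · have h2 : 3 ≤ complexity h 2 := hlow 2 hj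
    have hS := (hasSum_min_geometric hy0 (by linarith) (show 2 ≤ j by omega)).add
      (hasSum_indicator_geometric hy0 (by linarith) (j - 3))
    refine hw.ofReal_le_lowerGrowthRate (a₁ := 2) (a₂ := 3) (d := 1)
      (c := fun i => ((min (i + 3) j + 1 : ℕ) : ℝ) + if j - 3 ≤ i then 1 else 0) (by linarith)
      (by exact_mod_cast h1.ge) (by exact_mod_cast h2) (by exact_mod_cast (by omega : 1 ≤ numDoubles h))
      (fun i => ?_) (hS.congr_fun fun i => by ring) ?_
    · split_ifs with hi
      · have := hhigh (i + 3) (by omega)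
        rw [min_eq_right (by omega)]
        exact_mod_cast this
      · have := hlow (i + 3) (by omega)
        rw [min_eq_left (by omega)]
        simpa using (by exact_mod_cast this : ((i + 3 + 1 : ℕ) : ℝ) ≤ complexity h (i + 3))
    · have hV := total_eq (x := 1 / μ) (Y := 0) (by linarith) (by linarith)
      rw [add_zero, hQ] at hV
      have hgain : ((1 / μ) ^ 2) ^ j / (1 - (1 / μ) ^ 2) ^ 2 ≤
          ((1 / μ) ^ 2) ^ (j - 3 + 2) / (1 - (1 / μ) ^ 2) := by
        rw [show j = j - 3 + 2 + 1 by omega, pow_succ, show j - 3 + 2 + 1 - 3 + 2 = j - 3 + 2 by omega]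
        generalize (1 / μ) ^ 2 = y at *
        rw [div_le_div_iff₀ (by nlinarith) (by linarith), mul_assoc]
        refine mul_le_mul_of_nonneg_left ?_ (by positivity)
        nlinarith
      refine (show (1 : ℝ) = _ by rw [hV]; ring).le.trans (add_le_add_right ?_ _)
      refine mul_le_mul_of_nonneg_left ?_ (by positivity)
      rw [zero_div]
      linarith
  · have h2 : 4 ≤ complexity h 2 := hhigh 2 le_rfl
    have hS := (hasSum_indicator_geometric hy0 (by linarith) 0).mul_left 4
    refine hw.ofReal_le_lowerGrowthRate (a₁ := 2) (a₂ := 4) (d := 2)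
      (c := fun i => 4) (by linarith)
      (by exact_mod_cast h1.ge) (by exact_mod_cast h2) (by exact_mod_cast (by omega : 2 ≤ numDoubles h))
      (fun i => by exact_mod_cast hhigh (i + 3) (by omega))
      (hS.congr_fun fun i => by simp) ?_
    generalize 1 / μ = x at *
    have h4 : 0 < 1 - x := by linarith
    have h5 : 0 < 1 + x := by linarith
    rw [show 1 - x ^ 2 = (1 - x) * (1 + x) by ring]
    have h6 : (1 + x) ^ 2 * (4 * ((x ^ 2) ^ (0 + 2) / ((1 - x) * (1 + x)))) =
        4 * x ^ 4 * (1 + x) / (1 - x) := by field_simp; ring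
    rw [h6, ← sub_le_iff_le_add', le_div_iff₀ h4]
    have h7 : 0 ≤ (-1 + 3 * x + 4 * x ^ 3 + 2 * x ^ 4) * (1 - x) := by
      have : 0 ≤ x ^ 3 * (2 - 3 * x) := mul_nonneg (by positivity) (by linarith)
      linear_combination this + hQ
    have := nonneg_of_mul_nonneg_left h7 h4
    linear_combination this

/-- The complexity `m + 1` leads to the growth rate `μ`. -/
lemma UpperTail.mu_le_of_forall (hw : UpperTail w i₀ h) (hlow : ∀ m, m + 1 ≤ complexity h m)
    {μ : ℝ} (hμ : μ ^ 5 - 4 * μ ^ 4 + 3 * μ ^ 3 - 2 * μ ^ 2 - μ + 2 = 0) (hμ3 : 3 ≤ μ) :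
    ENNReal.ofReal μ ≤ lowerGrowthRate (pinClassCount w) := by
  have h1 : complexity h 1 = 2 := le_antisymm (complexity_one_le h) (hlow 1)
  have hd := complexity_two_of_one h1
  have h2 := hlow 2
  have hx0 : 0 < 1 / μ := by positivity
  have hx1 : 1 / μ ≤ 1 / 3 := one_div_le_one_div_of_le (by norm_num) hμ3
  have hy0 : 0 ≤ (1 / μ) ^ 2 := by positivity
  have hy1 : (1 / μ) ^ 2 ≤ (1 / 3) ^ 2 := by gcongr
  refine hw.ofReal_le_lowerGrowthRate (a₁ := 2) (a₂ := 3) (d := 1) (by linarith)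
    (by exact_mod_cast h1.ge) (by exact_mod_cast h2) (by exact_mod_cast (by omega : 1 ≤ numDoubles h))
    (fun i => by exact_mod_cast hlow (i + 3)) (hasSum_affine_geometric hy0 (by linarith)) ?_
  have hV := total_eq (x := 1 / μ) (Y := 0) (by linarith) (by linarith)
  rw [add_zero, muPoly_inv (by linarith) hμ, zero_div, sub_zero, zero_div, sub_zero] at hV
  exact hV.ge

/-- The dichotomy for sequences that stay above the horizontal axis, by the first length `ℓ` at
which the complexity stagnates: the growth rate is `κ` for `ℓ = 0`, and `ν_ℓ` otherwise. -/
theorem UpperTail.classification (hw : UpperTail w i₀ h) {μ : ℝ}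
    (hμ : IsLargestRealZero (fun z => z ^ 5 - 4 * z ^ 4 + 3 * z ^ 3 - 2 * z ^ 2 - z + 2) μ)
    (hlt : lowerGrowthRate (pinClassCount w) < ENNReal.ofReal μ) :
    IsEventuallyPeriodic w ∧
      ((∃ κ : ℝ, IsLargestRealZero (fun z => z ^ 3 - 2 * z ^ 2 - 1) κ ∧
          HasGrowthRate (pinClassCount w) κ) ∨
        ∃ ℓ : ℕ, 1 ≤ ℓ ∧ ∃ ν : ℝ, IsLargestRealZero (nuPoly ℓ) ν ∧
          HasGrowthRate (pinClassCount (oneEllWord ℓ)) ν ∧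
          HasGrowthRate (pinClassCount w) ν) := by
  have hμ3 := (mu_bounds hμ).1
  have hex : ∃ m, complexity h m = complexity h (m + 1) := by
    by_contra! hne
    refine hlt.not_ge (hw.mu_le_of_forall (fun m => ?_) hμ.1 hμ3)
    induction m with
    | zero => simp [complexity_zero]
    | succ m ih =>
      have := lt_of_le_of_ne (complexity_le_succ h m) (hne m)
      omega
  classical
  obtain ⟨ℓ, hℓ, hmin⟩ : ∃ ℓ, complexity h ℓ = complexity h (ℓ + 1) ∧
      ∀ m, m < ℓ → complexity h m ≠ complexity h (m + 1) :=
    ⟨Nat.find hex, Nat.find_spec hex, fun m hm => Nat.find_min hex hm⟩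
  have hlow : ∀ m, m ≤ ℓ → m + 1 ≤ complexity h m := by
    intro m
    induction m with
    | zero => simp [complexity_zero]
    | succ m ih =>
      intro hm
      have := lt_of_le_of_ne (complexity_le_succ h m) (hmin m (by omega))
      have := ih (by omega)
      omega
  obtain ⟨N, p, hp, hper⟩ := exists_periodic hℓ
  refine ⟨hw.isEventuallyPeriodic hp hper, ?_⟩
  rcases Nat.eq_zero_or_pos ℓ with rfl | hℓ1
  · obtain ⟨κ, hκ, hκ2⟩ := exists_kappa
    refine Or.inl ⟨κ, hκ, hw.hasGrowthRate_kappa hp hper (fun m => ?_) hκ.1 hκ2⟩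
    rw [complexity_eq_of_le hℓ (Nat.zero_le m), complexity_zero]
  · refine Or.inr ⟨ℓ, hℓ1, ?_⟩
    obtain ⟨ν, hν, hν3⟩ := exists_nu hℓ1
    have hc : ∀ m, m ≤ ℓ → complexity h m = m + 1 := by
      by_contra! hne
      -- the first length at which the complexity is too large
      obtain ⟨j, ⟨hjℓ, hj⟩, hjmin⟩ : ∃ j, (j ≤ ℓ ∧ complexity h j ≠ j + 1) ∧
          ∀ m, m < j → ¬(m ≤ ℓ ∧ complexity h m ≠ m + 1) :=
        ⟨Nat.find hne, Nat.find_spec hne, fun m hm => Nat.find_min hne hm⟩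
      have hj' := hlow j hjℓ
      have hj2 : 2 ≤ j := by
        by_contra hj2
        have := complexity_one_le h
        have := complexity_zero h
        interval_cases j <;> omega
      refine hlt.not_ge (hw.mu_le_of_jump hj2 (fun m hm => hlow m (by omega)) (fun m hm => ?_)
        hμ.1 hμ3)
      have := complexity_mono h hm
      omega
    refine ⟨ν, hν, ?_, hw.hasGrowthRate_nu hp hper hℓ1 (fun m => ?_) hν.1 hν3⟩
    · exact (upperTail_oneEllWord ℓ).hasGrowthRate_nu (N := 0) (Nat.succ_pos ℓ) (by simp) hℓ1
        (complexity_oneEll ℓ) hν.1 hν3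
    · rcases le_total m ℓ with hm | hm
      · rw [hc m hm, min_eq_left hm]
      · rw [complexity_eq_of_le hℓ hm, hc ℓ le_rfl, min_eq_right hm]

end UpperClassification

/-! ### Sequences that use all directions infinitely often -/

section AllDirections

variable {w : ℕ → PinLetter}

/-- By the pigeonhole principle, some occurrence of a recurrent property is followed by a run of
quadrants which recurs together with the property. -/
lemma exists_recurrent_run {P : ℕ → Prop} (hP : ∃ᶠ i in atTop, P i) (n : ℕ) :
    ∃ i, P i ∧ ∀ N, ∃ j, N ≤ j ∧ P j ∧
      ∀ s < n, isRight w (j + s) = isRight w (i + s) ∧ isUp w (j + s) = isUp w (i + s) := by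
  by_contra! hne
  let τ : ℕ → Fin n → Bool × Bool := fun i s => (isRight w (i + s), isUp w (i + s))
  have h1 : ∀ a, ∀ᶠ j in atTop, ¬(P j ∧ τ j = a) := by
    intro a
    by_cases ha : ∃ i, P i ∧ τ i = a
    · obtain ⟨i, hi, rfl⟩ := ha
      obtain ⟨N, hN⟩ := hne i hi
      filter_upwards [eventually_ge_atTop N] with j hj hj'
      obtain ⟨s, hs, hs'⟩ := hN j hj hj'.1
      have := congrFun hj'.2 ⟨s, hs⟩
      simp only [τ, Prod.mk.injEq] at this
      exact hs' this.1 this.2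
    · exact Eventually.of_forall fun j hj => ha ⟨j, hj⟩
  exact hP ((eventually_all.2 h1).mono fun j hj hPj => hj _ ⟨hPj, rfl⟩)

lemma not_inQuadrant {i n j : ℕ} (hij : i ≤ j) (hjn : j < i + n) {a b : Bool}
    (h : isRight w j ≠ a ∨ isUp w j ≠ b) :
    ¬(pinConf w (Finset.Ico i (i + n))).InQuadrant a b := by
  intro hq
  have h1 : isRight w j = a ∧ isUp w j = b :=
    hq (⟨j, Finset.mem_Ico.2 ⟨hij, hjn⟩⟩ : ↥(Finset.Ico i (i + n)))
  rcases h with h | h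
  · exact h h1.1
  · exact h h1.2

lemma exists_sides_of_iso {i j m n : ℕ}
    (h : (pinConf w (Finset.Ico i (i + m))).Iso (pinConf w (Finset.Ico j (j + n)))) {s : ℕ}
    (hs : s < m) :
    ∃ s' < n, isRight w (j + s') = isRight w (i + s) ∧ isUp w (j + s') = isUp w (i + s) := by
  obtain ⟨e, hR, hU, -, -⟩ := pinConf_iso_iff.1 h
  have hm : i + s ∈ Finset.Ico i (i + m) := Finset.mem_Ico.2 ⟨by omega, by omega⟩
  have h1 := Finset.mem_Ico.1 (e ⟨i + s, hm⟩).2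
  obtain ⟨s', hs'⟩ := Nat.exists_eq_add_of_le h1.1
  refine ⟨s', by omega, ?_, ?_⟩
  · rw [← hs', hR]
  · rw [← hs', hU]

/-- If all four quadrants recur, then lists of single points suffice as blocks, where a point on the
left is never followed by a point in the opposite quadrant. With weight `1` for points on the right
and `1 - x` for points on the left, the condition on the transfer matrix is `1 ≤ 4 * x - 2 * x ^ 2`
at `x = 1 / t`. -/
theorem le_lowerGrowthRate_of_four_quadrants
    (hq : ∀ a b, ∃ᶠ i in atTop, isRight w i = a ∧ isUp w i = b) :
    ENNReal.ofReal 3.3 ≤ lowerGrowthRate (pinClassCount w) := by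
  refine ofReal_le_lowerGrowthRate (by norm_num) fun t ht ht' => ?_
  choose p hp using fun c : Bool × Bool => (hq c.1 c.2).exists
  have hx0 : 0 < 1 / t := by positivity
  have hx : 1 / 3.3 < 1 / t := one_div_lt_one_div_of_lt (by linarith) ht'
  have hx1 : 1 / t < 1 := (div_lt_one (by linarith)).2 ht
  refine exists_le_pinClassCount w (A := Bool × Bool) Finset.univ
    (fun c => pinConf w (Finset.Ico (p c) (p c + 1))) (fun _ => 1)
    (fun c c' => ¬(c.1 = false ∧ c'.1 = true ∧ c'.2 = !c.2))
    (fun c => if c.1 = true then 1 else 1 - 1 / t) ht Finset.univ_nonempty (by simp)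
    (fun c _ N => ?_) (fun c _ => strongConn_singleton w _) (fun c _ c' _ hiso => ?_)
    (fun c _ c' _ hok q hc hc' => ?_) (fun c _ => ?_) (fun c _ => ?_) (fun c _ => ?_)
  · obtain ⟨i, hi, hi'⟩ := (frequently_atTop.1 (hq c.1 c.2)) N
    exact ⟨i, hi, single_iso (by rw [hi'.1, (hp c).1]) (by rw [hi'.2, (hp c).2])⟩
  · obtain ⟨s, hs, h1, h2⟩ := exists_sides_of_iso hiso (s := 0) (by norm_num)
    obtain rfl : s = 0 := by omega
    simp only [add_zero] at h1 h2
    rw [(hp c).1, (hp c').1] at h1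
    rw [(hp c).2, (hp c').2] at h2
    exact Prod.ext h1.symm h2.symm
  · refine hok ⟨?_, ?_, ?_⟩
    · by_contra hne
      exact not_inQuadrant le_rfl (by omega) (Or.inl (by rwa [(hp c).1])) hc
    · by_contra hne
      exact not_inQuadrant le_rfl (by omega) (Or.inl (by rwa [(hp c').1])) hc'
    · have h1 : c.2 = q := by
        by_contra hne
        exact not_inQuadrant le_rfl (by omega) (Or.inr (by rwa [(hp c).2])) hc
      rw [h1]
      by_contra hne
      exact not_inQuadrant le_rfl (by omega) (Or.inr (by rwa [(hp c').2])) hc'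
  · split_ifs <;> linarith
  · exact ⟨c, Finset.mem_univ _, by simp, rfl⟩
  · have key : 1 ≤ 4 * (1 / t) - 2 * (1 / t) ^ 2 := by
      generalize 1 / t = x at *
      norm_num at hx
      nlinarith
    rw [Finset.sum_filter]
    simp only [Fintype.sum_prod_type, Fintype.sum_bool, pow_one, div_eq_mul_inv, one_mul] at key ⊢
    obtain ⟨a, b⟩ := c
    generalize t⁻¹ = x at *
    cases a <;> cases b <;>
      simp <;> linarith

/-- The letters for sequences that avoid the quadrant below right: the letter `(b, o, n)` is the run
of `n` pins from offset `o` on in the pattern `b`. The pattern `true` is an entry into the quadrant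
above right, the pattern `false` is an entry into the quadrant below left. -/
def entryLetters : Finset (Bool × ℕ × ℕ) :=
  {(true, 0, 1), (true, 1, 1), (true, 1, 2), (true, 0, 3), (true, 0, 4), (false, 1, 1),
    (false, 1, 2), (false, 0, 3)}

/-- If one quadrant is avoided but all directions recur, then the sequence enters the two
neighbours of this quadrant infinitely often, always from the opposite one. The runs at these
entries are used as blocks. Only runs within the quadrant below left may not be followed by runs
within the quadrant above right. With weight `1 - x - x ^ 2` for the former and `1` for all others,
the condition on the transfer matrix is `1 ≤ 3 * x + x ^ 2` at `x = 1 / t`. -/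
theorem le_lowerGrowthRate_of_three_quadrants (hw : IsPinSequence w)
    (hq : ∀ᶠ i in atTop, ¬(isRight w i = true ∧ isUp w i = false))
    (hR : ∃ᶠ i in atTop, isRight w i = true) (hU : ∃ᶠ i in atTop, isUp w i = false) :
    ENNReal.ofReal 3.3 ≤ lowerGrowthRate (pinClassCount w) := by
  obtain ⟨K, hK⟩ := eventually_atTop.1 hq
  have hKR : ∀ i, K ≤ i → isRight w i = true → isUp w i = true := fun i hi h => by
    by_contra hne; exact hK i hi ⟨h, by simpa using hne⟩
  have hKU : ∀ i, K ≤ i → isUp w i = false → isRight w i = false := fun i hi h => by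
    by_contra hne; exact hK i hi ⟨by simpa using hne, h⟩
  rw [frequently_atTop] at hR hU
  have enter : ∀ (P : ℕ → Prop) (a b : ℕ), a ≤ b → ¬P a → P b → ∃ i, a ≤ i ∧ ¬P i ∧ P (i + 1) := by
    intro P a b hab ha hb
    induction b, hab using Nat.le_induction with
    | base => exact absurd hb ha
    | succ b hab ih =>
      by_cases h : P b
      · exact ih h
      · exact ⟨b, hab, h, hb⟩
  have h1 : ∃ᶠ i in atTop, isHor w i = false ∧ isRight w i = false ∧ isUp w i = true ∧
      isRight w (i + 1) = true ∧ isUp w (i + 1) = true ∧ isRight w (i + 2) = true ∧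
      isUp w (i + 2) = true ∧ isUp w (i + 3) = true := by
    rw [frequently_atTop]
    intro N
    obtain ⟨a, ha, ha'⟩ := hU (max N K)
    obtain ⟨b, hb, hb'⟩ := hR a
    have haN := le_of_max_le_left ha
    have haK := le_of_max_le_right ha
    obtain ⟨i, hi, hi1, hi2⟩ := enter (fun i => isRight w i = true) a b hb
      (by simp [hKU a haK ha']) hb'
    have hh : isHor w i = false := by
      by_contra h
      exact hi1 (by rw [← isRight_succ hw (by simpa using h), hi2])
    have hh1 : isHor w (i + 1) = true := by rw [isHor_succ hw, hh]; rfl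
    have hh2 : isHor w (i + 2) = false := by rw [isHor_succ hw, hh1]; rfl
    have hu1 := hKR (i + 1) (by omega) hi2
    have hr2 : isRight w (i + 2) = true := by rw [isRight_succ hw hh1, hi2]
    have hu2 := hKR (i + 2) (by omega) hr2
    exact ⟨i, by omega, hh, by simpa using hi1, by rw [← isUp_succ hw hh, hu1], hi2, hu1, hr2, hu2,
      by rw [isUp_succ hw hh2, hu2]⟩
  have h3 : ∃ᶠ i in atTop, isHor w i = true ∧ isRight w i = false ∧ isUp w i = true ∧
      isRight w (i + 1) = false ∧ isUp w (i + 1) = false ∧ isRight w (i + 2) = false ∧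
      isUp w (i + 2) = false := by
    rw [frequently_atTop]
    intro N
    obtain ⟨a, ha, ha'⟩ := hR (max N K)
    obtain ⟨b, hb, hb'⟩ := hU a
    have haN := le_of_max_le_left ha
    have haK := le_of_max_le_right ha
    obtain ⟨i, hi, hi1, hi2⟩ := enter (fun i => isUp w i = false) a b hb
      (by simp [hKR a haK ha']) hb'
    have hh : isHor w i = true := by
      by_contra h
      exact hi1 (by rw [← isUp_succ hw (by simpa using h), hi2])
    have hh1 : isHor w (i + 1) = false := by rw [isHor_succ hw, hh]; rfl
    have hr1 := hKU (i + 1) (by omega) hi2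
    have hu2 : isUp w (i + 2) = false := by rw [isUp_succ hw hh1, hi2]
    exact ⟨i, by omega, hh, by rw [← isRight_succ hw hh, hr1], by simpa using hi1, hr1, hi2,
      hKU (i + 2) (by omega) hu2, hu2⟩
  obtain ⟨i, ⟨hh, hr0, hu0, hr1, hu1, hr2, hu2, hu3⟩, hi⟩ := exists_recurrent_run (w := w) h1 4
  obtain ⟨j, ⟨ghh, gr0, gu0, gr1, gu1, gr2, gu2⟩, hj⟩ := exists_recurrent_run (w := w) h3 3
  have hh1 : isHor w (i + 1) = true := by rw [isHor_succ hw, hh]; rfl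
  have ghh1 : isHor w (j + 1) = false := by rw [isHor_succ hw, ghh]; rfl
  suffices key : ∀ t : ℝ, 3 ≤ t → t < 3.3 →
      ∃ C : ℝ, 0 < C ∧ ∀ n, C * t ^ n ≤ pinClassCount w n by
    refine ofReal_le_lowerGrowthRate (by norm_num) fun t ht ht' => ?_
    obtain ⟨C, hC, h⟩ := key (max t 3) (le_max_right _ _) (max_lt ht' (by norm_num))
    refine ⟨C, hC, fun n => le_trans ?_ (h n)⟩
    gcongr
    exact le_max_left _ _
  intro t ht3 ht'
  have ht : 1 < t := by linarith
  have hx : 1 / 3.3 < 1 / t := one_div_lt_one_div_of_lt (by linarith) ht'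
  have hx1 : 1 / t ≤ 1 / 3 := one_div_le_one_div_of_le (by norm_num) ht3
  -- the only forbidden steps lead from runs below left to runs above right
  let ok : Bool × ℕ × ℕ → Bool × ℕ × ℕ → Prop := fun a b =>
    a.1 = false ∧ a.2.1 = 1 → ¬(b.1 = true ∧ b.2.1 = 1)
  have hcases : ∀ a ∈ entryLetters, a = (true, 0, 1) ∨ a = (true, 1, 1) ∨ a = (true, 1, 2) ∨
      a = (true, 0, 3) ∨ a = (true, 0, 4) ∨ a = (false, 1, 1) ∨ a = (false, 1, 2) ∨
      a = (false, 0, 3) := fun a ha => by simpa [entryLetters] using ha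
  have hXY : ∀ k, absX w k = 2 * k + 1 + (if isHor w k then 3 else 0) ∧
    absY w k = 2 * k + 1 + (if isHor w k then 0 else 3) := fun k => ⟨rfl, rfl⟩
  have hfirst : ∀ a ∈ entryLetters, ∀ p q, (pinConf w (Finset.Ico ((if a.1 then i else j) + a.2.1)
      ((if a.1 then i else j) + a.2.1 + a.2.2))).InQuadrant p q →
      isRight w ((if a.1 then i else j) + a.2.1) = p ∧
        isUp w ((if a.1 then i else j) + a.2.1) = q := fun a ha p q hpq => by
    have hpos : 0 < a.2.2 := by
      rcases hcases a ha with rfl | rfl | rfl | rfl | rfl | rfl | rfl | rfl <;> simp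
    by_contra hne
    exact not_inQuadrant le_rfl (by omega) (not_and_or.1 hne) hpq
  have hup : ∀ a ∈ entryLetters,
      (∀ s < a.2.2, isUp w ((if a.1 then i else j) + a.2.1 + s) = true) ↔ a.1 = true := fun a ha => by
    rcases hcases a ha with rfl | rfl | rfl | rfl | rfl | rfl | rfl | rfl
    all_goals simp only [if_true, if_false, reduceCtorEq, iff_true, iff_false, add_zero, add_assoc]
    · intro s hs; interval_cases s; exact hu0
    · intro s hs; interval_cases s; exact hu1
    · intro s hs; interval_cases s; exacts [hu1, hu2]
    · intro s hs; interval_cases s; exacts [hu0, hu1, hu2]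
    · intro s hs; interval_cases s; exacts [hu0, hu1, hu2, hu3]
    · intro hs; simpa [gu1] using hs 0
    · intro hs; simpa [gu1] using hs 0
    · intro hs; simpa [gu1] using hs 1
  refine exists_le_pinClassCount w entryLetters
    (fun a => pinConf w (Finset.Ico ((if a.1 then i else j) + a.2.1)
      ((if a.1 then i else j) + a.2.1 + a.2.2))) (fun a => a.2.2) ok
    (fun a => if a.1 = false ∧ a.2.1 = 1 then 1 - 1 / t - (1 / t) ^ 2 else 1) ht
    ⟨(true, 0, 1), by simp [entryLetters]⟩ (fun a ha => ?_)
    (fun a ha N => ?_) (fun a ha => ?_) (fun a ha b hb hiso => ?_)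
    (fun a ha b hb hok q hqa hqb => ?_) (fun a ha => ?_) (fun a ha => ?_) (fun a ha => ?_)
  · rcases hcases a ha with rfl | rfl | rfl | rfl | rfl | rfl | rfl | rfl <;> simp
  · have ho : a.2.1 + a.2.2 ≤ if a.1 then 4 else 3 := by
      rcases hcases a ha with rfl | rfl | rfl | rfl | rfl | rfl | rfl | rfl <;> simp
    obtain ⟨b, o, n⟩ := a
    cases b
    · obtain ⟨k, hk, hk1, hk2⟩ := hj N
      refine ⟨k + o, by omega, pinConf_Ico_iso hw hw ?_ (fun s hs => ?_) fun s hs => ?_⟩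
      · simp [isHor_add hw, hk1.1, ghh]
      · simp only [add_assoc] at *; exact (hk2 _ (by simp at ho; omega)).1
      · simp only [add_assoc] at *; exact (hk2 _ (by simp at ho; omega)).2
    · obtain ⟨k, hk, hk1, hk2⟩ := hi N
      refine ⟨k + o, by omega, pinConf_Ico_iso hw hw ?_ (fun s hs => ?_) fun s hs => ?_⟩
      · simp [isHor_add hw, hk1.1, hh]
      · simp only [add_assoc] at *; exact (hk2 _ (by simp at ho; omega)).1
      · simp only [add_assoc] at *; exact (hk2 _ (by simp at ho; omega)).2
  · have hh2 : isHor w (i + 2) = false := by rw [isHor_succ hw, hh1]; rfl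
    have hh3 : isHor w (i + 3) = true := by rw [isHor_succ hw, hh2]; rfl
    have ghh2 : isHor w (j + 2) = true := by rw [isHor_succ hw, ghh1]; rfl
    rcases hcases a ha with rfl | rfl | rfl | rfl | rfl | rfl | rfl | rfl
    · exact strongConn_singleton w _
    · exact strongConn_singleton w _
    · refine strongConn_Ico hw (k := 1) (Or.inr ⟨hu1.trans hu2.symm, ?_⟩)
      change absY w (i + 1) < absY w (i + 2)
      simp only [hXY, hh1, hh2]; simp; omega
    · refine strongConn_Ico hw (k := 2) (Or.inr ⟨hu0.trans hu2.symm, ?_⟩)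
      change absY w i < absY w (i + 2)
      simp only [hXY, hh, hh2]; simp
    · refine strongConn_Ico hw (k := 3) (Or.inr ⟨hu0.trans hu3.symm, ?_⟩)
      change absY w i < absY w (i + 3)
      simp only [hXY, hh, hh3]; simp; omega
    · exact strongConn_singleton w _
    · refine strongConn_Ico hw (k := 1) (Or.inl ⟨gr1.trans gr2.symm, ?_⟩)
      change absX w (j + 1) < absX w (j + 2)
      simp only [hXY, ghh1, ghh2]; simp; omega
    · refine strongConn_Ico hw (k := 2) (Or.inl ⟨gr0.trans gr2.symm, ?_⟩)
      change absX w j < absX w (j + 2)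
      simp only [hXY, ghh, ghh2]; simp
  · -- the runs are distinguished by their lengths and by the quadrants that they meet
    have hlen : a.2.2 = b.2.2 := by simpa using card_eq_of_iso hiso
    have hfst : a.1 = b.1 := by
      rw [Bool.eq_iff_iff, ← hup a ha, ← hup b hb]
      constructor
      · intro h s hs
        obtain ⟨s', hs', -, h2⟩ := exists_sides_of_iso hiso.symm hs
        rw [← h2, h s' hs']
      · intro h s hs
        obtain ⟨s', hs', -, h2⟩ := exists_sides_of_iso hiso hs
        rw [← h2, h s' hs']
    have hne : ¬(pinConf w (Finset.Ico (i + 0) (i + 0 + 1))).Iso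
        (pinConf w (Finset.Ico (i + 1) (i + 1 + 1))) := fun h => by
      obtain ⟨s, hs, h2, -⟩ := exists_sides_of_iso h (s := 0) (by omega)
      obtain rfl : s = 0 := by omega
      simp [hr0, hr1] at h2
    rcases hcases a ha with rfl | rfl | rfl | rfl | rfl | rfl | rfl | rfl <;>
      rcases hcases b hb with rfl | rfl | rfl | rfl | rfl | rfl | rfl | rfl <;>
      first
        | rfl
        | (exfalso; revert hlen; decide)
        | (exfalso; revert hfst; decide)
        | exact absurd hiso hne
        | exact absurd hiso.symm hne
  · obtain ⟨hb1, hb2⟩ := hfirst b hb _ _ hqb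
    obtain ⟨ha1, ha2⟩ := hfirst a ha _ _ hqa
    have hb3 : b.1 = true ∧ b.2.1 = 1 := by
      rcases hcases b hb with rfl | rfl | rfl | rfl | rfl | rfl | rfl | rfl <;>
        simp [hr0, hr1, gr0, gr1] at hb1 ⊢
    refine hok ?_ hb3
    rw [hb3.1, hb3.2] at hb2
    obtain rfl : q = false := by simpa [hu1] using hb2
    rcases hcases a ha with rfl | rfl | rfl | rfl | rfl | rfl | rfl | rfl <;>
      simp [hu0, hu1, gu0, gu1] at ha2 ⊢
  · have : 0 < 1 - 1 / t - (1 / t) ^ 2 := by nlinarith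
    split_ifs <;> linarith
  · exact ⟨(true, 0, 1), by simp [entryLetters], by simp [ok], rfl⟩
  · have key : 1 ≤ 3 * (1 / t) + (1 / t) ^ 2 := by
      generalize 1 / t = x at *
      norm_num at hx
      nlinarith
    rw [Finset.sum_filter]
    rw [one_div] at key ⊢
    simp only [div_eq_mul_inv, ← inv_pow]
    generalize t⁻¹ = x at *
    rcases hcases a ha with rfl | rfl | rfl | rfl | rfl | rfl | rfl | rfl <;>
      simp [entryLetters, ok] <;> nlinarith

end AllDirections

/-! ### Reduction by symmetry -/

theorem le_lowerGrowthRate_of_avoided_quadrant {w : ℕ → PinLetter} (hw : IsPinSequence w)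
    (hR : ∀ a, ∃ᶠ i in atTop, isRight w i = a) (hU : ∀ b, ∃ᶠ i in atTop, isUp w i = b) {a b : Bool}
    (hq : ∀ᶠ i in atTop, ¬(isRight w i = a ∧ isUp w i = b)) :
    ENNReal.ofReal 3.3 ≤ lowerGrowthRate (pinClassCount w) := by
  have main : ∀ w, IsPinSequence w → (∀ a, ∃ᶠ i in atTop, isRight w i = a) →
      (∀ b, ∃ᶠ i in atTop, isUp w i = b) → ∀ b,
      (∀ᶠ i in atTop, ¬(isRight w i = true ∧ isUp w i = b)) →
      ENNReal.ofReal 3.3 ≤ lowerGrowthRate (pinClassCount w) := by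
    intro w hw hR hU b hq
    cases b
    · exact le_lowerGrowthRate_of_three_quadrants hw hq (hR true) (hU false)
    · rw [← pinClassCount_flipY]
      refine le_lowerGrowthRate_of_three_quadrants hw.flipY ?_ ?_ ?_
      · simpa only [isRight_flipY, isUp_flipY, Bool.not_eq_false'] using hq
      · simpa only [isRight_flipY] using hR true
      · simpa only [isUp_flipY, Bool.not_eq_false'] using hU true
  cases a
  · rw [← pinClassCount_flipX]
    refine main _ hw.flipX (fun a => ?_) (fun b => ?_) b ?_
    · simpa only [isRight_flipX, Bool.not_eq_eq_eq_not] using hR (!a)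
    · simpa only [isUp_flipX] using hU b
    · simpa only [isRight_flipX, isUp_flipX, Bool.not_eq_true'] using hq
  · exact main w hw hR hU b hq

lemma exists_upperTail {w : ℕ → PinLetter} (hw : IsPinSequence w)
    (hup : ∀ᶠ i in atTop, isUp w i = true) : ∃ i₀ h, UpperTail w i₀ h := by
  obtain ⟨N, hN⟩ := eventually_atTop.1 hup
  cases hh : isHor w N
  · exact ⟨N + 1, _, hw, by rw [isHor_succ hw, hh]; rfl, fun i hi => hN i (by omega), fun _ => rfl⟩
  · exact ⟨N, _, hw, hh, hN, fun _ => rfl⟩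

theorem theorem6p3 (w : ℕ → PinLetter) (hw : IsPinSequence w)
    (μ : ℝ) (hμ : IsLargestRealZero (fun z => z ^ 5 - 4 * z ^ 4 + 3 * z ^ 3 - 2 * z ^ 2 - z + 2) μ)
    (hlt : lowerGrowthRate (pinClassCount w) < ENNReal.ofReal μ) :
    IsEventuallyPeriodic w ∧
      ((∃ κ : ℝ, IsLargestRealZero (fun z => z ^ 3 - 2 * z ^ 2 - 1) κ ∧
          HasGrowthRate (pinClassCount w) κ) ∨
        ∃ ℓ : ℕ, 1 ≤ ℓ ∧ ∃ ν : ℝ, IsLargestRealZero (nuPoly ℓ) ν ∧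
          HasGrowthRate (pinClassCount (oneEllWord ℓ)) ν ∧
          HasGrowthRate (pinClassCount w) ν) := by
  have upper : ∀ w, IsPinSequence w → lowerGrowthRate (pinClassCount w) < ENNReal.ofReal μ →
      (∀ᶠ i in atTop, isUp w i = true) → _ := fun w hw hlt hup =>
    let ⟨_, _, htail⟩ := exists_upperTail hw hup
    htail.classification hμ hlt
  by_cases hU : ∀ b, ∃ᶠ i in atTop, isUp w i = b
  · by_cases hR : ∀ a, ∃ᶠ i in atTop, isRight w i = a
    · -- all four directions recur, so that the growth is larger than `μ`
      have hle : ENNReal.ofReal 3.3 ≤ lowerGrowthRate (pinClassCount w) := by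
        by_cases hq : ∀ a b, ∃ᶠ i in atTop, isRight w i = a ∧ isUp w i = b
        · exact le_lowerGrowthRate_of_four_quadrants hq
        · push Not at hq
          obtain ⟨a, b, hq⟩ := hq
          exact le_lowerGrowthRate_of_avoided_quadrant hw hR hU
            (hq.mono fun i hi h => hi h.1 h.2)
      exact absurd ((ENNReal.ofReal_le_ofReal (mu_bounds hμ).2.le).trans hle) hlt.not_ge
    · push Not at hR
      obtain ⟨a, hR⟩ := hR
      cases a
      · have := upper (fun i => (w i).swap) hw.swap (by rwa [pinClassCount_swap])
          (by simpa only [isUp_swap, ne_eq, Bool.not_eq_false] using hR)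
        rw [pinClassCount_swap] at this
        exact ⟨this.1.of_comp PinLetter.swap_injective, this.2⟩
      · have := upper (fun i => (w i).flipX.swap) hw.flipX.swap
          (by rwa [pinClassCount_swap fun i => (w i).flipX, pinClassCount_flipX])
          (by simpa only [isUp_swap fun i => (w i).flipX, isRight_flipX, ne_eq, Bool.not_eq_true,
            Bool.not_eq_true'] using hR)
        rw [pinClassCount_swap fun i => (w i).flipX, pinClassCount_flipX] at this
        exact ⟨this.1.of_comp (PinLetter.swap_injective.comp PinLetter.flipX_injective), this.2⟩
  · push Not at hU
    obtain ⟨b, hU⟩ := hU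
    cases b
    · exact upper w hw hlt (by simpa only [ne_eq, Bool.not_eq_false] using hU)
    · have := upper (fun i => (w i).flipY) hw.flipY (by rwa [pinClassCount_flipY])
        (by simpa only [isUp_flipY, ne_eq, Bool.not_eq_true, Bool.not_eq_true'] using hU)
      rw [pinClassCount_flipY] at this
      exact ⟨this.1.of_comp PinLetter.flipY_injective, this.2⟩
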